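/- Let $d\in\{2,3\}$, let $\Omega\subset\mathbb R^d$ be a bounded domain with Lipschitz boundary, and put $H=L^2(\Omega)$, $V=H^1(\Omega)$, $(J*u)(x)=\int_\Omega J(x-y)u(y)\,dy$ and $a(x)=\int_\Omega J(x-y)\,dy$. Assume: - (H1) $J\in W^{1,1}(\mathbb R^d)$, $J(-x)=J(x)$, and $a\ge 0$ a.e. in $\Omega$; - (H2) $F\in C^{2,1}_{\rm loc}(\mathbb R)$ and there is $c_0>0$ with $F''(s)+\inf_\Omega a\ge c_0$ for all $s\in\mathbb R$; - (H3) there are $c_1>\frac12\|J\|_{L^1(\mathbb R^d)}$ and $c_2\in\mathbb R$ with $F(s)\ge c_1s^2-c_2$ for all $s\in\mathbb R$; - (H4) there are $c_3>0$, $c_4\ge0$ and $p\in(1,2]$ with $|F'(s)|^p\le c_3|F(s)|+c_4$ for all $s\in\mathbb R$; - (H5) there are $c_5,c_6>0$ and $q>0$ with $F''(s)+\inf_\Omega a\ge c_5|s|^{2q}-c_6$ for all $s\in\mathbb R$; - if $d=3$, then moreover $q\ge\frac12$ and $p\in(\frac65,2]$. For $T>0$, a weak solution on $[0,T]$ of the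 nonlocal Cahn–Hilliard problem $$\partial_t\varphi=\Delta\mu,\qquad \mu=a\varphi-J*\varphi+F'(\varphi)\ \text{ in }\Omega,\qquad \partial_{\mathbf n}\mu=0\ \text{ on }\partial\Omega,\qquad \varphi(0)=\varphi_0,$$ is a function $\varphi\in C([0,T];H)\cap L^2(0,T;V)\cap L^\infty(0,T;L^{2+2q}(\Omega))$ with $\varphi(0)=\varphi_0$, $\partial_t\varphi\in L^2(0,T;V')$, $\mu\in L^2(0,T;V)$, $F(\varphi)\in L^\infty(0,T;L^1(\Omega))$ and, for every $\psi\in V$, $\langle\partial_t\varphi,\psi\rangle+(\nabla\mu,\nabla\psi)=0$ a.e. in $(0,T)$. A global weak solution is a function on $[0,\infty)$ that is a weak solution on $[0,T]$ for every $T>0$. For $m\ge0$ let $\mathcal Y_m=\{\psi\in H: F(\psi)\in L^1(\Omega),\ |\langle\psi\rangle|\le m\}$, where $\langle\psi\rangle=|\Omega|^{-1}\int_\Omega\psi\,dx$, with the metric $$d(\psi_1,\psi_2)=\|\psi_1-\psi_2\|_H+\Big|\int_\Omega F(\psi_1)\,dx-\int_\Omega F(\psi_2)\,dx\Big|^{1/2},$$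 and for $B\subset\mathcal Y_m$ let $S(t)B$ be the set of the values $\varphi(t)$ of the global weak solutions $\varphi$ with $\varphi(0)\in B$. Then for every $m\ge 0$ the following hold. 1. For every $\tau>0$ there is a constant $C_{m,\tau}>0$, independent of the initial datum, such that every global weak solution $\varphi$ with $\varphi(0)\in\mathcal Y_m$ satisfies $$\sup_{t\ge2\tau}\|\varphi(t)\|_{L^\infty(\Omega)}\le C_{m,\tau}.$$ 2. There is $R_0>0$ (independent of time, of $\tau$ and of the initial data) such that $\mathcal B(R_0)=\{\psi\in\mathcal Y_m:\|\psi\|_{L^\infty(\Omega)}\le R_0\}$ is an absorbing set for $S(t)$ on $\mathcal Y_m$: for every $B\subset\mathcal Y_m$ that is bounded for the metric $d$ there is $t_0\ge0$ such that $S(t)B\subset\mathcal B(R_0)$ for all $t\ge t_0$. -/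

import Mathlib

open MeasureTheory Set
open scoped ContDiff ENNReal

noncomputable section

namespace NonlocalCH

/-- `ℝ^d` with its Euclidean norm. -/
abbrev E (d : ℕ) : Type := EuclideanSpace ℝ (Fin d)

/-! ### The domain -/

/-- Near every boundary point, `Ω` is, after a rotation that turns the unit vector `e` into the
last basis vector, the strict epigraph of a Lipschitz function. The function `g` is only used on
the hyperplane orthogonal to `e`. -/
def HasLipschitzBoundary {d : ℕ} (Ω : Set (E d)) : Prop :=
  ∀ x ∈ frontier Ω, ∃ r > 0, ∃ e : E d, ‖e‖ = 1 ∧ ∃ (K : NNReal) (g : E d → ℝ),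
    LipschitzWith K g ∧ ∀ y ∈ Metric.ball x r,
      (y ∈ Ω ↔ g (y - inner ℝ y e • e) < inner ℝ y e)

/-- A bounded domain (nonempty connected open set) with Lipschitz boundary. -/
structure IsBoundedLipschitzDomain {d : ℕ} (Ω : Set (E d)) : Prop where
  isOpen : IsOpen Ω
  isConnected : IsConnected Ω
  isBounded : Bornology.IsBounded Ω
  lipschitz : HasLipschitzBoundary Ω

/-! ### Function spaces -/

/-- Smooth functions with compact support in `U`. -/
structure IsTestFunction {X : Type*} [NormedAddCommGroup X] [NormedSpace ℝ X] (U : Set X)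
    (η : X → ℝ) : Prop where
  smooth : ContDiff ℝ ∞ η
  compact : HasCompactSupport η
  support : tsupport η ⊆ U

/-- `G` is the weak gradient of `u` on `U` (used for `u`, `G` integrable on bounded sets). -/
def HasWeakGradient {d : ℕ} (U : Set (E d)) (u : E d → ℝ) (G : E d → E d) : Prop :=
  ∀ η : E d → ℝ, IsTestFunction U η → ∀ v : E d,
    ∫ x in U, u x * fderiv ℝ η x v = -∫ x in U, inner ℝ (G x) v * η x

/-- `J ∈ W^{1,1}(ℝ^d)`. -/
def MemW11 {d : ℕ} (J : E d → ℝ) : Prop :=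
  MemLp J 1 volume ∧ ∃ G : E d → E d, MemLp G 1 volume ∧ HasWeakGradient univ J G

/-- `H = L²(Ω)`. -/
abbrev H {d : ℕ} (Ω : Set (E d)) : Type := Lp ℝ 2 (volume.restrict Ω)

/-- `L²(Ω; ℝ^d)`. -/
abbrev Hvec {d : ℕ} (Ω : Set (E d)) : Type := Lp (E d) 2 (volume.restrict Ω)

theorem integrable_mul_fderiv {d : ℕ} {Ω : Set (E d)} (u : H Ω) {η : E d → ℝ}
    (hη : IsTestFunction Ω η) (v : E d) :
    Integrable (fun x => u x * fderiv ℝ η x v) (volume.restrict Ω) := by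
  have hc : Continuous fun x => fderiv ℝ η x v :=
    (hη.smooth.continuous_fderiv (by simp)).clm_apply continuous_const
  have hs : HasCompactSupport fun x => fderiv ℝ η x v := hη.compact.fderiv_apply ℝ v
  exact MemLp.integrable_mul (p := 2) (q := 2) (Lp.memLp u) (hc.memLp_of_hasCompactSupport hs)

theorem integrable_inner_mul {d : ℕ} {Ω : Set (E d)} (G : Hvec Ω) {η : E d → ℝ}
    (hη : IsTestFunction Ω η) (v : E d) :
    Integrable (fun x => inner ℝ (G x) v * η x) (volume.restrict Ω) :=
  MemLp.integrable_mul (p := 2) (q := 2) ((Lp.memLp G).inner_const v)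
    (hη.smooth.continuous.memLp_of_hasCompactSupport hη.compact)

/-- The space of pairs `(u, ∇u)` in `L²(Ω) × L²(Ω; ℝ^d)`. -/
def sobolev {d : ℕ} (Ω : Set (E d)) : Submodule ℝ (WithLp 2 (H Ω × Hvec Ω)) where
  carrier := {w | HasWeakGradient Ω w.fst w.snd}
  zero_mem' := by
    intro η _ v
    have h1 : (fun x => ((0 : H Ω) : E d → ℝ) x * fderiv ℝ η x v)
        =ᵐ[volume.restrict Ω] fun _ => 0 := by
      filter_upwards [Lp.coeFn_zero ℝ 2 (volume.restrict Ω)] with x hx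
      rw [hx]; simp
    have h2 : (fun x => inner ℝ (((0 : Hvec Ω) : E d → E d) x) v * η x)
        =ᵐ[volume.restrict Ω] fun _ => 0 := by
      filter_upwards [Lp.coeFn_zero (E d) 2 (volume.restrict Ω)] with x hx
      rw [hx]; simp
    simp only [WithLp.zero_fst, WithLp.zero_snd]
    rw [integral_congr_ae h1, integral_congr_ae h2]
    simp
  add_mem' := by
    intro w z hw hz η hη v
    have h1 : (fun x => ((w.fst + z.fst : H Ω) : E d → ℝ) x * fderiv ℝ η x v)
        =ᵐ[volume.restrict Ω]
          fun x => w.fst x * fderiv ℝ η x v + z.fst x * fderiv ℝ η x v := by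
      filter_upwards [Lp.coeFn_add w.fst z.fst] with x hx
      rw [hx, Pi.add_apply, add_mul]
    have h2 : (fun x => inner ℝ (((w.snd + z.snd : Hvec Ω) : E d → E d) x) v * η x)
        =ᵐ[volume.restrict Ω]
          fun x => inner ℝ (w.snd x) v * η x + inner ℝ (z.snd x) v * η x := by
      filter_upwards [Lp.coeFn_add w.snd z.snd] with x hx
      rw [hx, Pi.add_apply, inner_add_left, add_mul]
    simp only [WithLp.add_fst, WithLp.add_snd]
    rw [integral_congr_ae h1, integral_congr_ae h2,
      integral_add (integrable_mul_fderiv _ hη v) (integrable_mul_fderiv _ hη v),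
      integral_add (integrable_inner_mul _ hη v) (integrable_inner_mul _ hη v),
      hw η hη v, hz η hη v]
    ring
  smul_mem' := by
    intro c w hw η hη v
    have h1 : (fun x => ((c • w.fst : H Ω) : E d → ℝ) x * fderiv ℝ η x v)
        =ᵐ[volume.restrict Ω] fun x => c * (w.fst x * fderiv ℝ η x v) := by
      filter_upwards [Lp.coeFn_smul c w.fst] with x hx
      rw [hx, Pi.smul_apply, smul_eq_mul, mul_assoc]
    have h2 : (fun x => inner ℝ (((c • w.snd : Hvec Ω) : E d → E d) x) v * η x)
        =ᵐ[volume.restrict Ω] fun x => c * (inner ℝ (w.snd x) v * η x) := by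
      filter_upwards [Lp.coeFn_smul c w.snd] with x hx
      rw [hx, Pi.smul_apply, real_inner_smul_left, mul_assoc]
    simp only [WithLp.smul_fst, WithLp.smul_snd]
    rw [integral_congr_ae h1, integral_congr_ae h2, integral_const_mul, integral_const_mul,
      hw η hη v]
    ring

/-- `V = H¹(Ω)`, realised as the space of pairs `(u, ∇u)`, with the norm `(‖u‖² + ‖∇u‖²)^{1/2}`. -/
def V {d : ℕ} (Ω : Set (E d)) : Type := sobolev Ω

instance {d : ℕ} (Ω : Set (E d)) : NormedAddCommGroup (V Ω) :=
  inferInstanceAs (NormedAddCommGroup (sobolev Ω))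

instance {d : ℕ} (Ω : Set (E d)) : InnerProductSpace ℝ (V Ω) :=
  inferInstanceAs (InnerProductSpace ℝ (sobolev Ω))

/-- The element of `L²(Ω)` underlying an element of `H¹(Ω)`. -/
def toL2 {d : ℕ} {Ω : Set (E d)} (w : V Ω) : H Ω := w.1.fst

/-- The weak gradient of an element of `H¹(Ω)`. -/
def weakGrad {d : ℕ} {Ω : Set (E d)} (w : V Ω) : Hvec Ω := w.1.snd

/-- The dual space `V'` of `V`, with the dual norm. -/
def V' {d : ℕ} (Ω : Set (E d)) : Type := StrongDual ℝ (V Ω)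

instance {d : ℕ} (Ω : Set (E d)) : NormedAddCommGroup (V' Ω) :=
  inferInstanceAs (NormedAddCommGroup (StrongDual ℝ (V Ω)))

instance {d : ℕ} (Ω : Set (E d)) : NormedSpace ℝ (V' Ω) :=
  inferInstanceAs (NormedSpace ℝ (StrongDual ℝ (V Ω)))

/-- The duality product `⟨g, ψ⟩` of `V'` and `V`. -/
def duality {d : ℕ} {Ω : Set (E d)} (g : V' Ω) (ψ : V Ω) : ℝ :=
  (show StrongDual ℝ (V Ω) from g) ψ

/-! ### Kernel and potential -/

/-- `(J * u)(x) = ∫_Ω J(x - y) u(y) dy`. -/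
def conv {d : ℕ} (Ω : Set (E d)) (J u : E d → ℝ) (x : E d) : ℝ := ∫ y in Ω, J (x - y) * u y

/-- `a(x) = ∫_Ω J(x - y) dy`. -/
def aCoef {d : ℕ} (Ω : Set (E d)) (J : E d → ℝ) (x : E d) : ℝ := ∫ y in Ω, J (x - y)

/-- `J ∈ W^{1,1}(ℝ^d)` is even and `a ≥ 0` a.e. in `Ω`. -/
structure KernelAssumption {d : ℕ} (Ω : Set (E d)) (J : E d → ℝ) : Prop where
  memW11 : MemW11 J
  even : ∀ᵐ x : E d, J (-x) = J x
  nonneg : ∀ᵐ x ∂volume.restrict Ω, 0 ≤ aCoef Ω J x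

/-- `F ∈ C^{2,1}_loc(ℝ)` and `F'' + inf_Ω a ≥ c₀ > 0`. -/
structure ConvexityAssumption {d : ℕ} (Ω : Set (E d)) (J : E d → ℝ) (F : ℝ → ℝ) : Prop where
  contDiff : ContDiff ℝ 2 F
  locLip : LocallyLipschitz (deriv (deriv F))
  lower : ∃ c₀ > 0, ∀ s : ℝ, c₀ ≤ deriv (deriv F) s + sInf (aCoef Ω J '' Ω)

/-- `F(s) ≥ c₁ s² - c₂` with `c₁ > ‖J‖_{L¹(ℝ^d)} / 2`. -/
def CoercivityAssumption {d : ℕ} (J : E d → ℝ) (F : ℝ → ℝ) : Prop :=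
  ∃ c₁ c₂ : ℝ, (∫ x, |J x|) / 2 < c₁ ∧ ∀ s : ℝ, c₁ * s ^ 2 - c₂ ≤ F s

/-- `|F'(s)|^p ≤ c₃ |F(s)| + c₄` with `p ∈ (1, 2]`. -/
def GrowthAssumption (F : ℝ → ℝ) (p : ℝ) : Prop :=
  1 < p ∧ p ≤ 2 ∧ ∃ c₃ c₄ : ℝ, 0 < c₃ ∧ 0 ≤ c₄ ∧ ∀ s : ℝ, |deriv F s| ^ p ≤ c₃ * |F s| + c₄

/-- `F'' (s) + inf_Ω a ≥ c₅ |s|^{2q} - c₆` with `q > 0`. -/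
def SuperlinearAssumption {d : ℕ} (Ω : Set (E d)) (J : E d → ℝ) (F : ℝ → ℝ) (q : ℝ) : Prop :=
  0 < q ∧ ∃ c₅ c₆ : ℝ, 0 < c₅ ∧ 0 < c₆ ∧
    ∀ s : ℝ, c₅ * |s| ^ (2 * q) - c₆ ≤ deriv (deriv F) s + sInf (aCoef Ω J '' Ω)

/-! ### Weak solutions -/

/-- `g` is the weak time derivative of `φ` in `V'` on `(0, T)`, where `H` is embedded in `V'`
through the inner product of `H`. -/
def HasWeakTimeDeriv {d : ℕ} {Ω : Set (E d)} (T : ℝ) (φ : ℝ → H Ω)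
    (g : ℝ → V' Ω) : Prop :=
  ∀ θ : ℝ → ℝ, IsTestFunction (Ioo 0 T) θ → ∀ ψ : V Ω,
    ∫ t in Ioo 0 T, deriv θ t * inner ℝ (φ t) (toL2 ψ) = -∫ t in Ioo 0 T, θ t * duality (g t) ψ

/-- Weak solutions on `[0, T]` of `∂ₜφ = Δμ`, `μ = aφ - J * φ + F'(φ)` with the no-flux boundary
condition `∂ₙμ = 0`. -/
structure IsWeakSolutionOn {d : ℕ} (Ω : Set (E d)) (J : E d → ℝ) (F : ℝ → ℝ) (q T : ℝ)
    (φ : ℝ → H Ω) : Prop where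
  /-- `φ ∈ C([0, T]; H)` -/
  continuousOn : ContinuousOn φ (Icc 0 T)
  /-- `φ ∈ L²(0, T; V)` -/
  memL2V : ∃ w : ℝ → V Ω, MemLp w 2 (volume.restrict (Ioo 0 T)) ∧
    ∀ᵐ t ∂volume.restrict (Ioo 0 T), toL2 (w t) = φ t
  /-- `φ ∈ L^∞(0, T; L^{2+2q}(Ω))` -/
  bddLq : ∃ M : NNReal, ∀ᵐ t ∂volume.restrict (Ioo 0 T),
    eLpNorm (φ t) (ENNReal.ofReal (2 + 2 * q)) (volume.restrict Ω) ≤ M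
  /-- `F(φ) ∈ L^∞(0, T; L¹(Ω))` -/
  bddF : ∃ M : ℝ, ∀ᵐ t ∂volume.restrict (Ioo 0 T),
    IntegrableOn (fun x => F (φ t x)) Ω ∧ ∫ x in Ω, |F (φ t x)| ≤ M
  /-- `∂ₜφ ∈ L²(0, T; V')`, `μ ∈ L²(0, T; V)`, and the weak form of the equation -/
  equation : ∃ (φ' : ℝ → V' Ω) (μ : ℝ → V Ω),
    MemLp φ' 2 (volume.restrict (Ioo 0 T)) ∧
    MemLp μ 2 (volume.restrict (Ioo 0 T)) ∧
    HasWeakTimeDeriv T φ φ' ∧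
    (∀ᵐ t ∂volume.restrict (Ioo 0 T), ∀ᵐ x ∂volume.restrict Ω,
      toL2 (μ t) x = aCoef Ω J x * φ t x - conv Ω J (φ t) x + deriv F (φ t x)) ∧
    ∀ ψ : V Ω, ∀ᵐ t ∂volume.restrict (Ioo 0 T), duality (φ' t) ψ + inner ℝ (weakGrad (μ t)) (weakGrad ψ) = 0

/-- `φ` is a weak solution on `[0, T]` for every `T > 0`, with initial value `φ₀`. Only the values
`φ t` with `t ≥ 0` matter. -/
def IsGlobalWeakSolution {d : ℕ} (Ω : Set (E d)) (J : E d → ℝ) (F : ℝ → ℝ) (q : ℝ) (φ₀ : H Ω)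
    (φ : ℝ → H Ω) : Prop :=
  φ 0 = φ₀ ∧ ∀ T > 0, IsWeakSolutionOn Ω J F q T φ

/-! ### The phase space and absorbing sets -/

/-- `Y_m = {ψ ∈ H : F(ψ) ∈ L¹(Ω), |⟨ψ⟩| ≤ m}`, where `⟨ψ⟩` is the mean value over `Ω`. -/
def Y {d : ℕ} (Ω : Set (E d)) (F : ℝ → ℝ) (m : ℝ) : Set (H Ω) :=
  {ψ | IntegrableOn (fun x => F (ψ x)) Ω ∧ |⨍ x in Ω, ψ x| ≤ m}

/-- The metric of `Y_m`. -/
def distY {d : ℕ} {Ω : Set (E d)} (F : ℝ → ℝ) (ψ₁ ψ₂ : H Ω) : ℝ :=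
  ‖ψ₁ - ψ₂‖ + √|(∫ x in Ω, F (ψ₁ x)) - ∫ x in Ω, F (ψ₂ x)|

/-- `S(t) B`: the values at time `t` of the global weak solutions that start in `B`. -/
def flowImage {d : ℕ} (Ω : Set (E d)) (J : E d → ℝ) (F : ℝ → ℝ) (q : ℝ) (t : ℝ)
    (B : Set (H Ω)) : Set (H Ω) :=
  {ψ | ∃ φ₀ ∈ B, ∃ φ : ℝ → H Ω, IsGlobalWeakSolution Ω J F q φ₀ φ ∧ φ t = ψ}

/-- The ball of radius `R` of `L^∞(Ω)`, inside `Y_m`. -/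
def ballLinfty {d : ℕ} (Ω : Set (E d)) (F : ℝ → ℝ) (m R : ℝ) : Set (H Ω) :=
  {ψ | ψ ∈ Y Ω F m ∧ eLpNorm ψ ∞ (volume.restrict Ω) ≤ ENNReal.ofReal R}

/-- `A` is an absorbing set of the semiflow `S(t)` on `Y_m`: every subset `B` of `Y_m` that is
bounded for the metric of `Y_m` satisfies `S(t) B ⊆ A` for all `t` from some time on. -/
def IsAbsorbing {d : ℕ} (Ω : Set (E d)) (J : E d → ℝ) (F : ℝ → ℝ) (q m : ℝ)
    (A : Set (H Ω)) : Prop :=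
  ∀ B ⊆ Y Ω F m, (∃ M : ℝ, ∀ ψ₁ ∈ B, ∀ ψ₂ ∈ B, distY F ψ₁ ψ₂ ≤ M) →
    ∃ t₀ ≥ 0, ∀ t ≥ t₀, flowImage Ω J F q t B ⊆ A

end NonlocalCH

end

open NonlocalCH

/-! The proof follows the functionals y(t) = ∫ Ψ(φ(t)) with Ψ'' = ρ². Testing the equation with
Ψ'(φ) gives, formally, y' = -∫ ρ(φ)² ∇μ·∇φ, where ∇μ = (a + F''(φ))∇φ + φ∇a - ∇J * φ. The first term
is coercive because a + F'' ≥ c₀. The other two are absorbed by Young's inequality at the price of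
c₀/2, and a Schur test for the kernel ∇J ∈ L¹ leaves only a source D ∫ ρ(φ)²φ² (`dissipation_le`).
The remaining part of the coercive term is the dissipation; two stages exploit it differently.

L² bound, ρ = 1. The superlinear growth of F'' makes the dissipation large where |φ| is large: above
a level k it controls a multiple of k^{2q'}|∇φ|², for some exponent 0 < q' ≤ 1. Poincaré's
inequality for φ with its values below the level k damped, together with conservation of mass, then
bounds ‖φ‖² up to an error of order k² (`exists_variance_le`). Letting k depend on the elapsed time
δ so that k^{2q'} ~ 1/δ produces y' ≤ b δ^(-σ-1) - (σ+1) y/δ. Any such y lies below 2b δ^(-σ),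
whatever its initial value (`le_rpow_of_integral_inequality`). Hence
`exists_integral_sq_le_of_global`, whose constant sees the initial datum only through m.

L^∞ bound, ρ a truncated power. This is a Moser iteration. A Nash type inequality at a length scale
of order √δ/(j+2) turns a bound for the truncated power of order j+2 into one for order 2(j+2), at
the end of a short time interval (`exists_integral_truncPow_le`). Over intervals of length τ/2^(n+1)
the constants grow geometrically in n, which is harmless against exponents that double. Chebyshev's
inequality then shows that {|φ| ≥ k} is null for a suitable k (`exists_ae_abs_le_of_global`).

Two formal steps need justification. F'' is unbounded, so the chain rule is applied not to F'(φ) but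
to the inverse of s ↦ F'(s) + (inf a)s, whose derivative is bounded
(`ae_eq_grad_chemicalPotential`). And ∂ₜφ lies only in V', so the chain rule in time is replaced by
convexity of Ψ on increments of length h, with an error removed by continuity of translations in
L²(0,T) (`integral_primitive_sub_le`). The Poincaré and Nash inequalities are derived from an L²
estimate for translates and the interior cone property of Lipschitz domains.

Since the final bound does not depend on the initial datum, the choice τ = 1 gives an absorbing ball
with the same entrance time for every B. -/

namespace NonlocalCH

open Filter Topology

/-! ### Mollification. -/

section

/-- Weighted Cauchy-Schwarz inequality. -/
theorem lintegral_mul_sq_le {α : Type*} [MeasurableSpace α] {μ : Measure α} {k g : α → ℝ≥0∞}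
    (hk : AEMeasurable k μ) (hg : AEMeasurable g μ) :
    (∫⁻ x, k x * g x ∂μ) ^ 2 ≤ (∫⁻ x, k x ∂μ) * ∫⁻ x, k x * g x ^ 2 ∂μ := by
  have h := ENNReal.lintegral_mul_le_Lp_mul_Lq μ Real.HolderConjugate.two_two
    (f := fun x => k x ^ (1 / 2 : ℝ)) (g := fun x => k x ^ (1 / 2 : ℝ) * g x)
    (hk.pow_const _) ((hk.pow_const _).mul hg)
  have e (z : ℝ≥0∞) : z ^ (1 / 2 : ℝ) * z ^ (1 / 2 : ℝ) = z := by
    rw [← ENNReal.rpow_add_of_nonneg _ _ (by norm_num) (by norm_num)]; norm_num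
  have e' (z : ℝ≥0∞) : (z ^ (1 / 2 : ℝ)) ^ (2 : ℝ) = z := by
    rw [← ENNReal.rpow_mul]; norm_num
  have e3 (z : ℝ≥0∞) : (z ^ (1 / 2 : ℝ)) ^ 2 = z := by
    rw [sq, e]
  simp only [Pi.mul_apply, ← mul_assoc, e, ENNReal.mul_rpow_of_nonneg _ _ (zero_le_two (α := ℝ)), e']
    at h
  calc _ ≤ _ := pow_le_pow_left' h 2
    _ = _ := by
      rw [mul_pow, e3, e3]
      simp

variable {d : ℕ}

/-- A sequence of normed bump functions that concentrates at the origin. -/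
noncomputable def mollifier (n : ℕ) : ContDiffBump (0 : E d) where
  rIn := 1 / (2 * (n + 1))
  rOut := 1 / (n + 1)
  rIn_pos := by positivity
  rIn_lt_rOut := by
    apply one_div_lt_one_div_of_lt <;> [positivity; linarith [(Nat.cast_nonneg n : (0 : ℝ) ≤ n)]]

/-- Mollification of a function on the whole space. -/
noncomputable def mollify (n : ℕ) (f : E d → ℝ) (x : E d) : ℝ :=
  ∫ y, (mollifier n).normed volume (x - y) * f y

theorem mollify_eq_convolution (n : ℕ) (f : E d → ℝ) :
    mollify n f = convolution ((mollifier n).normed volume) f (ContinuousLinearMap.lsmul ℝ ℝ)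
      volume := by
  ext x
  rw [convolution_eq_swap]
  rfl

theorem mollify_contDiff (n : ℕ) {f : E d → ℝ} (hf : LocallyIntegrable f) :
    ContDiff ℝ ∞ (mollify n f) := by
  rw [mollify_eq_convolution]
  exact (mollifier n).hasCompactSupport_normed.contDiff_convolution_left _
    (mollifier n).contDiff_normed hf

theorem mollify_ae_tendsto {f : E d → ℝ} (hf : LocallyIntegrable f) :
    ∀ᵐ x, Tendsto (fun n => mollify n f x) atTop (𝓝 (f x)) := by
  simp only [mollify_eq_convolution]
  -- The outer radius of `mollifier` is exactly twice the inner one; a bounded ratio is what the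
  -- Lebesgue differentiation theorem needs.
  refine ContDiffBump.ae_convolution_tendsto_right_of_locallyIntegrable (K := 2) ?_
    (Eventually.of_forall fun n => ?_) hf
  · exact tendsto_one_div_add_atTop_nhds_zero_nat
  · simp only [mollifier]
    apply le_of_eq
    field_simp

theorem lintegral_enorm_mollifier (n : ℕ) :
    ∫⁻ x : E d, ‖(mollifier n).normed volume x‖ₑ = 1 := by
  have h := (mollifier (d := d) n).integral_normed (μ := volume)
  rw [← ofReal_integral_norm_eq_lintegral_enorm (mollifier n).integrable_normed]
  simp only [Real.norm_of_nonneg ((mollifier n).nonneg_normed _)]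
  rw [h]; simp

theorem enorm_mollify_le (n : ℕ) (f : E d → ℝ) (x : E d) :
    ‖mollify n f x‖ₑ ≤ ∫⁻ y, ‖(mollifier n).normed volume (x - y)‖ₑ * ‖f y‖ₑ := by
  refine (enorm_integral_le_lintegral_enorm _).trans_eq ?_
  simp only [enorm_mul]

theorem measurable_enorm_mollifier_sub (n : ℕ) : Measurable fun z : E d × E d =>
    ‖(mollifier n).normed volume (z.1 - z.2)‖ₑ :=
  (((mollifier n).continuous_normed (μ := volume)).comp
    (continuous_fst.sub continuous_snd)).measurable.enorm

/-- Tonelli, translation invariance and the unit mass of the kernel. Both contraction bounds for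
`mollify` follow from it. -/
theorem lintegral_mollifier_conv (n : ℕ) {g : E d → ℝ≥0∞} (hg : AEMeasurable g) :
    ∫⁻ x, ∫⁻ y, ‖(mollifier n).normed volume (x - y)‖ₑ * g y = ∫⁻ y, g y := by
  rw [lintegral_lintegral_swap]
  · refine lintegral_congr fun y => ?_
    rw [lintegral_mul_const'', lintegral_sub_right_eq_self
      (fun z => ‖(mollifier n).normed volume z‖ₑ), lintegral_enorm_mollifier, one_mul]
    exact ((measurable_enorm_mollifier_sub n).comp measurable_prodMk_right).aemeasurable
  · exact (measurable_enorm_mollifier_sub n).aemeasurable.mul hg.comp_snd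

theorem lintegral_enorm_mollify_le (n : ℕ) {f : E d → ℝ} (hf : AEStronglyMeasurable f) :
    ∫⁻ x, ‖mollify n f x‖ₑ ≤ ∫⁻ x, ‖f x‖ₑ :=
  (lintegral_mono fun x => enorm_mollify_le n f x).trans_eq (lintegral_mollifier_conv n hf.enorm)

/-- Jensen's inequality for the probability density ρₙ(x - ·), in the form of the weighted
Cauchy–Schwarz inequality, and then Tonelli. -/
theorem lintegral_enorm_mollify_sq_le (n : ℕ) {f : E d → ℝ} (hf : AEStronglyMeasurable f) :
    ∫⁻ x, ‖mollify n f x‖ₑ ^ 2 ≤ ∫⁻ x, ‖f x‖ₑ ^ 2 := by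
  rw [← lintegral_mollifier_conv n (hf.enorm.pow_const 2)]
  refine lintegral_mono fun x => ?_
  refine (pow_le_pow_left' (enorm_mollify_le n f x) 2).trans ?_
  have hm := (measurable_enorm_mollifier_sub (d := d) n).comp (measurable_prodMk_left (x := x))
  refine (lintegral_mul_sq_le hm.aemeasurable hf.enorm).trans_eq ?_
  simp only [Function.comp_apply]
  rw [lintegral_sub_left_eq_self (fun z => ‖(mollifier n).normed volume z‖ₑ),
    lintegral_enorm_mollifier, one_mul]

/-- Almost everywhere convergence together with a bound of the `L¹` norms by the `L¹` norm of
the limit implies convergence in `L¹`. -/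
theorem tendsto_lintegral_enorm_sub_of_le {α : Type*} [MeasurableSpace α] {μ : Measure α}
    {f : ℕ → α → ℝ} {g : α → ℝ} (hf : ∀ n, AEStronglyMeasurable (f n) μ) (hg : Integrable g μ)
    (hle : ∀ n, ∫⁻ x, ‖f n x‖ₑ ∂μ ≤ ∫⁻ x, ‖g x‖ₑ ∂μ)
    (hlim : ∀ᵐ x ∂μ, Tendsto (fun n => f n x) atTop (𝓝 (g x))) :
    Tendsto (fun n => ∫⁻ x, ‖f n x - g x‖ₑ ∂μ) atTop (𝓝 0) := by
  -- Scheffé's argument: s lies between 0 and 2|g|, so dominated convergence applies to it although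
  -- no dominating function for f n is known. The bound on the norms then transfers the limit to |f
  -- n - g|.
  set s : ℕ → α → ℝ := fun n x => |f n x - g x| + |g x| - |f n x| with hs
  have hs0 (n x) : 0 ≤ s n x := by
    have := abs_add_le (f n x - g x) (g x)
    simp only [hs]
    rw [sub_add_cancel] at this
    linarith
  have hs1 (n x) : s n x ≤ 2 * |g x| := by
    have := abs_sub (f n x) (g x)
    simp only [hs]
    linarith
  have hsm (n) : AEStronglyMeasurable (s n) μ :=
    (((hf n).sub hg.1).norm.add hg.1.norm).sub (hf n).norm
  have hlim' : Tendsto (fun n => ∫⁻ x, ‖s n x‖ₑ ∂μ) atTop (𝓝 0) := by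
    have := tendsto_lintegral_of_dominated_convergence' (μ := μ) (F := fun n x => ‖s n x‖ₑ)
      (f := fun _ => 0) (fun x => ‖2 * |g x|‖ₑ) (fun n => (hsm n).enorm) (fun n => ?_) ?_ ?_
    · simpa using this
    · refine Eventually.of_forall fun x => ?_
      rw [enorm_le_iff_norm_le, Real.norm_of_nonneg (hs0 n x), Real.norm_of_nonneg (by positivity)]
      exact hs1 n x
    · exact (hg.abs.const_mul 2).2.ne
    · filter_upwards [hlim] with x hx
      have : Tendsto (fun n => ‖s n x‖ₑ) atTop (𝓝 ‖|g x - g x| + |g x| - |g x|‖ₑ) :=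
        ((((hx.sub_const _).abs).add_const _).sub hx.abs).enorm
      simpa using this
  refine tendsto_of_tendsto_of_tendsto_of_le_of_le tendsto_const_nhds hlim' (fun _ => zero_le)
    fun n => ?_
  have hI : ∫⁻ x, ‖g x‖ₑ ∂μ ≠ ⊤ := hg.2.ne
  refine ENNReal.le_of_add_le_add_right hI ?_
  calc ∫⁻ x, ‖f n x - g x‖ₑ ∂μ + ∫⁻ x, ‖g x‖ₑ ∂μ = ∫⁻ x, (‖f n x - g x‖ₑ + ‖g x‖ₑ) ∂μ :=
        (lintegral_add_right' _ hg.1.enorm).symm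
    _ = ∫⁻ x, (‖s n x‖ₑ + ‖f n x‖ₑ) ∂μ := by
        refine lintegral_congr fun x => ?_
        simp only [Real.enorm_eq_ofReal_abs]
        rw [← ENNReal.ofReal_add (abs_nonneg _) (abs_nonneg _),
          ← ENNReal.ofReal_add (abs_nonneg _) (abs_nonneg _), abs_of_nonneg (hs0 n x)]
        simp [hs]
    _ = ∫⁻ x, ‖s n x‖ₑ ∂μ + ∫⁻ x, ‖f n x‖ₑ ∂μ := lintegral_add_right' _ (hf n).enorm
    _ ≤ _ := add_le_add_right (hle n) _

theorem mollify_tendsto_L1 {f : E d → ℝ} (hf : Integrable f) :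
    Tendsto (fun n => ∫⁻ x, ‖mollify n f x - f x‖ₑ) atTop (𝓝 0) :=
  tendsto_lintegral_enorm_sub_of_le
    (fun n => (mollify_contDiff n hf.locallyIntegrable).continuous.aestronglyMeasurable) hf
    (fun n => lintegral_enorm_mollify_le n hf.1) (mollify_ae_tendsto hf.locallyIntegrable)

/-- In the interior, the derivative of the mollification of a function with a weak gradient is
the mollification of the weak gradient. -/
theorem fderiv_mollify {Ω : Set (E d)} (hΩ : MeasurableSet Ω) {u : E d → ℝ} {G : E d → E d}
    (hu : IntegrableOn u Ω) (hG : HasWeakGradient Ω u G) (n : ℕ) {x : E d}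
    (hx : Metric.closedBall x (1 / (n + 1)) ⊆ Ω) (v : E d) :
    fderiv ℝ (mollify n (Ω.indicator u)) x v
      = mollify n (Ω.indicator fun y => inner ℝ (G y) v) x := by
  set ρ := (mollifier (d := d) n).normed volume with hρ
  have hρs : ContDiff ℝ ∞ ρ := (mollifier n).contDiff_normed
  have hρc : HasCompactSupport ρ := (mollifier n).hasCompactSupport_normed
  have hui : Integrable (Ω.indicator u) := hu.integrable_indicator hΩ
  have h1 := hρc.hasFDerivAt_convolution_left (ContinuousLinearMap.lsmul ℝ ℝ)
    (hρs.of_le (by simp)) hui.locallyIntegrable x (μ := volume)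
  rw [mollify_eq_convolution, h1.fderiv, convolution_eq_swap]
  have hint := (hρc.fderiv (𝕜 := ℝ)).convolutionExists_left
    ((ContinuousLinearMap.lsmul ℝ ℝ).precompL (E d)) (hρs.continuous_fderiv (by simp))
    hui.locallyIntegrable x
  rw [ContinuousLinearMap.integral_apply (ConvolutionExistsAt.integrable_swap hint)]
  -- The closed ball of radius 1/(n+1) around x lies in Ω, so the reflected kernel is an admissible
  -- test function for the weak gradient.
  set η : E d → ℝ := fun y => ρ (x - y) with hη
  have hηt : IsTestFunction Ω η := by
    refine ⟨hρs.comp (contDiff_const.sub contDiff_id),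
      hρc.comp_homeomorph (Homeomorph.subLeft x), ?_⟩
    refine Subset.trans ?_ hx
    refine closure_minimal ?_ Metric.isClosed_closedBall
    intro y hy
    have : x - y ∈ Function.support ρ := hy
    rw [hρ, ContDiffBump.support_normed_eq, mem_ball_zero_iff] at this
    rw [Metric.mem_closedBall, dist_comm, dist_eq_norm]
    exact this.le
  have hder (y : E d) : fderiv ℝ η y v = -fderiv ℝ ρ (x - y) v := by
    have h := ((hρs.differentiable (by simp)) (x - y)).hasFDerivAt.comp y
      ((hasFDerivAt_const x y).sub (hasFDerivAt_id y))
    rw [show η = ρ ∘ fun y => x - y from rfl, HasFDerivAt.fderiv h]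
    simp
  have h2 := hG η hηt v
  have e1 : ∫ y, ((((ContinuousLinearMap.lsmul ℝ ℝ).precompL (E d)) (fderiv ℝ ρ (x - y)))
      (Ω.indicator u y)) v = -∫ y in Ω, u y * fderiv ℝ η y v := by
    rw [← integral_neg, ← integral_indicator hΩ]
    refine integral_congr_ae (Eventually.of_forall fun y => ?_)
    simp only [ContinuousLinearMap.precompL_apply, ContinuousLinearMap.lsmul_apply, smul_eq_mul]
    by_cases hy : y ∈ Ω
    · simp only [indicator_of_mem hy, hder]; ring
    · simp [indicator_of_notMem hy]
  rw [e1, h2, neg_neg, ← integral_indicator hΩ]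
  refine integral_congr_ae (Eventually.of_forall fun y => ?_)
  by_cases hy : y ∈ Ω
  · simp only [indicator_of_mem hy, hη, hρ]; ring
  · simp [indicator_of_notMem hy]

end

/-! ### Chain rule and product rule for weak gradients. -/

section

/-- L¹ convergence against a fixed bounded factor: the device by which the weak identities below
pass to the limit in the mollification parameter. -/
theorem tendsto_integral_mul_of_L1 {α : Type*} [MeasurableSpace α] {μ : Measure α}
    {f : ℕ → α → ℝ} {g c : α → ℝ} {M : ℝ} (hf : ∀ n, AEStronglyMeasurable (f n) μ)
    (hg : Integrable g μ) (hc : AEStronglyMeasurable c μ) (hM : ∀ᵐ x ∂μ, |c x| ≤ M)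
    (hlim : Tendsto (fun n => ∫⁻ x, ‖f n x - g x‖ₑ ∂μ) atTop (𝓝 0)) :
    Tendsto (fun n => ∫ x, f n x * c x ∂μ) atTop (𝓝 (∫ x, g x * c x ∂μ)) := by
  have hfi : ∀ᶠ n in atTop, Integrable (f n) μ := by
    filter_upwards [hlim.eventually (gt_mem_nhds (show (0 : ℝ≥0∞) < 1 by simp))] with n hn
    have : Integrable (fun x => f n x - g x) μ := ⟨(hf n).sub hg.1, hn.trans (by simp)⟩
    exact (this.add hg).congr (Eventually.of_forall fun x => by simp)
  have hM' : ∀ᵐ x ∂μ, ‖c x‖ ≤ M := hM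
  refine tendsto_integral_of_L1 _ (hg.mul_bdd hc hM').1
    (hfi.mono fun n hn => hn.mul_bdd hc hM') ?_
  have h0 : Tendsto (fun n => (∫⁻ x, ‖f n x - g x‖ₑ ∂μ) * ENNReal.ofReal M) atTop (𝓝 0) := by
    simpa using ENNReal.Tendsto.mul_const hlim (Or.inr ENNReal.ofReal_ne_top)
  refine tendsto_of_tendsto_of_tendsto_of_le_of_le tendsto_const_nhds h0 (fun _ => zero_le)
    fun n => ?_
  dsimp only
  rw [← lintegral_mul_const' _ _ ENNReal.ofReal_ne_top]
  refine lintegral_mono_ae ?_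
  filter_upwards [hM] with x hx
  rw [← sub_mul, enorm_mul]
  gcongr
  rw [Real.enorm_eq_ofReal_abs]
  exact ENNReal.ofReal_le_ofReal hx

variable {d : ℕ} {Ω : Set (E d)} {u : E d → ℝ} {G : E d → E d}

theorem IsTestFunction.continuous_fderiv_apply {η : E d → ℝ} (hη : IsTestFunction Ω η) (v : E d) :
    Continuous fun x => fderiv ℝ η x v :=
  (hη.smooth.continuous_fderiv (by simp)).clm_apply continuous_const

theorem IsTestFunction.exists_bound {η : E d → ℝ} (hη : IsTestFunction Ω η) :
    ∃ M, 0 ≤ M ∧ ∀ x, |η x| ≤ M := by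
  obtain ⟨M, hM⟩ := hη.smooth.continuous.bounded_above_of_compact_support hη.compact
  exact ⟨M, (norm_nonneg _).trans (hM 0), hM⟩

theorem IsTestFunction.exists_bound_fderiv {η : E d → ℝ} (hη : IsTestFunction Ω η) (v : E d) :
    ∃ M, 0 ≤ M ∧ ∀ x, |fderiv ℝ η x v| ≤ M := by
  obtain ⟨M, hM⟩ := (hη.continuous_fderiv_apply v).bounded_above_of_compact_support
    (hη.compact.fderiv_apply ℝ v)
  exact ⟨M, (norm_nonneg _).trans (hM 0), hM⟩

theorem IsTestFunction.eq_zero {η : E d → ℝ} (hη : IsTestFunction Ω η) {x : E d} (hx : x ∉ Ω) :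
    η x = 0 :=
  image_eq_zero_of_notMem_tsupport fun h => hx (hη.support h)

theorem IsTestFunction.fderiv_eq_zero {η : E d → ℝ} (hη : IsTestFunction Ω η) {x : E d}
    (hx : x ∉ Ω) (v : E d) : fderiv ℝ η x v = 0 := by
  have : x ∉ tsupport (fderiv ℝ η) := fun h => hx (hη.support (tsupport_fderiv_subset ℝ h))
  rw [image_eq_zero_of_notMem_tsupport this]
  rfl

/-- Mollifications of a function with a weak gradient, near the support of a test function. -/
theorem eventually_fderiv_mollify (hΩ : IsOpen Ω) (hu : IntegrableOn u Ω)
    (hG : HasWeakGradient Ω u G) {K : Set (E d)} (hK : IsCompact K) (hKΩ : K ⊆ Ω) (v : E d) :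
    ∀ᶠ n in atTop, ∀ x ∈ K, fderiv ℝ (mollify n (Ω.indicator u)) x v
      = mollify n (Ω.indicator fun y => inner ℝ (G y) v) x := by
  obtain ⟨δ, hδ, hδΩ⟩ := hK.exists_cthickening_subset_open hΩ hKΩ
  filter_upwards [tendsto_one_div_add_atTop_nhds_zero_nat.eventually (gt_mem_nhds hδ)] with n hn x hx
  refine fderiv_mollify hΩ.measurableSet hu hG n ?_ v
  exact ((Metric.closedBall_subset_closedBall hn.le).trans
    (Metric.closedBall_subset_cthickening hx δ)).trans hδΩ

theorem mollify_indicator_tendsto_L1 (hΩ : MeasurableSet Ω) (hu : IntegrableOn u Ω) :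
    Tendsto (fun n => ∫⁻ x in Ω, ‖mollify n (Ω.indicator u) x - u x‖ₑ) atTop (𝓝 0) := by
  refine tendsto_of_tendsto_of_tendsto_of_le_of_le tendsto_const_nhds
    (mollify_tendsto_L1 (hu.integrable_indicator hΩ)) (fun _ => zero_le) fun n => ?_
  calc ∫⁻ x in Ω, ‖mollify n (Ω.indicator u) x - u x‖ₑ
      = ∫⁻ x in Ω, ‖mollify n (Ω.indicator u) x - Ω.indicator u x‖ₑ :=
        setLIntegral_congr_fun hΩ fun x hx => by simp only [indicator_of_mem hx]
    _ ≤ _ := setLIntegral_le_lintegral _ _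

theorem mollify_indicator_ae_tendsto (hΩ : MeasurableSet Ω) (hu : IntegrableOn u Ω) :
    ∀ᵐ x ∂volume.restrict Ω, Tendsto (fun n => mollify n (Ω.indicator u) x) atTop (𝓝 (u x)) := by
  have h := mollify_ae_tendsto (hu.integrable_indicator hΩ).locallyIntegrable
  filter_upwards [ae_restrict_of_ae h, ae_restrict_mem hΩ] with x hx hxΩ
  rwa [indicator_of_mem hxΩ] at hx

theorem mollify_indicator_contDiff (hΩ : MeasurableSet Ω) (hu : IntegrableOn u Ω) (n : ℕ) :
    ContDiff ℝ ∞ (mollify n (Ω.indicator u)) :=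
  mollify_contDiff n (hu.integrable_indicator hΩ).locallyIntegrable

/-- Integration by parts against a test function for continuously differentiable functions. -/
theorem setIntegral_mul_fderiv_testFunction {η f : E d → ℝ} (hη : IsTestFunction Ω η)
    (hf : ContDiff ℝ 1 f) (v : E d) :
    ∫ x in Ω, f x * fderiv ℝ η x v = -∫ x in Ω, fderiv ℝ f x v * η x := by
  rw [setIntegral_eq_integral_of_forall_compl_eq_zero
      (fun x hx => by rw [hη.fderiv_eq_zero hx, mul_zero]),
    setIntegral_eq_integral_of_forall_compl_eq_zero (fun x hx => by rw [hη.eq_zero hx, mul_zero])]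
  have hc := hη.smooth.continuous
  have hc' := hη.continuous_fderiv_apply v
  have hf' : Continuous fun x => fderiv ℝ f x v :=
    (hf.continuous_fderiv (by simp)).clm_apply continuous_const
  refine integral_mul_fderiv_eq_neg_fderiv_mul_of_integrable ?_ ?_ ?_ ?_ ?_
  · exact (hf'.mul hc).integrable_of_hasCompactSupport hη.compact.mul_left
  · exact (hf.continuous.mul hc').integrable_of_hasCompactSupport
      (hη.compact.fderiv_apply ℝ v).mul_left
  · exact (hf.continuous.mul hc).integrable_of_hasCompactSupport hη.compact.mul_left
  · exact fun x _ => hf.differentiable (by simp) x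
  · exact fun x _ => hη.smooth.differentiable (by simp) x

/-- Chain rule for weak gradients. -/
theorem HasWeakGradient.comp (hΩ : IsOpen Ω) (hu : IntegrableOn u Ω) (hG : IntegrableOn G Ω)
    (h : HasWeakGradient Ω u G) {ψ ψ' : ℝ → ℝ} {M : ℝ} (hψ : ∀ s, HasDerivAt ψ (ψ' s) s)
    (hψ' : Continuous ψ') (hM : ∀ s, |ψ' s| ≤ M) :
    HasWeakGradient Ω (fun x => ψ (u x)) (fun x => ψ' (u x) • G x) := by
  intro η hη v
  have hm := hΩ.measurableSet
  set un : ℕ → E d → ℝ := fun n => mollify n (Ω.indicator u) with hun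
  set gn : ℕ → E d → ℝ := fun n => mollify n (Ω.indicator fun y => inner ℝ (G y) v) with hgn
  have hGv : IntegrableOn (fun y => inner ℝ (G y) v) Ω := hG.inner_const v
  have hψc : Continuous ψ := continuous_iff_continuousAt.2 fun s => (hψ s).continuousAt
  have hψL (a b : ℝ) : |ψ a - ψ b| ≤ M * |a - b| :=
    Convex.norm_image_sub_le_of_norm_hasDerivWithin_le (f := ψ) (s := univ)
      (fun x _ => (hψ x).hasDerivWithinAt) (fun x _ => hM x) convex_univ (mem_univ b) (mem_univ a)
  have hM0 : 0 ≤ M := (abs_nonneg _).trans (hM 0)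
  have huns (n) : ContDiff ℝ ∞ (un n) := mollify_indicator_contDiff hm hu n
  have hgns (n) : ContDiff ℝ ∞ (gn n) := mollify_indicator_contDiff hm hGv n
  have key : ∀ᶠ n in atTop, ∫ x in Ω, ψ (un n x) * fderiv ℝ η x v
      = -∫ x in Ω, (ψ' (un n x) * gn n x) * η x := by
    filter_upwards [eventually_fderiv_mollify hΩ hu h hη.compact hη.support v] with n hn
    have hψd : ContDiff ℝ 1 ψ := by
      rw [contDiff_one_iff_deriv]
      refine ⟨fun s => (hψ s).differentiableAt, ?_⟩
      rwa [show deriv ψ = ψ' from funext fun s => (hψ s).deriv]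
    have h0 := setIntegral_mul_fderiv_testFunction hη (hψd.comp ((huns n).of_le (by simp))) v
    simp only [Function.comp_apply] at h0
    rw [h0]
    congr 1
    refine setIntegral_congr_fun hm fun x _ => ?_
    by_cases hx : x ∈ tsupport η
    · rw [
        HasFDerivAt.fderiv ((hψ _).comp_hasFDerivAt x
          ((huns n).differentiable (by simp) x).hasFDerivAt)]
      simp [hn x hx, hun, hgn]
    · rw [image_eq_zero_of_notMem_tsupport hx]; simp
  -- Ω may have infinite measure and ψ 0 may be nonzero, so ψ ∘ u need not be integrable. The
  -- difference ψ(uₙ) - ψ(u) does tend to 0 in L¹, by the Lipschitz bound, and this suffices against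
  -- the derivative of η.
  have hL : Tendsto (fun n => ∫ x in Ω, (ψ (un n x) - ψ (u x)) * fderiv ℝ η x v) atTop
      (𝓝 (∫ x in Ω, (0 : ℝ) * fderiv ℝ η x v)) := by
    obtain ⟨C, hC0, hC⟩ := hη.exists_bound_fderiv v
    refine tendsto_integral_mul_of_L1 (M := C) (fun n => ?_) (integrable_zero _ _ _)
      (hη.continuous_fderiv_apply v).aestronglyMeasurable (Eventually.of_forall hC) ?_
    · exact (hψc.comp (huns n).continuous).aestronglyMeasurable.sub
        (hψc.comp_aestronglyMeasurable hu.1)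
    · have h0 := ENNReal.Tendsto.const_mul (a := ENNReal.ofReal M)
        (mollify_indicator_tendsto_L1 hm hu) (Or.inr ENNReal.ofReal_ne_top)
      rw [mul_zero] at h0
      refine tendsto_of_tendsto_of_tendsto_of_le_of_le tendsto_const_nhds h0 (fun _ => zero_le)
        fun n => ?_
      dsimp only
      rw [← lintegral_const_mul' _ _ ENNReal.ofReal_ne_top]
      refine lintegral_mono fun x => ?_
      dsimp only
      rw [sub_zero, Real.enorm_eq_ofReal_abs, Real.enorm_eq_ofReal_abs, ← ENNReal.ofReal_mul hM0]
      exact ENNReal.ofReal_le_ofReal (hψL _ _)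
  have hR : Tendsto (fun n => ∫ x in Ω, (ψ' (un n x) * gn n x) * η x) atTop
      (𝓝 (∫ x in Ω, (ψ' (u x) * inner ℝ (G x) v) * η x)) := by
    obtain ⟨C, hC0, hC⟩ := hη.exists_bound
    refine tendsto_integral_mul_of_L1 (M := C) (fun n => ?_) ?_
      hη.smooth.continuous.aestronglyMeasurable (Eventually.of_forall hC) ?_
    · exact ((hψ'.comp (huns n).continuous).mul (hgns n).continuous).aestronglyMeasurable
    · exact hGv.bdd_mul (hψ'.comp_aestronglyMeasurable hu.1) (Eventually.of_forall fun x => hM _)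
    -- ψ' is only bounded and continuous, so this half of the splitting ψ'(uₙ)(gₙ - g) + (ψ'(uₙ) -
    -- ψ'(u))g uses a.e. convergence and domination by 2M|g|. The other half uses L¹ convergence of
    -- gₙ.
    · have h1 : Tendsto (fun n => ∫⁻ x in Ω, ‖(ψ' (un n x) - ψ' (u x)) * inner ℝ (G x) v‖ₑ) atTop
          (𝓝 0) := by
        have := tendsto_lintegral_of_dominated_convergence' (μ := volume.restrict Ω)
          (F := fun n x => ‖(ψ' (un n x) - ψ' (u x)) * inner ℝ (G x) v‖ₑ)
          (f := fun _ => 0) (fun x => ‖(2 * M) * inner ℝ (G x) v‖ₑ) (fun n => ?_) (fun n => ?_) ?_ ?_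
        · simpa using this
        · exact (((hψ'.comp (huns n).continuous).aestronglyMeasurable.sub
            (hψ'.comp_aestronglyMeasurable hu.1)).mul hGv.1).enorm
        · refine Eventually.of_forall fun x => ?_
          rw [enorm_le_iff_norm_le, norm_mul, norm_mul]
          gcongr
          rw [Real.norm_of_nonneg (mul_nonneg zero_le_two hM0), Real.norm_eq_abs]
          exact (abs_sub _ _).trans (by linarith [hM (un n x), hM (u x)])
        · exact (hGv.const_mul (2 * M)).2.ne
        · filter_upwards [mollify_indicator_ae_tendsto hm hu] with x hx
          have : Tendsto (fun n => ‖(ψ' (un n x) - ψ' (u x)) * inner ℝ (G x) v‖ₑ) atTop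
              (𝓝 ‖(ψ' (u x) - ψ' (u x)) * inner ℝ (G x) v‖ₑ) :=
            (((((hψ'.tendsto _).comp hx).sub_const _).mul_const _)).enorm
          simpa using this
      have h2 := ENNReal.Tendsto.const_mul (a := ENNReal.ofReal M)
        (mollify_indicator_tendsto_L1 hm hGv) (Or.inr ENNReal.ofReal_ne_top)
      have h3 := h2.add h1
      rw [mul_zero, add_zero] at h3
      refine tendsto_of_tendsto_of_tendsto_of_le_of_le tendsto_const_nhds h3 (fun _ => zero_le)
        fun n => ?_
      dsimp only
      rw [← lintegral_const_mul' _ _ ENNReal.ofReal_ne_top, ← lintegral_add_right']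
      · refine lintegral_mono fun x => ?_
        dsimp only
        have e : ψ' (un n x) * gn n x - ψ' (u x) * inner ℝ (G x) v
          = ψ' (un n x) * (gn n x - inner ℝ (G x) v)
            + (ψ' (un n x) - ψ' (u x)) * inner ℝ (G x) v := by ring
        rw [e]
        refine (enorm_add_le _ _).trans ?_
        gcongr
        rw [enorm_mul]
        gcongr
        rw [Real.enorm_eq_ofReal_abs]
        exact ENNReal.ofReal_le_ofReal (hM _)
      · exact (((hψ'.comp (huns n).continuous).aestronglyMeasurable.sub
            (hψ'.comp_aestronglyMeasurable hu.1)).mul hGv.1).enorm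
  have hψu : IntegrableOn (fun x => ψ (u x) * fderiv ℝ η x v) Ω := by
    have e : (fun x => ψ (u x) * fderiv ℝ η x v)
        = fun x => (ψ (u x) - ψ 0) * fderiv ℝ η x v + ψ 0 * fderiv ℝ η x v := by
      ext x; ring
    rw [e]
    obtain ⟨C, hC0, hC⟩ := hη.exists_bound_fderiv v
    refine Integrable.add ?_ ?_
    · refine Integrable.mul_bdd (c := C) ?_ (hη.continuous_fderiv_apply v).aestronglyMeasurable
        (Eventually.of_forall hC)
      refine (hu.norm.const_mul M).mono' ((hψc.comp_aestronglyMeasurable hu.1).sub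
        aestronglyMeasurable_const) (Eventually.of_forall fun x => ?_)
      simpa using hψL (u x) 0
    · exact (((hη.continuous_fderiv_apply v).integrable_of_hasCompactSupport
        (hη.compact.fderiv_apply ℝ v)).const_mul _).integrableOn
  have hψun (n) : IntegrableOn (fun x => ψ (un n x) * fderiv ℝ η x v) Ω :=
    (((hψc.comp (huns n).continuous).mul
      (hη.continuous_fderiv_apply v)).integrable_of_hasCompactSupport
        (hη.compact.fderiv_apply ℝ v).mul_left).integrableOn
  have hL' : Tendsto (fun n => ∫ x in Ω, ψ (un n x) * fderiv ℝ η x v) atTop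
      (𝓝 (∫ x in Ω, ψ (u x) * fderiv ℝ η x v)) := by
    have := hL.add_const (∫ x in Ω, ψ (u x) * fderiv ℝ η x v)
    simp only [zero_mul, integral_zero, zero_add] at this
    refine this.congr fun n => ?_
    simp only [sub_mul]
    rw [integral_sub (hψun n) hψu]
    ring
  have := tendsto_nhds_unique (hL'.congr' key) hR.neg
  rw [this]
  congr 1
  refine integral_congr_ae (Eventually.of_forall fun x => ?_)
  simp only [real_inner_smul_left]

/-- Product rule for weak gradients, one factor being bounded with a bounded weak gradient. -/
theorem HasWeakGradient.mul_bounded (hΩ : IsOpen Ω) (hu : IntegrableOn u Ω)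
    (hG : IntegrableOn G Ω) (h : HasWeakGradient Ω u G) {a : E d → ℝ} {A : E d → E d} {M N : ℝ}
    (ha : AEStronglyMeasurable a (volume.restrict Ω))
    (hA : AEStronglyMeasurable A (volume.restrict Ω))
    (haM : ∀ᵐ x ∂volume.restrict Ω, |a x| ≤ M) (hAN : ∀ᵐ x ∂volume.restrict Ω, ‖A x‖ ≤ N)
    (haA : HasWeakGradient Ω a A) :
    HasWeakGradient Ω (fun x => a x * u x) (fun x => a x • G x + u x • A x) := by
  intro η hη v
  have hm := hΩ.measurableSet
  set un : ℕ → E d → ℝ := fun n => mollify n (Ω.indicator u) with hun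
  set gn : ℕ → E d → ℝ := fun n => mollify n (Ω.indicator fun y => inner ℝ (G y) v) with hgn
  have hGv : IntegrableOn (fun y => inner ℝ (G y) v) Ω := hG.inner_const v
  have huns (n) : ContDiff ℝ ∞ (un n) := mollify_indicator_contDiff hm hu n
  have hgns (n) : ContDiff ℝ ∞ (gn n) := mollify_indicator_contDiff hm hGv n
  obtain ⟨C, hC0, hC⟩ := hη.exists_bound
  obtain ⟨C', hC0', hC'⟩ := hη.exists_bound_fderiv v
  have hAv : AEStronglyMeasurable (fun x => inner ℝ (A x) v) (volume.restrict Ω) :=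
    hA.inner aestronglyMeasurable_const
  have hηm := hη.smooth.continuous.aestronglyMeasurable (μ := volume.restrict Ω)
  have hη'm := (hη.continuous_fderiv_apply v).aestronglyMeasurable (μ := volume.restrict Ω)
  have c1m : AEStronglyMeasurable (fun x => a x * fderiv ℝ η x v) (volume.restrict Ω) :=
    ha.mul hη'm
  have c2m : AEStronglyMeasurable (fun x => inner ℝ (A x) v * η x) (volume.restrict Ω) :=
    hAv.mul hηm
  have c3m : AEStronglyMeasurable (fun x => a x * η x) (volume.restrict Ω) := ha.mul hηm
  have c1b : ∀ᵐ x ∂volume.restrict Ω, |a x * fderiv ℝ η x v| ≤ M * C' := by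
    filter_upwards [haM] with x hx
    rw [abs_mul]
    exact mul_le_mul hx (hC' x) (abs_nonneg _) ((abs_nonneg _).trans hx)
  have c2b : ∀ᵐ x ∂volume.restrict Ω, |inner ℝ (A x) v * η x| ≤ (N * ‖v‖) * C := by
    filter_upwards [hAN] with x hx
    rw [abs_mul]
    have : |inner ℝ (A x) v| ≤ N * ‖v‖ := (abs_real_inner_le_norm _ _).trans (by gcongr)
    exact mul_le_mul this (hC x) (abs_nonneg _) ((abs_nonneg _).trans this)
  have c3b : ∀ᵐ x ∂volume.restrict Ω, |a x * η x| ≤ M * C := by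
    filter_upwards [haM] with x hx
    rw [abs_mul]
    exact mul_le_mul hx (hC x) (abs_nonneg _) ((abs_nonneg _).trans hx)
  have l1 := tendsto_integral_mul_of_L1 (fun n => (huns n).continuous.aestronglyMeasurable) hu c1m
    c1b (mollify_indicator_tendsto_L1 hm hu)
  have l2 := tendsto_integral_mul_of_L1 (fun n => (huns n).continuous.aestronglyMeasurable) hu c2m
    c2b (mollify_indicator_tendsto_L1 hm hu)
  have l3 := tendsto_integral_mul_of_L1 (fun n => (hgns n).continuous.aestronglyMeasurable) hGv c3m
    c3b (mollify_indicator_tendsto_L1 hm hGv)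
  have key : ∀ᶠ n in atTop, ∫ x in Ω, un n x * (a x * fderiv ℝ η x v)
      = -(∫ x in Ω, un n x * (inner ℝ (A x) v * η x)) - ∫ x in Ω, gn n x * (a x * η x) := by
    filter_upwards [eventually_fderiv_mollify hΩ hu h hη.compact hη.support v] with n hn
    -- Only u is mollified: uₙη is then itself a test function, and the weak gradient of a can be
    -- applied to it directly.
    have hηu : IsTestFunction Ω (fun x => un n x * η x) :=
      ⟨(huns n).mul hη.smooth, hη.compact.mul_left,
        (closure_mono (Function.support_mul_subset_right _ _)).trans hη.support⟩
    have hd (x : E d) : fderiv ℝ (fun x => un n x * η x) x v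
        = un n x * fderiv ℝ η x v + gn n x * η x := by
      have h1 := (huns n).differentiable (by simp) x
      have h2 := hη.smooth.differentiable (by simp) x
      rw [fderiv_fun_mul h1 h2]
      simp only [add_apply, smul_apply, smul_eq_mul]
      by_cases hx : x ∈ tsupport η
      · rw [hn x hx]; ring
      · rw [image_eq_zero_of_notMem_tsupport hx]; simp
    have h0 := haA _ hηu v
    simp only [hd] at h0
    have i1 : IntegrableOn (fun x => un n x * (a x * fderiv ℝ η x v)) Ω := by
      have := (((huns n).continuous.mul (hη.continuous_fderiv_apply
        v)).integrable_of_hasCompactSupport (μ := volume)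
          (hη.compact.fderiv_apply ℝ v).mul_left).integrableOn (s := Ω)
      refine (this.bdd_mul ha haM).congr (Eventually.of_forall fun x => ?_)
      simp only [Pi.mul_apply]; ring
    have i3 : IntegrableOn (fun x => gn n x * (a x * η x)) Ω := by
      have := (((hgns n).continuous.mul hη.smooth.continuous).integrable_of_hasCompactSupport
        (μ := volume) hη.compact.mul_left).integrableOn (s := Ω)
      refine (this.bdd_mul ha haM).congr (Eventually.of_forall fun x => ?_)
      simp only [Pi.mul_apply]; ring
    have e1 : ∫ x in Ω, a x * (un n x * fderiv ℝ η x v + gn n x * η x)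
        = (∫ x in Ω, un n x * (a x * fderiv ℝ η x v)) + ∫ x in Ω, gn n x * (a x * η x) := by
      rw [← integral_add i1 i3]
      refine integral_congr_ae (Eventually.of_forall fun x => ?_)
      ring
    have e2 : ∫ x in Ω, inner ℝ (A x) v * (un n x * η x)
        = ∫ x in Ω, un n x * (inner ℝ (A x) v * η x) :=
      integral_congr_ae (Eventually.of_forall fun x => by ring)
    rw [e1, e2] at h0
    linarith
  have hlim := tendsto_nhds_unique (l1.congr' key) (l2.neg.sub l3)
  have i2 : IntegrableOn (fun x => u x * (inner ℝ (A x) v * η x)) Ω := hu.mul_bdd c2m c2b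
  have i3 : IntegrableOn (fun x => inner ℝ (G x) v * (a x * η x)) Ω := hGv.mul_bdd c3m c3b
  calc ∫ x in Ω, a x * u x * fderiv ℝ η x v = ∫ x in Ω, u x * (a x * fderiv ℝ η x v) :=
        integral_congr_ae (Eventually.of_forall fun x => by ring)
    _ = -((∫ x in Ω, u x * (inner ℝ (A x) v * η x)) + ∫ x in Ω, inner ℝ (G x) v * (a x * η x)) := by
        rw [hlim]; ring
    _ = _ := by
        rw [← integral_add i2 i3]
        congr 1
        refine integral_congr_ae (Eventually.of_forall fun x => ?_)
        simp only [inner_add_left, real_inner_smul_left]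
        ring

end

/-! ### Convolution with an integrable kernel. -/

section

variable {d : ℕ} {Ω : Set (E d)} {u J : E d → ℝ} {K : E d → E d}

/-- Convolution over `Ω` with a vector field. -/
noncomputable def convVec (Ω : Set (E d)) (K : E d → E d) (u : E d → ℝ) (x : E d) : E d :=
  ∫ y in Ω, u y • K (x - y)

theorem integrable_conv_integrand (hJ : Integrable J) (hu : IntegrableOn u Ω) :
    Integrable (fun z : E d × E d => J (z.1 - z.2) * u z.2)
      (volume.prod (volume.restrict Ω)) := by
  refine (Integrable.convolution_integrand (ContinuousLinearMap.lsmul ℝ ℝ) hu hJ).congr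
    (Eventually.of_forall fun z => ?_)
  simp [mul_comm]

theorem integrable_convVec_integrand (hK : Integrable K) (hu : IntegrableOn u Ω) :
    Integrable (fun z : E d × E d => u z.2 • K (z.1 - z.2))
      (volume.prod (volume.restrict Ω)) :=
  (Integrable.convolution_integrand (ContinuousLinearMap.lsmul ℝ ℝ) hu hK).congr
    (Eventually.of_forall fun z => by simp)

theorem integrable_conv (hJ : Integrable J) (hu : IntegrableOn u Ω) : Integrable (conv Ω J u) :=
  (integrable_conv_integrand hJ hu).integral_prod_left

theorem integrable_convVec (hK : Integrable K) (hu : IntegrableOn u Ω) :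
    Integrable (convVec Ω K u) :=
  (integrable_convVec_integrand hK hu).integral_prod_left

/-- The weak gradient may be put on the kernel of a convolution. -/
theorem hasWeakGradient_conv (hJ : Integrable J) (hK : Integrable K)
    (h : HasWeakGradient univ J K) (hu : IntegrableOn u Ω) :
    HasWeakGradient Ω (conv Ω J u) (convVec Ω K u) := by
  intro η hη v
  obtain ⟨C, hC0, hC⟩ := hη.exists_bound
  obtain ⟨C', hC0', hC'⟩ := hη.exists_bound_fderiv v
  have hηm := hη.smooth.continuous.aestronglyMeasurable (μ := (volume : Measure (E d)))
  have hη'm := (hη.continuous_fderiv_apply v).aestronglyMeasurable (μ := (volume : Measure (E d)))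
  rw [setIntegral_eq_integral_of_forall_compl_eq_zero
      (fun x hx => by rw [hη.fderiv_eq_zero hx, mul_zero]),
    setIntegral_eq_integral_of_forall_compl_eq_zero (fun x hx => by rw [hη.eq_zero hx, mul_zero])]
  have i1 : Integrable (fun z : E d × E d => J (z.1 - z.2) * u z.2 * fderiv ℝ η z.1 v)
      (volume.prod (volume.restrict Ω)) :=
    (integrable_conv_integrand hJ hu).mul_bdd (c := C') hη'm.comp_fst
      (Eventually.of_forall fun z => hC' _)
  have i2 : Integrable (fun z : E d × E d => inner ℝ (u z.2 • K (z.1 - z.2)) v * η z.1)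
      (volume.prod (volume.restrict Ω)) :=
    ((integrable_convVec_integrand hK hu).inner_const v).mul_bdd (c := C) hηm.comp_fst
      (Eventually.of_forall fun z => hC _)
  have e1 : ∫ x, conv Ω J u x * fderiv ℝ η x v
      = ∫ y in Ω, ∫ x, J (x - y) * u y * fderiv ℝ η x v := by
    rw [← integral_integral_swap i1]
    simp only [conv, integral_mul_const]
  have e2 : ∫ x, inner ℝ (convVec Ω K u x) v * η x
      = ∫ y in Ω, ∫ x, inner ℝ (u y • K (x - y)) v * η x := by
    rw [← integral_integral_swap i2]
    refine integral_congr_ae ?_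
    filter_upwards [(integrable_convVec_integrand hK hu).prod_right_ae] with x hx
    rw [integral_mul_const]
    congr 1
    have := integral_inner (𝕜 := ℝ) hx v
    rw [real_inner_comm, convVec, ← this]
    exact integral_congr_ae (Eventually.of_forall fun y => real_inner_comm _ _)
  rw [e1, e2, ← integral_neg]
  refine integral_congr_ae (Eventually.of_forall fun y => ?_)
  dsimp only
  -- After Fubini, y is frozen and x is shifted by y. The shifted test function leaves Ω, so the
  -- weak gradient of the kernel is needed on the whole space.
  have hηt : IsTestFunction univ fun z => η (z + y) :=
    ⟨hη.smooth.comp (contDiff_id.add contDiff_const),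
      hη.compact.comp_homeomorph (Homeomorph.addRight y), subset_univ _⟩
  have h0 := h _ hηt v
  simp only [Measure.restrict_univ, fderiv_comp_add_right] at h0
  rw [← integral_add_right_eq_self _ y]
  simp only [add_sub_cancel_right]
  rw [← integral_add_right_eq_self (fun x => inner ℝ (u y • K (x - y)) v * η x) y]
  simp only [add_sub_cancel_right, real_inner_smul_left]
  calc ∫ x, J x * u y * fderiv ℝ η (x + y) v = u y * ∫ x, J x * fderiv ℝ η (x + y) v := by
        rw [← integral_const_mul]
        exact integral_congr_ae (Eventually.of_forall fun x => by ring)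
    _ = _ := by
        rw [h0, mul_neg, ← integral_const_mul]
        congr 1
        exact integral_congr_ae (Eventually.of_forall fun x => by ring)

/-- Through this identity the weak gradient of a comes from the general convolution formula. -/
theorem aCoef_eq_conv : aCoef Ω J = conv Ω J fun _ => 1 := by
  ext x; simp [aCoef, conv]

theorem abs_aCoef_le (hJ : Integrable J) (x : E d) : |aCoef Ω J x| ≤ ∫ y, |J y| := by
  have hi : Integrable fun y => |J (x - y)| := (hJ.comp_sub_left x).abs
  calc |aCoef Ω J x| ≤ ∫ y in Ω, |J (x - y)| := abs_integral_le_integral_abs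
    _ ≤ ∫ y, |J (x - y)| := setIntegral_le_integral hi (Eventually.of_forall fun _ => abs_nonneg _)
    _ = _ := integral_sub_left_eq_self (fun z => |J z|) volume x

theorem norm_convVec_one_le (hK : Integrable K) (x : E d) :
    ‖convVec Ω K (fun _ => 1) x‖ ≤ ∫ y, ‖K y‖ := by
  have hi : Integrable fun y => ‖K (x - y)‖ := (hK.comp_sub_left x).norm
  calc ‖convVec Ω K (fun _ => 1) x‖ ≤ ∫ y in Ω, ‖K (x - y)‖ := by
        simp only [convVec, one_smul]; exact norm_integral_le_integral_norm _
    _ ≤ ∫ y, ‖K (x - y)‖ := setIntegral_le_integral hi (Eventually.of_forall fun _ => norm_nonneg _)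
    _ = _ := integral_sub_left_eq_self (fun z => ‖K z‖) volume x

/-- A weighted `L²` bound of a convolution, for weights that increase with the convolved
function. -/
theorem lintegral_weight_mul_convVec_sq_le (hK : Integrable K)
    (hu : AEStronglyMeasurable u (volume.restrict Ω)) {ρ : ℝ → ℝ} (hρ : Measurable ρ)
    (hmono : ∀ a b, ρ a ^ 2 * b ^ 2 ≤ ρ a ^ 2 * a ^ 2 + ρ b ^ 2 * b ^ 2) :
    ∫⁻ x in Ω, ‖ρ (u x)‖ₑ ^ 2 * ‖convVec Ω K u x‖ₑ ^ 2
      ≤ 2 * (∫⁻ z, ‖K z‖ₑ) ^ 2 * ∫⁻ x in Ω, ‖ρ (u x)‖ₑ ^ 2 * ‖u x‖ₑ ^ 2 := by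
  set ν := volume.restrict Ω with hν
  set L := ∫⁻ z, ‖K z‖ₑ with hL
  have hLtop : L ≠ ⊤ := hK.2.ne
  set Q : E d → ℝ≥0∞ := fun x => ‖ρ (u x)‖ₑ ^ 2 * ‖u x‖ₑ ^ 2 with hQ
  have hρu : AEMeasurable (fun x => ‖ρ (u x)‖ₑ ^ 2) ν :=
    ((hρ.comp_aemeasurable hu.aemeasurable).enorm.pow_const 2)
  have hQm : AEMeasurable Q ν := hρu.mul (hu.enorm.pow_const 2)
  have hKm : AEMeasurable (fun z : E d × E d => ‖K (z.1 - z.2)‖ₑ) (ν.prod ν) := by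
    have : AEMeasurable (fun z : E d × E d => ‖K (z.1 - z.2)‖ₑ) (volume.prod volume) :=
      (hK.1.comp_quasiMeasurePreserving
        (quasiMeasurePreserving_sub_of_right_invariant volume volume)).enorm
    refine this.mono_ac ?_
    exact Measure.AbsolutelyContinuous.prod (Measure.restrict_le_self.absolutelyContinuous)
      (Measure.restrict_le_self.absolutelyContinuous)
  have hKx (x : E d) : AEMeasurable (fun y => ‖K (x - y)‖ₑ) ν :=
    ((hK.comp_sub_left x).1.enorm).restrict
  have hKy (y : E d) : AEMeasurable (fun x => ‖K (x - y)‖ₑ) ν :=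
    ((hK.comp_sub_right y).1.enorm).restrict
  have hKxL (x : E d) : ∫⁻ y, ‖K (x - y)‖ₑ ∂ν ≤ L :=
    (setLIntegral_le_lintegral _ _).trans_eq (lintegral_sub_left_eq_self (fun z => ‖K z‖ₑ) x)
  have hKyL (y : E d) : ∫⁻ x, ‖K (x - y)‖ₑ ∂ν ≤ L :=
    (setLIntegral_le_lintegral _ _).trans_eq (lintegral_sub_right_eq_self (fun z => ‖K z‖ₑ) y)
  -- Cauchy–Schwarz with weight |K(x - y)| brings the square inside; `hmono` then replaces the mixed
  -- product ρ(u x)² u(y)² by Q x + Q y. What remains is Schur's test: each of the two terms costs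
  -- L², whence the factor 2.
  have hpt (x : E d) : ‖ρ (u x)‖ₑ ^ 2 * ‖convVec Ω K u x‖ₑ ^ 2
      ≤ L * ∫⁻ y, ‖K (x - y)‖ₑ * (Q x + Q y) ∂ν := by
    have h1 : ‖convVec Ω K u x‖ₑ ^ 2 ≤ L * ∫⁻ y, ‖K (x - y)‖ₑ * ‖u y‖ₑ ^ 2 ∂ν := by
      have h2 : ‖convVec Ω K u x‖ₑ ≤ ∫⁻ y, ‖K (x - y)‖ₑ * ‖u y‖ₑ ∂ν := by
        refine (enorm_integral_le_lintegral_enorm _).trans_eq ?_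
        simp only [enorm_smul, mul_comm, hν]
      refine (pow_le_pow_left' h2 2).trans ((lintegral_mul_sq_le (hKx x) hu.enorm).trans ?_)
      gcongr
      exact hKxL x
    calc ‖ρ (u x)‖ₑ ^ 2 * ‖convVec Ω K u x‖ₑ ^ 2
        ≤ ‖ρ (u x)‖ₑ ^ 2 * (L * ∫⁻ y, ‖K (x - y)‖ₑ * ‖u y‖ₑ ^ 2 ∂ν) := by gcongr
      _ = L * ∫⁻ y, ‖ρ (u x)‖ₑ ^ 2 * (‖K (x - y)‖ₑ * ‖u y‖ₑ ^ 2) ∂ν := by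
          rw [lintegral_const_mul' _ _ (by simp)]; ring
      _ ≤ _ := by
          refine mul_le_mul_right (lintegral_mono fun y => ?_) _
          dsimp only
          rw [mul_left_comm]
          refine mul_le_mul_right ?_ _
          have := hmono (u x) (u y)
          simp only [hQ, ← mul_pow, ← enorm_mul]
          simp only [Real.enorm_eq_ofReal_abs, ← ENNReal.ofReal_pow (abs_nonneg _), sq_abs]
          rw [← ENNReal.ofReal_add (sq_nonneg _) (sq_nonneg _)]
          apply ENNReal.ofReal_le_ofReal
          simpa only [mul_pow] using this
  calc ∫⁻ x, ‖ρ (u x)‖ₑ ^ 2 * ‖convVec Ω K u x‖ₑ ^ 2 ∂ν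
      ≤ ∫⁻ x, L * ∫⁻ y, ‖K (x - y)‖ₑ * (Q x + Q y) ∂ν ∂ν := lintegral_mono hpt
    _ = L * ∫⁻ x, ∫⁻ y, ‖K (x - y)‖ₑ * (Q x + Q y) ∂ν ∂ν := lintegral_const_mul' _ _ hLtop
    _ = L * ((∫⁻ x, ∫⁻ y, ‖K (x - y)‖ₑ * Q x ∂ν ∂ν) + ∫⁻ x, ∫⁻ y, ‖K (x - y)‖ₑ * Q y ∂ν ∂ν) := by
        rw [← lintegral_add_left']
        · congr 2 with x
          rw [← lintegral_add_left' ((hKx x).mul_const _)]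
          simp only [mul_add]
        · exact (hKm.mul hQm.comp_fst).lintegral_prod_right'
    _ ≤ L * (L * (∫⁻ x, Q x ∂ν) + L * ∫⁻ x, Q x ∂ν) := by
        gcongr
        · rw [← lintegral_const_mul' _ _ hLtop]
          refine lintegral_mono fun x => ?_
          dsimp only
          rw [lintegral_mul_const'' _ (hKx x)]
          gcongr
          exact hKxL x
        · rw [lintegral_lintegral_swap (hKm.mul hQm.comp_snd), ← lintegral_const_mul' _ _ hLtop]
          refine lintegral_mono fun y => ?_
          dsimp only
          rw [lintegral_mul_const'' _ (hKy y)]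
          gcongr
          exact hKyL y
    _ = _ := by ring

end

/-! ### Translates of Sobolev functions and the interior cone property. -/

section

variable {d : ℕ} {Ω : Set (E d)} {u : E d → ℝ} {G : E d → E d}

/-- The fundamental theorem of calculus and Cauchy–Schwarz on [0,1]. The derivative is prescribed
along the segment only, since the gradient of a mollification is identified only in the interior of
Ω. -/
theorem enorm_sub_sq_le_lintegral_of_segment {f g : E d → ℝ} (hf : ContDiff ℝ 1 f)
    (x z : E d) (hg : ∀ t ∈ Icc (0 : ℝ) 1, fderiv ℝ f (x + t • z) z = g (x + t • z)) :
    ‖f (x + z) - f x‖ₑ ^ 2 ≤ ∫⁻ t in Icc (0 : ℝ) 1, ‖g (x + t • z)‖ₑ ^ 2 := by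
  have hd (t : ℝ) : HasDerivAt (fun t : ℝ => f (x + t • z)) (fderiv ℝ f (x + t • z) z) t := by
    have h1 : HasDerivAt (fun t : ℝ => x + t • z) z t := by
      simpa using ((hasDerivAt_id t).smul_const z).const_add x
    exact ((hf.differentiable (by simp)) _).hasFDerivAt.comp_hasDerivAt t h1
  have hc : Continuous fun t : ℝ => fderiv ℝ f (x + t • z) z :=
    ((hf.continuous_fderiv (by simp)).comp (by fun_prop)).clm_apply continuous_const
  have h1 := intervalIntegral.integral_eq_sub_of_hasDerivAt (a := 0) (b := 1)
    (fun t _ => hd t) (hc.intervalIntegrable _ _)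
  simp only [one_smul, zero_smul, add_zero] at h1
  have h2 : ‖f (x + z) - f x‖ₑ ≤ ∫⁻ t in Icc (0 : ℝ) 1, 1 * ‖fderiv ℝ f (x + t • z) z‖ₑ := by
    rw [← h1, intervalIntegral.integral_of_le zero_le_one]
    refine (enorm_integral_le_lintegral_enorm _).trans ?_
    simp only [one_mul]
    exact lintegral_mono_set Ioc_subset_Icc_self
  refine (pow_le_pow_left' h2 2).trans
    ((lintegral_mul_sq_le aemeasurable_const hc.enorm.aemeasurable).trans_eq ?_)
  simp only [lintegral_const, Measure.restrict_apply MeasurableSet.univ, univ_inter,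
    Real.volume_Icc, sub_zero, ENNReal.ofReal_one, one_mul]
  exact setLIntegral_congr_fun measurableSet_Icc fun t ht => by simp only [hg t ht]

/-- The `L²` norm of the difference of a function and its translate is bounded by that of the
weak derivative in the direction of the translation. -/
theorem lintegral_translate_sub_sq_le (hΩ : IsOpen Ω) (hu : IntegrableOn u Ω)
    (hG : IntegrableOn G Ω) (h : HasWeakGradient Ω u G) {A : Set (E d)} (hA : MeasurableSet A)
    (z : E d) (hAz : ∀ x ∈ A, ∀ t ∈ Icc (0 : ℝ) 1, x + t • z ∈ Ω) :
    ∫⁻ x in A, ‖u (x + z) - u x‖ₑ ^ 2 ≤ ∫⁻ x in Ω, ‖inner ℝ (G x) z‖ₑ ^ 2 := by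
  have hm := hΩ.measurableSet
  have hGz : IntegrableOn (fun y => inner ℝ (G y) z) Ω := hG.inner_const z
  set un : ℕ → E d → ℝ := fun n => mollify n (Ω.indicator u) with hun
  set gn : ℕ → E d → ℝ := fun n => mollify n (Ω.indicator fun y => inner ℝ (G y) z) with hgn
  have huns (n) : ContDiff ℝ ∞ (un n) := mollify_indicator_contDiff hm hu n
  have hgns (n) : ContDiff ℝ ∞ (gn n) := mollify_indicator_contDiff hm hGz n
  -- The points whose whole segment keeps a distance of at least 2/(n+1) from the complement of Ω;
  -- the factor 2 leaves room for closed balls of radius 1/(n+1). Each set is closed, hence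
  -- measurable, and by compactness of segments every point of A belongs to it from some n on, so
  -- that Fatou's lemma concludes.
  set An : ℕ → Set (E d) := fun n => {x | ∀ t ∈ Icc (0 : ℝ) 1,
    ENNReal.ofReal (2 * (1 / (n + 1))) ≤ Metric.infEDist (x + t • z) Ωᶜ} with hAn
  have hAnm (n) : MeasurableSet (An n) := by
    apply IsClosed.measurableSet
    have : An n = ⋂ t ∈ Icc (0 : ℝ) 1,
        {x | ENNReal.ofReal (2 * (1 / (n + 1))) ≤ Metric.infEDist (x + t • z) Ωᶜ} := by
      ext x; simp [hAn]
    rw [this]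
    refine isClosed_biInter fun t _ => ?_
    exact isClosed_le continuous_const
      (Metric.continuous_infEDist.comp (continuous_id.add continuous_const))
  have hball (n) (x) (hx : x ∈ An n) (t) (ht : t ∈ Icc (0 : ℝ) 1) :
      Metric.closedBall (x + t • z) (1 / (n + 1)) ⊆ Ω := by
    intro y hy
    by_contra hyΩ
    have h1 := (hx t ht).trans (Metric.infEDist_le_edist_of_mem (show y ∈ Ωᶜ from hyΩ))
    rw [edist_dist, dist_comm] at h1
    have hp : (0 : ℝ) < 1 / (n + 1) := by positivity
    rw [ENNReal.ofReal_le_ofReal_iff dist_nonneg] at h1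
    have := Metric.mem_closedBall.1 hy
    linarith
  have hev (x) (hx : x ∈ A) : ∀ᶠ n in atTop, x ∈ An n := by
    have hK : IsCompact ((fun t : ℝ => x + t • z) '' Icc 0 1) :=
      isCompact_Icc.image (by fun_prop)
    obtain ⟨δ, hδ, hδΩ⟩ := hK.exists_cthickening_subset_open hΩ
      (by rintro _ ⟨t, ht, rfl⟩; exact hAz x hx t ht)
    have hlim : Tendsto (fun n : ℕ => 2 * (1 / ((n : ℝ) + 1))) atTop (𝓝 0) := by
      simpa using tendsto_one_div_add_atTop_nhds_zero_nat.const_mul (2 : ℝ)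
    filter_upwards [hlim.eventually (gt_mem_nhds hδ)] with n hn t ht
    refine (ENNReal.ofReal_le_ofReal hn.le).trans ?_
    rw [Metric.le_infEDist]
    intro y hy
    by_contra hlt
    push Not at hlt
    refine hy (hδΩ (Metric.mem_cthickening_iff.2 ?_))
    have hmem : x + t • z ∈ (fun t : ℝ => x + t • z) '' Icc 0 1 := ⟨t, ht, rfl⟩
    exact (Metric.infEDist_le_edist_of_mem hmem).trans (by rw [edist_comm]; exact hlt.le)
  have hbound (n) : ∫⁻ x in A, (An n).indicator (fun x => ‖un n (x + z) - un n x‖ₑ ^ 2) x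
      ≤ ∫⁻ x in Ω, ‖inner ℝ (G x) z‖ₑ ^ 2 := by
    have hgc : Measurable fun y : E d × ℝ => ‖gn n (y.1 + y.2 • z)‖ₑ ^ 2 :=
      ((hgns n).continuous.comp (by fun_prop)).measurable.enorm.pow_const 2
    calc ∫⁻ x in A, (An n).indicator (fun x => ‖un n (x + z) - un n x‖ₑ ^ 2) x
        ≤ ∫⁻ x, ∫⁻ t in Icc (0 : ℝ) 1, ‖gn n (x + t • z)‖ₑ ^ 2 := by
          refine (setLIntegral_le_lintegral _ _).trans (lintegral_mono fun x => ?_)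
          by_cases hx : x ∈ An n
          · rw [indicator_of_mem hx]
            exact enorm_sub_sq_le_lintegral_of_segment ((huns n).of_le (by simp)) x z
              fun t ht => fderiv_mollify hm hu h n (hball n x hx t ht) z
          · rw [indicator_of_notMem hx]; exact zero_le
      _ = ∫⁻ t in Icc (0 : ℝ) 1, ∫⁻ x, ‖gn n (x + t • z)‖ₑ ^ 2 :=
          lintegral_lintegral_swap hgc.aemeasurable
      _ = ∫⁻ x, ‖gn n x‖ₑ ^ 2 := by
          have (t : ℝ) : ∫⁻ x, ‖gn n (x + t • z)‖ₑ ^ 2 = ∫⁻ x, ‖gn n x‖ₑ ^ 2 :=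
            lintegral_add_right_eq_self (fun x => ‖gn n x‖ₑ ^ 2) _
          simp [this]
      _ ≤ ∫⁻ x, ‖Ω.indicator (fun y => inner ℝ (G y) z) x‖ₑ ^ 2 :=
          lintegral_enorm_mollify_sq_le n (hGz.integrable_indicator hm).1
      _ = _ := by
          rw [← lintegral_indicator hm]
          refine lintegral_congr fun x => ?_
          by_cases hx : x ∈ Ω <;> simp [hx]
  have hae := mollify_ae_tendsto (hu.integrable_indicator hm).locallyIntegrable
  have hae' : ∀ᵐ x, Tendsto (fun n => un n (x + z)) atTop (𝓝 (Ω.indicator u (x + z))) :=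
    (measurePreserving_add_right volume z).quasiMeasurePreserving.ae hae
  have hfatou := lintegral_liminf_le (μ := volume.restrict A) (u := atTop)
    (f := fun n => (An n).indicator (fun x => ‖un n (x + z) - un n x‖ₑ ^ 2))
    fun n => (((((huns n).continuous.comp (by fun_prop)).sub
      (huns n).continuous).measurable.enorm.pow_const 2).indicator (hAnm n))
  calc ∫⁻ x in A, ‖u (x + z) - u x‖ₑ ^ 2
      = ∫⁻ x in A, liminf (fun n => (An n).indicator
          (fun x => ‖un n (x + z) - un n x‖ₑ ^ 2) x) atTop := by
        refine lintegral_congr_ae ?_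
        filter_upwards [ae_restrict_of_ae hae, ae_restrict_of_ae hae', ae_restrict_mem hA]
          with x h1 h2 hx
        have hx0 : x ∈ Ω := by simpa using hAz x hx 0 (by simp)
        have hx1 : x + z ∈ Ω := by simpa using hAz x hx 1 (by simp)
        rw [indicator_of_mem hx0] at h1
        rw [indicator_of_mem hx1] at h2
        have hl : Tendsto (fun n => ‖un n (x + z) - un n x‖ₑ ^ 2) atTop
            (𝓝 (‖u (x + z) - u x‖ₑ ^ 2)) := ENNReal.Tendsto.pow ((h2.sub h1).enorm)
        refine (Tendsto.liminf_eq (hl.congr' ?_)).symm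
        filter_upwards [hev x hx] with n hn
        rw [indicator_of_mem hn]
    _ ≤ _ := hfatou
    _ ≤ _ := liminf_le_of_frequently_le' (Eventually.of_forall hbound).frequently

theorem lintegral_translate_sub_sq_le_norm (hΩ : IsOpen Ω) (hu : IntegrableOn u Ω)
    (hG : IntegrableOn G Ω) (h : HasWeakGradient Ω u G) {A : Set (E d)} (hA : MeasurableSet A)
    {z : E d} (hAz : ∀ x ∈ A, ∀ t ∈ Icc (0 : ℝ) 1, x + t • z ∈ Ω) {R : ℝ} (hz : ‖z‖ ≤ R) :
    ∫⁻ x in A, ‖u (x + z) - u x‖ₑ ^ 2 ≤ ENNReal.ofReal R ^ 2 * ∫⁻ x in Ω, ‖G x‖ₑ ^ 2 := by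
  refine (lintegral_translate_sub_sq_le hΩ hu hG h hA z hAz).trans ?_
  rw [← lintegral_const_mul' _ _ (by simp)]
  refine lintegral_mono fun x => ?_
  rw [← mul_pow]
  gcongr
  rw [← ofReal_norm, ← ofReal_norm,
    ← ENNReal.ofReal_mul ((norm_nonneg z).trans hz)]
  apply ENNReal.ofReal_le_ofReal
  rw [mul_comm]
  exact (norm_inner_le_norm _ _).trans (by gcongr)

/-- The uniform interior cone property at a point `x₀` of the closure of `Ω`. -/
def InteriorCone (Ω : Set (E d)) (x₀ : E d) (r s₀ θ : ℝ) (e : E d) : Prop :=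
  ∀ y ∈ Ω ∩ Metric.ball x₀ r, ∀ s ∈ Icc (0 : ℝ) s₀, ∀ w : E d, ‖w‖ ≤ θ → y + s • (e + w) ∈ Ω

/-- In a boundary chart with Lipschitz constant K, a displacement s(e + w) raises the height by at
least s(1 - ‖w‖), while the graph rises by at most K s‖w‖. The choice θ = 1/(K+1) balances the two.
The bounds R/2 and R/8 keep the displaced point in the chart. At an interior point any direction
works. -/
theorem HasLipschitzBoundary.exists_interiorCone (hd : 0 < d) (hΩ : IsOpen Ω)
    (hL : HasLipschitzBoundary Ω) {x₀ : E d} (hx₀ : x₀ ∈ closure Ω) :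
    ∃ r > 0, ∃ s₀ > 0, ∃ θ > 0, θ ≤ 1 ∧ ∃ e : E d, ‖e‖ = 1 ∧ InteriorCone Ω x₀ r s₀ θ e := by
  by_cases hx : x₀ ∈ Ω
  · obtain ⟨R, hR, hRΩ⟩ := Metric.isOpen_iff.1 hΩ x₀ hx
    have : Nonempty (Fin d) := ⟨⟨0, hd⟩⟩
    obtain ⟨e, he⟩ := exists_norm_eq (E d) (zero_le_one (α := ℝ))
    refine ⟨R / 2, by positivity, R / 8, by positivity, 1, one_pos, le_rfl, e, he, ?_⟩
    intro y hy s hs w hw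
    apply hRΩ
    have h1 : ‖y - x₀‖ < R / 2 := by simpa [dist_eq_norm] using hy.2
    have h2 : ‖s • (e + w)‖ ≤ R / 8 * 2 := by
      rw [norm_smul, Real.norm_of_nonneg hs.1]
      have : ‖e + w‖ ≤ 2 := (norm_add_le _ _).trans (by linarith)
      exact mul_le_mul hs.2 this (norm_nonneg _) (by positivity)
    rw [Metric.mem_ball, dist_eq_norm, add_sub_right_comm]
    exact (norm_add_le _ _).trans_lt (by linarith)
  · have hfr : x₀ ∈ frontier Ω := by
      rw [hΩ.frontier_eq]; exact ⟨hx₀, hx⟩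
    obtain ⟨R, hR, e, he, K, g, hg, hgΩ⟩ := hL x₀ hfr
    have hK : (0 : ℝ) < K + 1 := by positivity
    refine ⟨R / 2, by positivity, R / 8, by positivity, 1 / (K + 1), by positivity, ?_, e, he, ?_⟩
    · rw [div_le_one hK]; linarith [K.coe_nonneg]
    intro y hy s hs w hw
    have hw1 : ‖w‖ ≤ 1 := hw.trans (by rw [div_le_one hK]; linarith [K.coe_nonneg])
    have h1 : ‖y - x₀‖ < R / 2 := by simpa [dist_eq_norm] using hy.2
    have h2 : ‖s • (e + w)‖ ≤ R / 8 * 2 := by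
      rw [norm_smul, Real.norm_of_nonneg hs.1]
      have : ‖e + w‖ ≤ 2 := (norm_add_le _ _).trans (by linarith)
      exact mul_le_mul hs.2 this (norm_nonneg _) (by positivity)
    have hyR : y ∈ Metric.ball x₀ R := by
      rw [Metric.mem_ball, dist_eq_norm]; linarith
    have hy'R : y + s • (e + w) ∈ Metric.ball x₀ R := by
      rw [Metric.mem_ball, dist_eq_norm, add_sub_right_comm]
      exact (norm_add_le _ _).trans_lt (by linarith)
    rw [hgΩ _ hy'R]
    have hy1 := (hgΩ y hyR).1 hy.1
    have hee : inner ℝ e e = (1 : ℝ) := by rw [real_inner_self_eq_norm_sq, he]; norm_num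
    have hin : inner ℝ (y + s • (e + w)) e = inner ℝ y e + s * (1 + inner ℝ w e) := by
      rw [inner_add_left, real_inner_smul_left, inner_add_left, hee]
    have hwe : |inner ℝ w e| ≤ ‖w‖ := by
      simpa [he] using abs_real_inner_le_norm w e
    set P : E d → E d := fun y => y - inner ℝ y e • e with hP
    have hPd : P (y + s • (e + w)) - P y = s • P w := by
      simp only [hP, hin]
      module
    have hPw : ‖P w‖ ≤ ‖w‖ := by
      have : ‖P w‖ ^ 2 = ‖w‖ ^ 2 - inner ℝ w e ^ 2 := by
        simp only [hP]
        rw [norm_sub_sq_real, real_inner_smul_right, norm_smul, he, mul_one, Real.norm_eq_abs,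
          sq_abs]
        ring
      refine (sq_le_sq₀ (norm_nonneg _) (norm_nonneg _)).1 ?_
      rw [this]
      linarith [sq_nonneg (inner ℝ w e : ℝ)]
    have hgl : g (P (y + s • (e + w))) ≤ g (P y) + K * (s * ‖w‖) := by
      have := hg.dist_le_mul (P (y + s • (e + w))) (P y)
      rw [Real.dist_eq, dist_eq_norm, hPd, norm_smul, Real.norm_of_nonneg hs.1] at this
      have h3 : (K : ℝ) * (s * ‖P w‖) ≤ K * (s * ‖w‖) := by
        have := hs.1
        gcongr
      linarith [le_abs_self (g (P (y + s • (e + w))) - g (P y))]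
    refine hgl.trans_lt ?_
    rw [hin]
    have h4 : (K + 1 : ℝ) * ‖w‖ ≤ 1 := by
      rw [le_div_iff₀ hK] at hw; linarith
    have h5 : 0 ≤ s * (1 + inner ℝ w e - K * ‖w‖) :=
      mul_nonneg hs.1 (by linarith [neg_abs_le (inner ℝ w e)])
    have hy2 : g (P y) < inner ℝ y e := hy1
    linarith

end

/-! ### Poincaré's inequality by linking subsets of the domain. -/

section

variable {d : ℕ} {Ω : Set (E d)}

/-- The double integral of the squared differences of a Sobolev function over `A × B` is bounded
by its Dirichlet energy on `Ω`. -/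
def Linked (Ω A B : Set (E d)) : Prop :=
  ∃ C : ℝ≥0∞, C ≠ ⊤ ∧ ∀ (u : E d → ℝ) (G : E d → E d), IntegrableOn u Ω → IntegrableOn G Ω →
    HasWeakGradient Ω u G →
      ∫⁻ x in A, ∫⁻ y in B, ‖u x - u y‖ₑ ^ 2 ≤ C * ∫⁻ x in Ω, ‖G x‖ₑ ^ 2

theorem aemeasurable_enorm_sub_sq {α : Type*} [MeasurableSpace α] {μ ν : Measure α} [SFinite ν]
    [SFinite μ] {u : α → ℝ} (hμ : AEStronglyMeasurable u μ) (hν : AEStronglyMeasurable u ν) :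
    AEMeasurable (fun z : α × α => ‖u z.1 - u z.2‖ₑ ^ 2) (μ.prod ν) :=
  (hμ.comp_fst.sub hν.comp_snd).enorm.pow_const 2

theorem Linked.symm {A B : Set (E d)} (hAΩ : A ⊆ Ω) (hBΩ : B ⊆ Ω) (h : Linked Ω A B) :
    Linked Ω B A := by
  obtain ⟨C, hC, h⟩ := h
  refine ⟨C, hC, fun u G hu hG hw => ?_⟩
  rw [lintegral_lintegral_swap (aemeasurable_enorm_sub_sq (hu.mono_set hBΩ).1
    (hu.mono_set hAΩ).1)]
  simpa only [enorm_sub_rev] using h u G hu hG hw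

theorem Linked.mono {A B A' B' : Set (E d)} (h : Linked Ω A B) (hA : A' ⊆ A) (hB : B' ⊆ B) :
    Linked Ω A' B' := by
  obtain ⟨C, hC, h⟩ := h
  refine ⟨C, hC, fun u G hu hG hw => (?_ : _ ≤ _).trans (h u G hu hG hw)⟩
  exact (lintegral_mono_set hA).trans (lintegral_mono fun x => lintegral_mono_set hB)

/-- Averaging |u x - u z|² ≤ 2(|u x - u y|² + |u y - u z|²) over y in the middle set, whose measure
must therefore be positive and finite. -/
theorem Linked.trans {A B A' : Set (E d)} (hAΩ : A ⊆ Ω) (hBΩ : B ⊆ Ω) (hA'Ω : A' ⊆ Ω)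
    (hA : volume A ≠ ⊤) (hA' : volume A' ≠ ⊤) (hB : volume B ≠ 0) (hBt : volume B ≠ ⊤)
    (h : Linked Ω A B) (h' : Linked Ω B A') : Linked Ω A A' := by
  obtain ⟨C, hC, h⟩ := h
  obtain ⟨C', hC', h'⟩ := h'
  refine ⟨(volume B)⁻¹ * (2 * (volume A' * C + volume A * C')), ?_, fun u G hu hG hw => ?_⟩
  · exact ENNReal.mul_ne_top (ENNReal.inv_ne_top.2 hB) (ENNReal.mul_ne_top (by simp)
      (ENNReal.add_ne_top.2 ⟨ENNReal.mul_ne_top hA' hC, ENNReal.mul_ne_top hA hC'⟩))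
  set D := ∫⁻ x in Ω, ‖G x‖ₑ ^ 2
  have huA := (hu.mono_set hAΩ).1
  have huB := (hu.mono_set hBΩ).1
  have huA' := (hu.mono_set hA'Ω).1
  have e1 := h u G hu hG hw
  have e2 := h' u G hu hG hw
  have hpt (x z : E d) : volume B * ‖u x - u z‖ₑ ^ 2
      ≤ 2 * ((∫⁻ y in B, ‖u x - u y‖ₑ ^ 2) + ∫⁻ y in B, ‖u y - u z‖ₑ ^ 2) := by
    have hm : AEMeasurable (fun y => ‖u x - u y‖ₑ ^ 2) (volume.restrict B) :=
      (aestronglyMeasurable_const.sub huB).enorm.pow_const 2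
    rw [← lintegral_add_left' hm, ← lintegral_const_mul' _ _ (by simp), mul_comm, ← setLIntegral_const]
    refine lintegral_mono fun y => ?_
    simp only [Real.enorm_eq_ofReal_abs, ← ENNReal.ofReal_pow (abs_nonneg _), sq_abs]
    rw [← ENNReal.ofReal_add (sq_nonneg _) (sq_nonneg _), ← ENNReal.ofReal_ofNat,
      ← ENNReal.ofReal_mul (by norm_num)]
    apply ENNReal.ofReal_le_ofReal
    nlinarith [sq_nonneg ((u x - u y) - (u y - u z))]
  have key : volume B * ∫⁻ x in A, ∫⁻ z in A', ‖u x - u z‖ₑ ^ 2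
      ≤ 2 * (volume A' * C + volume A * C') * D := by
    calc volume B * ∫⁻ x in A, ∫⁻ z in A', ‖u x - u z‖ₑ ^ 2
        = ∫⁻ x in A, ∫⁻ z in A', volume B * ‖u x - u z‖ₑ ^ 2 := by
          rw [← lintegral_const_mul' _ _ hBt]
          refine lintegral_congr fun x => ?_
          rw [← lintegral_const_mul' _ _ hBt]
      _ ≤ ∫⁻ x in A, ∫⁻ z in A', 2 * ((∫⁻ y in B, ‖u x - u y‖ₑ ^ 2)
            + ∫⁻ y in B, ‖u y - u z‖ₑ ^ 2) :=
          lintegral_mono fun x => lintegral_mono fun z => hpt x z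
      _ = 2 * ((volume A' * ∫⁻ x in A, ∫⁻ y in B, ‖u x - u y‖ₑ ^ 2)
            + volume A * ∫⁻ z in A', ∫⁻ y in B, ‖u y - u z‖ₑ ^ 2) := by
          have hm : AEMeasurable (fun z => ∫⁻ y in B, ‖u y - u z‖ₑ ^ 2) (volume.restrict A') := by
            have := (aemeasurable_enorm_sub_sq huA' huB).lintegral_prod_right'
            simpa only [enorm_sub_rev] using this
          have hm' : AEMeasurable (fun x => ∫⁻ y in B, ‖u x - u y‖ₑ ^ 2) (volume.restrict A) :=
            (aemeasurable_enorm_sub_sq huA huB).lintegral_prod_right'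
          have (x : E d) : ∫⁻ z in A', 2 * ((∫⁻ y in B, ‖u x - u y‖ₑ ^ 2)
              + ∫⁻ y in B, ‖u y - u z‖ₑ ^ 2)
              = 2 * (volume A' * (∫⁻ y in B, ‖u x - u y‖ₑ ^ 2)
                + ∫⁻ z in A', ∫⁻ y in B, ‖u y - u z‖ₑ ^ 2) := by
            rw [lintegral_const_mul' _ _ (by simp), lintegral_add_left measurable_const,
              setLIntegral_const, mul_comm (volume A')]
          simp only [this]
          rw [lintegral_const_mul' _ _ (by simp), lintegral_add_left' (hm'.const_mul _),
            lintegral_const_mul' _ _ hA', setLIntegral_const, mul_comm (volume A)]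
      _ ≤ 2 * (volume A' * (C * D) + volume A * (C' * D)) := by
          gcongr
          rw [lintegral_lintegral_swap]
          · exact e2
          · refine (aemeasurable_enorm_sub_sq huA' huB).congr (Eventually.of_forall fun p => ?_)
            simp only [Function.uncurry, enorm_sub_rev]
      _ = _ := by ring
  calc _ = (volume B)⁻¹ * (volume B * ∫⁻ x in A, ∫⁻ z in A', ‖u x - u z‖ₑ ^ 2) := by
        rw [← mul_assoc, ENNReal.inv_mul_cancel hB hBt, one_mul]
    _ ≤ (volume B)⁻¹ * (2 * (volume A' * C + volume A * C') * D) := by gcongr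
    _ = _ := by ring

/-- With z = y - x as a new variable, the estimate for translates applies for each fixed z with ‖z‖
≤ R, on the set of x with x ∈ A and x + z ∈ B. Integration over the ball of radius R finishes. -/
theorem linked_of_segment (hΩ : IsOpen Ω) {A B : Set (E d)} (hA : MeasurableSet A)
    (hB : MeasurableSet B) {R : ℝ} (hAB : ∀ x ∈ A, ∀ y ∈ B, segment ℝ x y ⊆ Ω ∧ dist x y ≤ R) :
    Linked Ω A B := by
  refine ⟨volume (Metric.closedBall (0 : E d) R) * ENNReal.ofReal R ^ 2, ?_,
    fun u G hu hG hw => ?_⟩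
  · exact ENNReal.mul_ne_top measure_closedBall_lt_top.ne (by simp)
  rcases A.eq_empty_or_nonempty with rfl | ⟨a₀, ha₀⟩
  · simp
  rcases B.eq_empty_or_nonempty with rfl | ⟨b₀, hb₀⟩
  · simp
  have hAΩ : A ⊆ Ω := fun x hx => (hAB x hx b₀ hb₀).1 (left_mem_segment ℝ _ _)
  have hBΩ : B ⊆ Ω := fun y hy => (hAB a₀ ha₀ y hy).1 (right_mem_segment ℝ _ _)
  set S : Set (E d × E d) := {p | p.1 ∈ A ∧ p.1 + p.2 ∈ B} with hS
  have hSm : MeasurableSet S := (hA.preimage measurable_fst).inter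
    (hB.preimage (measurable_fst.add measurable_snd))
  set uΩ := Ω.indicator u with huΩ
  have hui : Integrable uΩ := hu.integrable_indicator hΩ.measurableSet
  set f : E d × E d → ℝ≥0∞ := S.indicator fun p => ‖uΩ (p.1 + p.2) - uΩ p.1‖ₑ ^ 2 with hf
  have hfm : AEMeasurable f (volume.prod volume) := by
    refine AEMeasurable.indicator (((AEStronglyMeasurable.sub ?_ ?_).enorm).pow_const 2) hSm
    · exact hui.1.comp_quasiMeasurePreserving
        (quasiMeasurePreserving_add volume volume)
    · exact hui.1.comp_fst
  calc ∫⁻ x in A, ∫⁻ y in B, ‖u x - u y‖ₑ ^ 2 = ∫⁻ x, ∫⁻ z, f (x, z) := by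
        rw [← lintegral_indicator hA]
        refine lintegral_congr fun x => ?_
        by_cases hx : x ∈ A
        · rw [indicator_of_mem hx, ← lintegral_indicator hB,
            ← lintegral_add_left_eq_self _ x]
          refine lintegral_congr fun z => ?_
          by_cases hz : x + z ∈ B
          · have : (x, z) ∈ S := ⟨hx, hz⟩
            rw [indicator_of_mem hz, hf, indicator_of_mem this, huΩ, indicator_of_mem (hBΩ hz),
              indicator_of_mem (hAΩ hx), enorm_sub_rev]
          · have : (x, z) ∉ S := fun h => hz h.2
            rw [indicator_of_notMem hz, hf, indicator_of_notMem this]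
        · rw [indicator_of_notMem hx]
          have (z : E d) : f (x, z) = 0 := by
            have : (x, z) ∉ S := fun h => hx h.1
            rw [hf, indicator_of_notMem this]
          simp [this]
    _ = ∫⁻ z, ∫⁻ x, f (x, z) := lintegral_lintegral_swap (f := fun x z => f (x, z)) hfm
    _ ≤ ∫⁻ z in Metric.closedBall (0 : E d) R, ENNReal.ofReal R ^ 2 * ∫⁻ x in Ω, ‖G x‖ₑ ^ 2 := by
        rw [← lintegral_indicator measurableSet_closedBall]
        refine lintegral_mono fun z => ?_
        dsimp only
        set Az : Set (E d) := {x | x ∈ A ∧ x + z ∈ B} with hAz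
        have hAzm : MeasurableSet Az := hSm.preimage measurable_prodMk_right
        have hfz (x : E d) : f (x, z) = Az.indicator (fun x => ‖u (x + z) - u x‖ₑ ^ 2) x := by
          by_cases hx : x ∈ Az
          · have : (x, z) ∈ S := hx
            rw [hf, indicator_of_mem this, indicator_of_mem hx, huΩ,
              indicator_of_mem (hBΩ hx.2), indicator_of_mem (hAΩ hx.1)]
          · have : (x, z) ∉ S := hx
            rw [hf, indicator_of_notMem this, indicator_of_notMem hx]
        simp only [hfz]
        rw [lintegral_indicator hAzm]
        by_cases hz : z ∈ Metric.closedBall (0 : E d) R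
        · rw [indicator_of_mem hz]
          refine lintegral_translate_sub_sq_le_norm hΩ hu hG hw hAzm (fun x hx t ht => ?_)
            (mem_closedBall_zero_iff.1 hz)
          refine (hAB x hx.1 _ hx.2).1 ?_
          rw [segment_eq_image']
          exact ⟨t, ht, by simp⟩
        · have : Az = ∅ := by
            rw [eq_empty_iff_forall_notMem]
            intro x hx
            apply hz
            have := (hAB x hx.1 _ hx.2).2
            rw [dist_comm, dist_eq_norm] at this
            simpa using this
          rw [this]; simp
    _ = _ := by rw [setLIntegral_const]; ring

theorem linked_subset_ball (hΩ : IsOpen Ω) {A B : Set (E d)} (hA : MeasurableSet A)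
    (hB : MeasurableSet B) {x : E d} {r : ℝ} (hr : Metric.ball x r ⊆ Ω)
    (hAr : A ⊆ Metric.ball x r) (hBr : B ⊆ Metric.ball x r) : Linked Ω A B := by
  refine linked_of_segment hΩ hA hB (R := 2 * r) fun a ha b hb =>
    ⟨((convex_ball x r).segment_subset (hAr ha) (hBr hb)).trans hr, ?_⟩
  have h1 := Metric.mem_ball.1 (hAr ha)
  have h2 := Metric.mem_ball'.1 (hBr hb)
  linarith [dist_triangle a x b]

/-- A chain of balls, organised as an induction over a preconnected set. Quantifying over all radii
makes linkage a symmetric and transitive relation between centres, which then only has to be checked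
locally. -/
theorem linked_balls (hΩ : IsOpen Ω) (hc : IsPreconnected Ω) {x y : E d} (hx : x ∈ Ω)
    (hy : y ∈ Ω) {r s : ℝ} (hr : 0 < r) (hs : 0 < s) (hrΩ : Metric.ball x r ⊆ Ω)
    (hsΩ : Metric.ball y s ⊆ Ω) : Linked Ω (Metric.ball x r) (Metric.ball y s) := by
  have fin (x : E d) (r : ℝ) : volume (Metric.ball x r) ≠ ⊤ := measure_ball_lt_top.ne
  have pos (x : E d) {r : ℝ} (hr : 0 < r) : volume (Metric.ball x r) ≠ 0 :=
    (Metric.measure_ball_pos volume x hr).ne'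
  have sym {x y : E d} (h : ∀ r > 0, ∀ s > 0, Metric.ball x r ⊆ Ω → Metric.ball y s ⊆ Ω →
      Linked Ω (Metric.ball x r) (Metric.ball y s)) :
      ∀ s > 0, ∀ r > 0, Metric.ball y s ⊆ Ω → Metric.ball x r ⊆ Ω →
      Linked Ω (Metric.ball y s) (Metric.ball x r) :=
    fun s hs r hr hsΩ hrΩ => (h r hr s hs hrΩ hsΩ).symm hrΩ hsΩ
  refine hc.induction₂ (fun x y => ∀ r > 0, ∀ s > 0, Metric.ball x r ⊆ Ω → Metric.ball y s ⊆ Ω →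
      Linked Ω (Metric.ball x r) (Metric.ball y s)) ?_ ?_ ?_ hx hy r hr s hs hrΩ hsΩ
  · intro x hx
    obtain ⟨R, hR, hRΩ⟩ := Metric.isOpen_iff.1 hΩ x hx
    filter_upwards [mem_nhdsWithin_of_mem_nhds (Metric.ball_mem_nhds x hR)] with y hy r hr s hs hrΩ hsΩ
    obtain ⟨ε, hε, hεR⟩ := Metric.isOpen_iff.1 (Metric.isOpen_ball (x := x) (ε := R)) y hy
    have h1 : Linked Ω (Metric.ball x r) (Metric.ball x (min r R)) :=
      linked_subset_ball hΩ measurableSet_ball measurableSet_ball hrΩ subset_rfl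
        (Metric.ball_subset_ball (min_le_left _ _))
    have h2 : Linked Ω (Metric.ball x (min r R)) (Metric.ball y (min s ε)) :=
      linked_subset_ball hΩ measurableSet_ball measurableSet_ball hRΩ
        (Metric.ball_subset_ball (min_le_right _ _))
        ((Metric.ball_subset_ball (min_le_right _ _)).trans hεR)
    have h3 : Linked Ω (Metric.ball y (min s ε)) (Metric.ball y s) :=
      linked_subset_ball hΩ measurableSet_ball measurableSet_ball hsΩ
        (Metric.ball_subset_ball (min_le_left _ _)) subset_rfl
    have hxR : Metric.ball x (min r R) ⊆ Ω := (Metric.ball_subset_ball (min_le_left _ _)).trans hrΩ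
    have hyε : Metric.ball y (min s ε) ⊆ Ω := (Metric.ball_subset_ball (min_le_left _ _)).trans hsΩ
    exact ((h1.trans hrΩ hxR hyε (fin _ _) (fin _ _) (pos _ (lt_min hr hR)) (fin _ _) h2).trans
      hrΩ hyε hsΩ (fin _ _) (fin _ _) (pos _ (lt_min hs hε)) (fin _ _) h3)
  · intro x y z hx hy hz h1 h2 r hr s hs hrΩ hsΩ
    obtain ⟨R, hR, hRΩ⟩ := Metric.isOpen_iff.1 hΩ y hy
    exact (h1 r hr R hR hrΩ hRΩ).trans hrΩ hRΩ hsΩ (fin _ _) (fin _ _) (pos _ hR) (fin _ _)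
      (h2 R hR s hs hRΩ hsΩ)
  · intro x y hx hy h s hs r hr hsΩ hrΩ
    exact (h r hr s hs hrΩ hsΩ).symm hrΩ hsΩ

/-- Poincaré inequality on bounded connected Lipschitz domains. -/
theorem IsBoundedLipschitzDomain.linked_self (hd : 0 < d) (hΩ : IsBoundedLipschitzDomain Ω) :
    Linked Ω Ω Ω := by
  have hop := hΩ.isOpen
  have hvol : volume Ω ≠ ⊤ := hΩ.isBounded.measure_lt_top.ne
  obtain ⟨x₁, hx₁⟩ := hΩ.isConnected.nonempty
  obtain ⟨R, hR, hRΩ⟩ := Metric.isOpen_iff.1 hop x₁ hx₁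
  have hBt : volume (Metric.ball x₁ R) ≠ ⊤ := measure_ball_lt_top.ne
  have hB0 : volume (Metric.ball x₁ R) ≠ 0 := (Metric.measure_ball_pos volume x₁ hR).ne'
  suffices h : Linked Ω Ω (Metric.ball x₁ R) from
    h.trans subset_rfl hRΩ subset_rfl hvol hvol hB0 hBt (h.symm subset_rfl hRΩ)
  -- By the cone property, all points of Ω near x see one common ball, centred at x + s e, along
  -- segments inside Ω. The radii of the two neighbourhoods add up to at most sθ, so that b - a =
  -- s(e + w) with ‖w‖ ≤ θ.
  have hloc : ∀ x ∈ closure Ω, ∃ t ∈ 𝓝[closure Ω] x, Linked Ω (Ω ∩ t) (Metric.ball x₁ R) := by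
    intro x hx
    obtain ⟨r, hr, s, hs, θ, hθ, hθ1, e, he, hcone⟩ := hΩ.lipschitz.exists_interiorCone hd hop hx
    have hsθ : 0 < s * θ := mul_pos hs hθ
    set δ := min r (s * θ / 2) with hδ
    have hδ0 : 0 < δ := lt_min hr (by positivity)
    have hδθ : δ ≤ s * θ / 2 := min_le_right _ _
    have hseg : ∀ a ∈ Ω ∩ Metric.ball x δ, ∀ b ∈ Metric.ball (x + s • e) (s * θ / 2),
        segment ℝ a b ⊆ Ω ∧ dist a b ≤ 2 * s := by
      intro a ha b hb
      set w := s⁻¹ • (b - a) - e with hw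
      have hba : b - a = s • (e + w) := by
        rw [hw, add_sub_cancel, smul_inv_smul₀ hs.ne']
      have hw' : ‖w‖ ≤ θ := by
        have h1 : s • w = (b - (x + s • e)) - (a - x) := by
          rw [hw, smul_sub, smul_inv_smul₀ hs.ne']; abel
        have h2 : s * ‖w‖ ≤ s * θ := by
          rw [← Real.norm_of_nonneg hs.le, ← norm_smul, Real.norm_of_nonneg hs.le, h1]
          refine (norm_sub_le _ _).trans ?_
          have h3 := mem_ball_iff_norm.1 hb
          have h4 := mem_ball_iff_norm.1 ha.2
          linarith
        exact le_of_mul_le_mul_left h2 hs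
      constructor
      · rw [segment_eq_image']
        rintro _ ⟨t, ht, rfl⟩
        dsimp only
        rw [hba, smul_smul]
        exact hcone a ⟨ha.1, Metric.ball_subset_ball (min_le_left _ _) ha.2⟩ (t * s)
          ⟨mul_nonneg ht.1 hs.le, mul_le_of_le_one_left hs.le ht.2⟩ w hw'
      · rw [dist_comm, dist_eq_norm, hba, norm_smul, Real.norm_of_nonneg hs.le, mul_comm]
        have : ‖e + w‖ ≤ 2 := (norm_add_le _ _).trans (by linarith)
        gcongr
    have hball : Metric.ball (x + s • e) (s * θ / 2) ⊆ Ω := by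
      obtain ⟨a, ha⟩ := mem_closure_iff_nhds.1 hx _ (Metric.ball_mem_nhds x hδ0)
      exact fun b hb => (hseg a ⟨ha.2, ha.1⟩ b hb).1 (right_mem_segment ℝ _ _)
    have hm : MeasurableSet (Ω ∩ Metric.ball x δ) := hop.measurableSet.inter measurableSet_ball
    have h1 := linked_of_segment hop hm measurableSet_ball hseg
    refine ⟨Metric.ball x δ, mem_nhdsWithin_of_mem_nhds (Metric.ball_mem_nhds x hδ0), ?_⟩
    have hc : x + s • e ∈ Ω := hball (Metric.mem_ball_self (by positivity))
    refine h1.trans inter_subset_left hball hRΩ ?_ hBt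
      (Metric.measure_ball_pos volume _ (by positivity)).ne' measure_ball_lt_top.ne
      (linked_balls hop hΩ.isConnected.isPreconnected hc hx₁ (by positivity) hR hball hRΩ)
    exact measure_ne_top_of_subset inter_subset_left hvol
  have hcomp : IsCompact (closure Ω) := hΩ.isBounded.isCompact_closure
  have := hcomp.induction_on (p := fun t => Linked Ω (Ω ∩ t) (Metric.ball x₁ R)) ?_ ?_ ?_ hloc
  · rwa [inter_eq_left.2 subset_closure] at this
  · exact ⟨0, by simp, fun u G _ _ _ => by simp⟩
  · exact fun s t hst h => h.mono (inter_subset_inter_right _ hst) subset_rfl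
  · rintro s t ⟨C, hC, h⟩ ⟨C', hC', h'⟩
    refine ⟨C + C', ENNReal.add_ne_top.2 ⟨hC, hC'⟩, fun u G hu hG hw => ?_⟩
    rw [inter_union_distrib_left, add_mul]
    exact (lintegral_union_le _ _ _).trans (add_le_add (h u G hu hG hw) (h' u G hu hG hw))

end

/-! ### A Nash type inequality. -/

section

variable {d : ℕ} {Ω : Set (E d)}

/-- u(x) is compared with its mean over x + Z, where Z is a ball of radius sθ inside the cone at
height s. The difference costs the gradient times ‖z‖ ≤ 2s, and the mean is bounded by the L¹ norm
divided by |Z|. The free scale s is what makes this an interpolation inequality. -/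
theorem lintegral_sq_le_of_interiorCone (hΩ : IsOpen Ω) {x₀ e : E d}
    {r s₀ θ : ℝ} (he : ‖e‖ = 1) (hθ : 0 < θ) (hθ1 : θ ≤ 1) (hcone : InteriorCone Ω x₀ r s₀ θ e)
    {s : ℝ} (hs : 0 < s) (hss : s ≤ s₀) {u : E d → ℝ} {G : E d → E d} (hu : IntegrableOn u Ω)
    (hG : IntegrableOn G Ω) (hw : HasWeakGradient Ω u G) :
    ∫⁻ x in Ω ∩ Metric.ball x₀ r, ‖u x‖ₑ ^ 2
      ≤ 2 * ENNReal.ofReal (2 * s) ^ 2 * (∫⁻ x in Ω, ‖G x‖ₑ ^ 2)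
        + 2 * volume Ω * (volume (Metric.ball (0 : E d) (s * θ)))⁻¹ ^ 2
          * (∫⁻ x in Ω, ‖u x‖ₑ) ^ 2 := by
  set A := Ω ∩ Metric.ball x₀ r with hA
  have hAm : MeasurableSet A := hΩ.measurableSet.inter measurableSet_ball
  set Z := Metric.ball (s • e) (s * θ) with hZ
  have hVZ : volume (Metric.ball (0 : E d) (s * θ)) = volume Z := by
    rw [hZ, Measure.addHaar_ball_center volume (s • e)]
  rw [hVZ]
  set V := volume Z with hV
  have hV0 : V ≠ 0 := (Metric.measure_ball_pos volume _ (mul_pos hs hθ)).ne'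
  have hVt : V ≠ ⊤ := measure_ball_lt_top.ne
  set D := ∫⁻ x in Ω, ‖G x‖ₑ ^ 2
  set N := ∫⁻ x in Ω, ‖u x‖ₑ
  have hseg (x) (hx : x ∈ A) (z) (hz : z ∈ Z) (t : ℝ) (ht : t ∈ Icc (0 : ℝ) 1) :
      x + t • z ∈ Ω := by
    set w := s⁻¹ • z - e with hw
    have hz' : z = s • (e + w) := by rw [hw, add_sub_cancel, smul_inv_smul₀ hs.ne']
    have hw' : ‖w‖ ≤ θ := by
      have h1 : s • w = z - s • e := by rw [hw, smul_sub, smul_inv_smul₀ hs.ne']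
      have h2 : s * ‖w‖ ≤ s * θ := by
        rw [← Real.norm_of_nonneg hs.le, ← norm_smul, Real.norm_of_nonneg hs.le, h1]
        exact (mem_ball_iff_norm.1 hz).le
      exact le_of_mul_le_mul_left h2 hs
    rw [hz', smul_smul]
    exact hcone x hx (t * s)
      ⟨mul_nonneg ht.1 hs.le, (mul_le_of_le_one_left hs.le ht.2).trans hss⟩ w hw'
  have hzn (z) (hz : z ∈ Z) : ‖z‖ ≤ 2 * s := by
    have h1 := (mem_ball_iff_norm.1 hz).le
    have h2 : ‖s • e‖ = s := by rw [norm_smul, he, mul_one, Real.norm_of_nonneg hs.le]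
    have h3 := norm_add_le (z - s • e) (s • e)
    rw [sub_add_cancel, h2] at h3
    nlinarith
  set uΩ := Ω.indicator u with huΩ
  have hui : Integrable uΩ := hu.integrable_indicator hΩ.measurableSet
  have hfm : AEMeasurable (fun p : E d × E d => ‖uΩ (p.1 + p.2) - uΩ p.1‖ₑ)
      ((volume.restrict A).prod (volume.restrict Z)) := by
    have : AEMeasurable (fun p : E d × E d => ‖uΩ (p.1 + p.2) - uΩ p.1‖ₑ)
        (volume.prod volume) := ((hui.1.comp_quasiMeasurePreserving
        (quasiMeasurePreserving_add volume volume)).sub hui.1.comp_fst).enorm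
    exact this.mono_ac (Measure.AbsolutelyContinuous.prod
      Measure.restrict_le_self.absolutelyContinuous Measure.restrict_le_self.absolutelyContinuous)
  have hfx (x : E d) : AEMeasurable (fun z => ‖uΩ (x + z) - uΩ x‖ₑ) (volume.restrict Z) :=
    (((hui.comp_add_left x).1.sub aestronglyMeasurable_const).enorm).restrict
  have hgx (x : E d) : AEMeasurable (fun z => ‖uΩ (x + z)‖ₑ) (volume.restrict Z) :=
    ((hui.comp_add_left x).1.enorm).restrict
  have hN (x : E d) : ∫⁻ z in Z, ‖uΩ (x + z)‖ₑ ≤ N := by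
    refine (setLIntegral_le_lintegral _ _).trans_eq ?_
    change _ = ∫⁻ x in Ω, ‖u x‖ₑ
    rw [lintegral_add_left_eq_self (fun y => ‖uΩ y‖ₑ), ← lintegral_indicator hΩ.measurableSet]
    refine lintegral_congr fun y => ?_
    by_cases hy : y ∈ Ω <;> simp [huΩ, hy]
  have hpt (x) (hx : x ∈ A) : V ^ 2 * ‖u x‖ₑ ^ 2
      ≤ 2 * V * (∫⁻ z in Z, ‖uΩ (x + z) - uΩ x‖ₑ ^ 2) + 2 * N ^ 2 := by
    have h1 : V * ‖u x‖ₑ ≤ (∫⁻ z in Z, ‖uΩ (x + z) - uΩ x‖ₑ) + N := by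
      calc V * ‖u x‖ₑ = ∫⁻ z in Z, ‖uΩ x‖ₑ := by
            rw [setLIntegral_const, mul_comm, huΩ, indicator_of_mem hx.1]
        _ ≤ ∫⁻ z in Z, (‖uΩ (x + z) - uΩ x‖ₑ + ‖uΩ (x + z)‖ₑ) := by
            refine lintegral_mono fun z => ?_
            have := enorm_sub_le (a := uΩ (x + z)) (b := uΩ (x + z) - uΩ x)
            rw [sub_sub_cancel] at this
            rwa [add_comm]
        _ = (∫⁻ z in Z, ‖uΩ (x + z) - uΩ x‖ₑ) + ∫⁻ z in Z, ‖uΩ (x + z)‖ₑ :=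
            lintegral_add_left' (hfx x) _
        _ ≤ _ := by gcongr; exact hN x
    have h2 : (∫⁻ z in Z, ‖uΩ (x + z) - uΩ x‖ₑ) ^ 2
        ≤ V * ∫⁻ z in Z, ‖uΩ (x + z) - uΩ x‖ₑ ^ 2 := by
      have := lintegral_mul_sq_le (k := fun _ => 1) aemeasurable_const (hfx x)
      simpa [hV] using this
    calc V ^ 2 * ‖u x‖ₑ ^ 2 = (V * ‖u x‖ₑ) ^ 2 := by rw [mul_pow]
      _ ≤ ((∫⁻ z in Z, ‖uΩ (x + z) - uΩ x‖ₑ) + N) ^ 2 := pow_le_pow_left' h1 2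
      _ ≤ 2 * ((∫⁻ z in Z, ‖uΩ (x + z) - uΩ x‖ₑ) ^ 2 + N ^ 2) := by
          have := ENNReal.rpow_add_le_mul_rpow_add_rpow (∫⁻ z in Z, ‖uΩ (x + z) - uΩ x‖ₑ) N
            (p := 2) (by norm_num)
          norm_num at this
          exact this
      _ ≤ 2 * (V * (∫⁻ z in Z, ‖uΩ (x + z) - uΩ x‖ₑ ^ 2) + N ^ 2) := by gcongr
      _ = _ := by ring
  have key : V ^ 2 * ∫⁻ x in A, ‖u x‖ₑ ^ 2
      ≤ 2 * V * (V * (ENNReal.ofReal (2 * s) ^ 2 * D)) + 2 * N ^ 2 * volume Ω := by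
    calc V ^ 2 * ∫⁻ x in A, ‖u x‖ₑ ^ 2 = ∫⁻ x in A, V ^ 2 * ‖u x‖ₑ ^ 2 :=
          (lintegral_const_mul' _ _ (ENNReal.pow_ne_top hVt)).symm
      _ ≤ ∫⁻ x in A, (2 * V * (∫⁻ z in Z, ‖uΩ (x + z) - uΩ x‖ₑ ^ 2) + 2 * N ^ 2) :=
          setLIntegral_mono' hAm hpt
      _ = 2 * V * (∫⁻ x in A, ∫⁻ z in Z, ‖uΩ (x + z) - uΩ x‖ₑ ^ 2) + 2 * N ^ 2 * volume A := by
          rw [lintegral_add_right _ measurable_const, setLIntegral_const,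
            lintegral_const_mul' _ _ (ENNReal.mul_ne_top (by simp) hVt)]
      _ ≤ _ := by
          gcongr
          · rw [lintegral_lintegral_swap (hfm.pow_const 2)]
            calc ∫⁻ z in Z, ∫⁻ x in A, ‖uΩ (x + z) - uΩ x‖ₑ ^ 2
                ≤ ∫⁻ z in Z, ENNReal.ofReal (2 * s) ^ 2 * D := by
                  refine setLIntegral_mono' measurableSet_ball fun z hz => ?_
                  refine le_trans (le_of_eq ?_) (lintegral_translate_sub_sq_le_norm hΩ hu hG hw hAm
                    (fun x hx t ht => hseg x hx z hz t ht) (hzn z hz))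
                  refine setLIntegral_congr_fun hAm fun x hx => ?_
                  have : x + z ∈ Ω := by simpa using hseg x hx z hz 1 (by simp)
                  simp only [huΩ, indicator_of_mem hx.1, indicator_of_mem this]
              _ = _ := by rw [setLIntegral_const]; ring
          · exact inter_subset_left
  have hVV : (V⁻¹) ^ 2 * V ^ 2 = 1 := by
    rw [← mul_pow, ENNReal.inv_mul_cancel hV0 hVt, one_pow]
  calc ∫⁻ x in A, ‖u x‖ₑ ^ 2 = (V⁻¹) ^ 2 * (V ^ 2 * ∫⁻ x in A, ‖u x‖ₑ ^ 2) := by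
        rw [← mul_assoc, hVV, one_mul]
    _ ≤ (V⁻¹) ^ 2 * (2 * V * (V * (ENNReal.ofReal (2 * s) ^ 2 * D)) + 2 * N ^ 2 * volume Ω) := by
        gcongr
    _ = (V⁻¹) ^ 2 * V ^ 2 * (2 * ENNReal.ofReal (2 * s) ^ 2 * D)
        + 2 * volume Ω * V⁻¹ ^ 2 * N ^ 2 := by ring
    _ = _ := by rw [hVV, one_mul]

/-- A Nash type interpolation inequality on bounded Lipschitz domains. -/
theorem IsBoundedLipschitzDomain.exists_lintegral_sq_le (hd : 0 < d)
    (hΩ : IsBoundedLipschitzDomain Ω) :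
    ∃ C > 0, ∀ s : ℝ, 0 < s → s ≤ 1 → ∀ (u : E d → ℝ) (G : E d → E d), IntegrableOn u Ω →
      IntegrableOn G Ω → HasWeakGradient Ω u G →
      ∫⁻ x in Ω, ‖u x‖ₑ ^ 2 ≤ ENNReal.ofReal (C * s ^ 2) * (∫⁻ x in Ω, ‖G x‖ₑ ^ 2)
        + ENNReal.ofReal (C * (s ^ d)⁻¹ ^ 2) * (∫⁻ x in Ω, ‖u x‖ₑ) ^ 2 := by
  have hop := hΩ.isOpen
  have hvol : volume Ω ≠ ⊤ := hΩ.isBounded.measure_lt_top.ne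
  have hloc : ∀ x ∈ closure Ω, ∃ t ∈ 𝓝[closure Ω] x,
      ∃ C > 0, ∀ s : ℝ, 0 < s → s ≤ 1 → ∀ (u : E d → ℝ) (G : E d → E d), IntegrableOn u Ω →
      IntegrableOn G Ω → HasWeakGradient Ω u G →
      ∫⁻ x in Ω ∩ t, ‖u x‖ₑ ^ 2 ≤ ENNReal.ofReal (C * s ^ 2) * (∫⁻ x in Ω, ‖G x‖ₑ ^ 2)
        + ENNReal.ofReal (C * (s ^ d)⁻¹ ^ 2) * (∫⁻ x in Ω, ‖u x‖ₑ) ^ 2 := by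
    intro x hx
    obtain ⟨r, hr, s₀, hs₀, θ, hθ, hθ1, e, he, hcone⟩ := hΩ.lipschitz.exists_interiorCone hd hop hx
    refine ⟨Metric.ball x r, mem_nhdsWithin_of_mem_nhds (Metric.ball_mem_nhds x hr), ?_⟩
    set b := (volume (Metric.ball (0 : E d) 1)).toReal with hb
    have hb0 : 0 < b := ENNReal.toReal_pos (Metric.measure_ball_pos volume _ one_pos).ne'
      measure_ball_lt_top.ne
    have hball (ρ : ℝ) (hρ : 0 < ρ) : volume (Metric.ball (0 : E d) ρ)
        = ENNReal.ofReal (ρ ^ d * b) := by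
      rw [Measure.addHaar_ball_of_pos volume (0 : E d) hρ, finrank_euclideanSpace_fin,
        ENNReal.ofReal_mul (by positivity), hb, ENNReal.ofReal_toReal measure_ball_lt_top.ne]
    set m := (volume Ω).toReal with hm
    have hm0 : 0 ≤ m := ENNReal.toReal_nonneg
    have hm' : volume Ω = ENNReal.ofReal m := (ENNReal.ofReal_toReal hvol).symm
    set C₁ := 8 * s₀ ^ 2 with hC₁
    set C₂ := 2 * m * ((s₀ * θ) ^ d * b)⁻¹ ^ 2 with hC₂
    have hC₁0 : 0 < C₁ := by positivity
    have hC₂0 : 0 ≤ C₂ := by positivity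
    refine ⟨C₁ + C₂, by positivity, fun s hs hs1 u G hu hG hw => ?_⟩
    -- The cone is used at height s s₀, so that the range 0 < s ≤ 1 is common to all the charts of
    -- the finite cover.
    have hmain := lintegral_sq_le_of_interiorCone hop he hθ hθ1 hcone (mul_pos hs hs₀)
      (mul_le_of_le_one_left hs₀.le hs1) hu hG hw
    refine hmain.trans (add_le_add ?_ ?_)
    · gcongr
      rw [← ENNReal.ofReal_pow (by positivity), ← ENNReal.ofReal_ofNat, ← ENNReal.ofReal_mul
        (by norm_num)]
      apply ENNReal.ofReal_le_ofReal
      have : 2 * (2 * (s * s₀)) ^ 2 = C₁ * s ^ 2 := by rw [hC₁]; ring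
      rw [this]
      gcongr
      linarith
    · gcongr
      rw [hball _ (by positivity), ← ENNReal.ofReal_inv_of_pos (by positivity),
        ← ENNReal.ofReal_pow (by positivity), hm']
      have e2 (x y : ℝ) (hx : 0 ≤ x) : 2 * ENNReal.ofReal x * ENNReal.ofReal y
          = ENNReal.ofReal (2 * x * y) := by
        rw [ENNReal.ofReal_mul (by positivity), ENNReal.ofReal_mul (by norm_num),
          ENNReal.ofReal_ofNat]
      rw [e2 _ _ hm0]
      apply ENNReal.ofReal_le_ofReal
      have : 2 * m * ((s * s₀ * θ) ^ d * b)⁻¹ ^ 2 = C₂ * (s ^ d)⁻¹ ^ 2 := by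
        rw [hC₂, mul_assoc s, mul_pow s, mul_assoc (s ^ d), mul_inv, mul_pow]; ring
      rw [this]
      gcongr
      linarith
  have hcomp : IsCompact (closure Ω) := hΩ.isBounded.isCompact_closure
  have := hcomp.induction_on (p := fun t => ∃ C > 0, ∀ s : ℝ, 0 < s → s ≤ 1 →
      ∀ (u : E d → ℝ) (G : E d → E d), IntegrableOn u Ω →
      IntegrableOn G Ω → HasWeakGradient Ω u G →
      ∫⁻ x in Ω ∩ t, ‖u x‖ₑ ^ 2 ≤ ENNReal.ofReal (C * s ^ 2) * (∫⁻ x in Ω, ‖G x‖ₑ ^ 2)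
        + ENNReal.ofReal (C * (s ^ d)⁻¹ ^ 2) * (∫⁻ x in Ω, ‖u x‖ₑ) ^ 2) ?_ ?_ ?_ hloc
  · rwa [inter_eq_left.2 subset_closure] at this
  · exact ⟨1, one_pos, fun s hs hs1 u G _ _ _ => by simp⟩
  · rintro s t hst ⟨C, hC, h⟩
    exact ⟨C, hC, fun r hr hr1 u G hu hG hw =>
      (lintegral_mono_set (inter_subset_inter_right _ hst)).trans (h r hr hr1 u G hu hG hw)⟩
  · rintro s t ⟨C, hC, h⟩ ⟨C', hC', h'⟩
    refine ⟨C + C', add_pos hC hC', fun r hr hr1 u G hu hG hw => ?_⟩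
    rw [inter_union_distrib_left]
    refine (lintegral_union_le _ _ _).trans
      ((add_le_add (h r hr hr1 u G hu hG hw) (h' r hr hr1 u G hu hG hw)).trans_eq ?_)
    rw [add_mul, add_mul, ENNReal.ofReal_add (by positivity) (by positivity),
      ENNReal.ofReal_add (by positivity) (by positivity)]
    ring

end

/-! ### The gradient of the chemical potential and the dissipation estimate. -/

section

variable {d : ℕ} {Ω : Set (E d)}

/-! ### Calculus of weak gradients -/

theorem HasWeakGradient.congr_ae {u u' : E d → ℝ} {G G' : E d → E d}
    (h : HasWeakGradient Ω u G) (hu : u =ᵐ[volume.restrict Ω] u')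
    (hG : G =ᵐ[volume.restrict Ω] G') : HasWeakGradient Ω u' G' := by
  intro η hη v
  rw [← integral_congr_ae (f := fun x => u x * fderiv ℝ η x v)
    (hu.mono fun x hx => by simp only [hx]), h η hη v]
  congr 1
  exact integral_congr_ae (hG.mono fun x hx => by simp only [hx])

theorem HasWeakGradient.add_smul {u u' : E d → ℝ} {G G' : E d → E d}
    (h : HasWeakGradient Ω u G) (h' : HasWeakGradient Ω u' G') (hu : IntegrableOn u Ω)
    (hu' : IntegrableOn u' Ω) (hG : IntegrableOn G Ω) (hG' : IntegrableOn G' Ω) (c : ℝ) :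
    HasWeakGradient Ω (fun x => u x + c * u' x) (fun x => G x + c • G' x) := by
  intro η hη v
  obtain ⟨C, hC0, hC⟩ := hη.exists_bound
  obtain ⟨C', hC0', hC'⟩ := hη.exists_bound_fderiv v
  have hηm := hη.smooth.continuous.aestronglyMeasurable (μ := volume.restrict Ω)
  have hη'm := (hη.continuous_fderiv_apply v).aestronglyMeasurable (μ := volume.restrict Ω)
  have i1 {f : E d → ℝ} (hf : IntegrableOn f Ω volume) : IntegrableOn (fun x => f x * fderiv ℝ η x v) Ω :=
    Integrable.mul_bdd (μ := volume.restrict Ω) (c := C') hf hη'm (Eventually.of_forall hC')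
  have i2 {f : E d → E d} (hf : IntegrableOn f Ω volume) :
      IntegrableOn (fun x => inner ℝ (f x) v * η x) Ω :=
    Integrable.mul_bdd (μ := volume.restrict Ω) (c := C) (hf.inner_const v) hηm (Eventually.of_forall hC)
  simp only [add_mul, inner_add_left, real_inner_smul_left, mul_assoc]
  rw [integral_add (i1 hu) ((i1 hu').const_mul c), integral_add (i2 hG) ((i2 hG').const_mul c),
    integral_const_mul, integral_const_mul, h η hη v, h' η hη v]
  ring

/-- The fundamental lemma of the calculus of variations, the vector valued integral being tested
against each direction v. -/
theorem HasWeakGradient.ae_unique (hΩ : IsOpen Ω) {u : E d → ℝ} {G G' : E d → E d}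
    (h : HasWeakGradient Ω u G) (h' : HasWeakGradient Ω u G') (hG : IntegrableOn G Ω)
    (hG' : IntegrableOn G' Ω) : G =ᵐ[volume.restrict Ω] G' := by
  have key : ∀ᵐ x, x ∈ Ω → (G x - G' x) = 0 := by
    refine hΩ.ae_eq_zero_of_integral_contDiff_smul_eq_zero
      (hG.sub hG').locallyIntegrableOn fun η hη hc hs => ?_
    have ht : IsTestFunction Ω η := ⟨hη, hc, hs⟩
    obtain ⟨C, hC0, hC⟩ := ht.exists_bound
    have hi : IntegrableOn (fun x => η x • (G x - G' x)) Ω :=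
      Integrable.bdd_smul (μ := volume.restrict Ω) (hG.sub hG') C
        hη.continuous.aestronglyMeasurable (Eventually.of_forall hC)
    rw [← setIntegral_eq_integral_of_forall_compl_eq_zero (s := Ω)
      (fun x hx => by rw [ht.eq_zero hx, zero_smul])]
    refine ext_inner_left ℝ fun v => ?_
    rw [inner_zero_right, ← integral_inner hi v]
    have i2 {f : E d → E d} (hf : IntegrableOn f Ω volume) :
        IntegrableOn (fun x => inner ℝ (f x) v * η x) Ω :=
      Integrable.mul_bdd (μ := volume.restrict Ω) (c := C) (hf.inner_const v)
        hη.continuous.aestronglyMeasurable (Eventually.of_forall hC)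
    have e := (h η ht v).symm.trans (h' η ht v)
    have e' := integral_sub (i2 hG) (i2 hG')
    rw [neg_inj.1 e, sub_self] at e'
    rw [← e']
    refine integral_congr_ae (Eventually.of_forall fun x => ?_)
    simp only [real_inner_smul_right, inner_sub_right, real_inner_comm v]
    ring
  filter_upwards [(ae_restrict_iff' hΩ.measurableSet).2 key] with x hx
  exact sub_eq_zero.1 hx

/-- A function with a continuous derivative that is bounded below by a positive constant has a
left inverse with a bounded continuous derivative. -/
theorem exists_leftInverse_of_deriv_ge {β β' : ℝ → ℝ} {c : ℝ} (hc : 0 < c)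
    (hβ : ∀ s, HasDerivAt β (β' s) s) (hβ' : Continuous β') (hle : ∀ s, c ≤ β' s) :
    ∃ b b' : ℝ → ℝ, (∀ s, b (β s) = s) ∧ (∀ r, HasDerivAt b (b' r) r) ∧ Continuous b' ∧
      (∀ r, |b' r| ≤ c⁻¹) ∧ ∀ s, b' (β s) = (β' s)⁻¹ := by
  have hpos (s) : 0 < β' s := hc.trans_le (hle s)
  have hmono : StrictMono β := strictMono_of_hasDerivAt_pos hβ hpos
  have hcont : Continuous β := continuous_iff_continuousAt.2 fun s => (hβ s).continuousAt
  have hgrow {x y : ℝ} (hxy : x ≤ y) : c * (y - x) ≤ β y - β x :=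
    convex_univ.mul_sub_le_image_sub_of_le_deriv hcont.continuousOn
      (fun s _ => (hβ s).differentiableAt.differentiableWithinAt)
      (fun s _ => by rw [(hβ s).deriv]; exact hle s) x (mem_univ _) y (mem_univ _) hxy
  have hsurj : Function.Surjective β := by
    refine hcont.surjective ?_ ?_
    · refine tendsto_atTop_mono' atTop (f₁ := fun s => β 0 + c * s) ?_ ?_
      · filter_upwards [eventually_ge_atTop 0] with s hs
        have := hgrow hs
        simp only [sub_zero] at this
        linarith
      · exact tendsto_atTop_add_const_left _ _ (tendsto_id.const_mul_atTop hc)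
    · refine tendsto_atBot_mono' atBot (f₂ := β) (f₁ := fun s => β 0 + c * s) ?_ ?_
      · filter_upwards [eventually_le_atBot 0] with s hs
        have := hgrow hs
        simp only [zero_sub] at this
        linarith
      · exact tendsto_atBot_add_const_left _ _ (tendsto_id.const_mul_atBot hc)
  set e := hmono.orderIsoOfSurjective β hsurj with he
  have hes (s) : e s = β s := rfl
  have heb (s) : e.symm (β s) = s := by rw [← hes, OrderIso.symm_apply_apply]
  have hbe (r) : β (e.symm r) = r := by rw [← hes, OrderIso.apply_symm_apply]
  refine ⟨e.symm, fun r => (β' (e.symm r))⁻¹, heb, fun r => ?_, ?_, fun r => ?_, fun s => ?_⟩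
  · exact (hβ (e.symm r)).of_local_left_inverse e.symm.continuous.continuousAt (hpos _).ne'
      (Eventually.of_forall hbe)
  · exact (hβ'.comp e.symm.continuous).inv₀ fun r => (hpos _).ne'
  · rw [abs_of_pos (inv_pos.2 (hpos _))]
    exact inv_anti₀ hc (hle _)
  · simp only [heb]

/-! ### The gradient of the chemical potential -/

/-- A real infimum is meaningful only for a set that is bounded below; here |a| ≤ ‖J‖_{L¹} provides
the bound. -/
theorem sInf_aCoef_le {J : E d → ℝ} (hJ : Integrable J) {x : E d} (hx : x ∈ Ω) :
    sInf (aCoef Ω J '' Ω) ≤ aCoef Ω J x := by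
  refine csInf_le ⟨-∫ y, |J y|, ?_⟩ ⟨x, hx, rfl⟩
  rintro _ ⟨y, _, rfl⟩
  exact neg_le_of_abs_le (abs_aCoef_le hJ y)

theorem ConvexityAssumption.hasDerivAt_deriv {J : E d → ℝ} {F : ℝ → ℝ}
    (hF : ConvexityAssumption Ω J F) (s : ℝ) : HasDerivAt (deriv F) (deriv (deriv F) s) s := by
  have : ContDiff ℝ (1 + 1) F := by simpa [one_add_one_eq_two] using hF.contDiff
  exact ((contDiff_succ_iff_deriv.1 this).2.2.differentiable (by simp) s).hasDerivAt

/-- The weak gradient of `μ = aφ - J * φ + F'(φ)`. -/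
theorem ae_eq_grad_chemicalPotential (hΩ : IsOpen Ω) (hvol : volume Ω ≠ ⊤) {J : E d → ℝ}
    {K : E d → E d} {F : ℝ → ℝ} (hJ : Integrable J) (hK : Integrable K)
    (hJK : HasWeakGradient univ J K) (hF : ConvexityAssumption Ω J F) {φ m : E d → ℝ}
    {Gφ Gm : E d → E d} (hφ : IntegrableOn φ Ω) (hm : IntegrableOn m Ω) (hGφ : IntegrableOn Gφ Ω)
    (hGm : IntegrableOn Gm Ω) (hφw : HasWeakGradient Ω φ Gφ) (hmw : HasWeakGradient Ω m Gm)
    (hmφ : ∀ᵐ x ∂volume.restrict Ω,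
      m x = aCoef Ω J x * φ x - conv Ω J φ x + deriv F (φ x)) :
    ∀ᵐ x ∂volume.restrict Ω, Gm x = (aCoef Ω J x + deriv (deriv F) (φ x)) • Gφ x
      + φ x • convVec Ω K (fun _ => 1) x - convVec Ω K φ x := by
  set a := aCoef Ω J with ha
  set A := convVec Ω K fun _ => 1 with hA
  set κ := convVec Ω K φ with hκ
  obtain ⟨c₀, hc₀, hF0⟩ := hF.lower
  set a₀ := sInf (aCoef Ω J '' Ω) with ha₀
  have h1 : IntegrableOn (fun _ : E d => (1 : ℝ)) Ω :=
    integrableOn_const (hs := hvol)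
  have hai : IntegrableOn a Ω := by
    rw [ha, aCoef_eq_conv]; exact (integrable_conv hJ h1).integrableOn
  have hAi : IntegrableOn A Ω := (integrable_convVec hK h1).integrableOn
  have hκi : IntegrableOn κ Ω := (integrable_convVec hK hφ).integrableOn
  have haw : HasWeakGradient Ω a A := by
    rw [ha, aCoef_eq_conv]; exact hasWeakGradient_conv hJ hK hJK h1
  have haM : ∀ᵐ x ∂volume.restrict Ω, |a x| ≤ ∫ y, |J y| :=
    Eventually.of_forall fun x => abs_aCoef_le hJ x
  have hAM : ∀ᵐ x ∂volume.restrict Ω, ‖A x‖ ≤ ∫ y, ‖K y‖ :=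
    Eventually.of_forall fun x => norm_convVec_one_le hK x
  have hci : IntegrableOn (conv Ω J φ) Ω := (integrable_conv hJ hφ).integrableOn
  have haφ := hφw.mul_bounded hΩ hφ hGφ hai.1 hAi.1 haM hAM haw
  have hcw := hasWeakGradient_conv hJ hK hJK hφ
  have haφi : IntegrableOn (fun x => a x * φ x) Ω := hφ.bdd_mul hai.1 haM
  have hGaφi : IntegrableOn (fun x => a x • Gφ x + φ x • A x) Ω :=
    (Integrable.bdd_smul hGφ _ hai.1 haM).add (Integrable.smul_bdd hφ _ hAi.1 hAM)
  have hz := (haφ.add_smul hcw haφi hci hGaφi hκi (-1))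
  have hzi := haφi.add (hci.const_mul (-1))
  have hGzi := hGaφi.add (hκi.smul (-1 : ℝ))
  have hb1 := hmw.add_smul hz hm hzi hGm hGzi (-1)
  have hb1i := hm.add (hzi.const_mul (-1))
  have hGb1i := hGm.add (hGzi.smul (-1 : ℝ))
  have hb := hb1.add_smul hφw hb1i hφ hGb1i hGφ a₀
  have hbi := hb1i.add (hφ.const_mul a₀)
  have hGbi := hGb1i.add (hGφ.smul a₀)
  -- β(φ) is μ - aφ + J * φ + a₀φ, so it has a weak gradient without any chain rule for F'. As β' ≥
  -- c₀, the inverse of β has a bounded derivative. The chain rule for φ = β⁻¹(β(φ)) and uniqueness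
  -- of weak gradients give ∇φ = ∇(β(φ))/β'(φ), which is solved for ∇μ.
  set β : ℝ → ℝ := fun s => deriv F s + a₀ * s with hβ
  set β' : ℝ → ℝ := fun s => deriv (deriv F) s + a₀ with hβ'
  have hβd (s) : HasDerivAt β (β' s) s := by
    have := (hF.hasDerivAt_deriv s).add ((hasDerivAt_id s).const_mul a₀)
    rw [mul_one] at this
    exact this
  have hβc : Continuous β' := by
    have : ContDiff ℝ (1 + 1) F := by simpa [one_add_one_eq_two] using hF.contDiff
    have h2 := (contDiff_succ_iff_deriv.1 this).2.2
    exact (h2.continuous_deriv (by simp)).add continuous_const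
  obtain ⟨b, b', hbβ, hbd, hbc, hbM, hb'⟩ := exists_leftInverse_of_deriv_ge hc₀ hβd hβc hF0
  have hβφ : (fun x => (fun x => m x + -1 * (a x * φ x + -1 * conv Ω J φ x)) x + a₀ * φ x)
      =ᵐ[volume.restrict Ω] fun x => β (φ x) := by
    filter_upwards [hmφ] with x hx
    simp only [hβ, hx]
    ring
  have hw := hb.congr_ae hβφ (EventuallyEq.refl _ _)
  have hβφi : IntegrableOn (fun x => β (φ x)) Ω := hbi.congr hβφ
  have hfin := hw.comp hΩ hβφi hGbi hbd hbc hbM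
  simp only [hbβ, hb'] at hfin
  have hGfin : IntegrableOn (fun x => (β' (φ x))⁻¹ • ((Gm x + (-1 : ℝ) • (a x • Gφ x + φ x • A x
      + (-1 : ℝ) • κ x)) + a₀ • Gφ x)) Ω := by
    refine Integrable.bdd_smul (φ := fun x => (β' (φ x))⁻¹) hGbi c₀⁻¹ ?_ (Eventually.of_forall fun x => ?_)
    · exact ((hβc.inv₀ fun r => (hc₀.trans_le (hF0 r)).ne')).comp_aestronglyMeasurable hφ.1
    · have := hbM (β (φ x))
      rwa [hb'] at this
  filter_upwards [hφw.ae_unique hΩ hfin hGφ hGfin] with x hx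
  have hne : β' (φ x) ≠ 0 := (hc₀.trans_le (hF0 (φ x))).ne'
  have hx' : β' (φ x) • Gφ x = (Gm x + (-1 : ℝ) • (a x • Gφ x + φ x • A x
      + (-1 : ℝ) • κ x)) + a₀ • Gφ x := by
    conv_lhs => rw [hx]
    rw [smul_inv_smul₀ hne]
    rfl
  have e : Gm x = β' (φ x) • Gφ x - a₀ • Gφ x + (a x • Gφ x + φ x • A x - κ x) := by
    rw [hx']; module
  rw [e, hβ']
  module

/-- The dissipation estimate: testing the equation with a nondecreasing function of `φ`. -/
theorem dissipation_le (hΩ : IsOpen Ω) (hvol : volume Ω ≠ ⊤) {J : E d → ℝ}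
    {K : E d → E d} {F : ℝ → ℝ} (hJ : Integrable J) (hK : Integrable K)
    (hJK : HasWeakGradient univ J K) (hF : ConvexityAssumption Ω J F) {c₀ : ℝ} (hc₀ : 0 < c₀)
    {φ m : E d → ℝ} {Gφ Gm : E d → E d} (hφ : MemLp φ 2 (volume.restrict Ω))
    (hm : MemLp m 2 (volume.restrict Ω)) (hGφ : MemLp Gφ 2 (volume.restrict Ω))
    (hGm : MemLp Gm 2 (volume.restrict Ω)) (hφw : HasWeakGradient Ω φ Gφ)
    (hmw : HasWeakGradient Ω m Gm)
    (hmφ : ∀ᵐ x ∂volume.restrict Ω,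
      m x = aCoef Ω J x * φ x - conv Ω J φ x + deriv F (φ x))
    {ρ χ : ℝ → ℝ} {M N : ℝ} (hρ : Continuous ρ) (hχ : Continuous χ) (hρM : ∀ s, |ρ s| ≤ M)
    (hχM : ∀ s, |χ s| ≤ N)
    (hmono : ∀ a b, ρ a ^ 2 * b ^ 2 ≤ ρ a ^ 2 * a ^ 2 + ρ b ^ 2 * b ^ 2)
    (hχρ : ∀ s, χ s ^ 2 ≤ ρ s ^ 2 * (deriv (deriv F) s + sInf (aCoef Ω J '' Ω) - c₀ / 2)) :
    -∫ x in Ω, inner ℝ (Gm x) (ρ (φ x) ^ 2 • Gφ x)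
      ≤ -(∫ x in Ω, χ (φ x) ^ 2 * ‖Gφ x‖ ^ 2)
        + (3 * (∫ y, ‖K y‖) ^ 2 / c₀) * ∫ x in Ω, ρ (φ x) ^ 2 * φ x ^ 2 := by
  have : IsFiniteMeasure (volume.restrict Ω) := ⟨by simpa using hvol.lt_top⟩
  set ν := volume.restrict Ω with hν
  have hφi : IntegrableOn φ Ω := hφ.integrable one_le_two
  have hmi : IntegrableOn m Ω := hm.integrable one_le_two
  have hGφi : IntegrableOn Gφ Ω := hGφ.integrable one_le_two
  have hGmi : IntegrableOn Gm Ω := hGm.integrable one_le_two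
  have hgrad := ae_eq_grad_chemicalPotential hΩ hvol hJ hK hJK hF hφi hmi hGφi hGmi hφw hmw hmφ
  set κ := convVec Ω K φ with hκ
  set L := ∫ y, ‖K y‖ with hL
  have hL0 : 0 ≤ L := integral_nonneg fun _ => norm_nonneg _
  have hLe : ∫⁻ z, ‖K z‖ₑ = ENNReal.ofReal L := (ofReal_integral_norm_eq_lintegral_enorm hK).symm
  have hκm : AEStronglyMeasurable κ ν := (integrable_convVec hK hφi).1.restrict
  have hρφm : AEStronglyMeasurable (fun x => ρ (φ x) ^ 2) ν :=
    (hρ.pow 2).comp_aestronglyMeasurable hφ.1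
  have hρφM : ∀ᵐ x ∂ν, ‖ρ (φ x) ^ 2‖ ≤ M ^ 2 := Eventually.of_forall fun x => by
    rw [norm_pow, Real.norm_eq_abs]
    exact pow_le_pow_left₀ (abs_nonneg _) (hρM _) 2
  have hφ2 : Integrable (fun x => φ x ^ 2) ν := hφ.integrable_sq
  have hQi : Integrable (fun x => ρ (φ x) ^ 2 * φ x ^ 2) ν := hφ2.bdd_mul hρφm hρφM
  have hGφ2 : Integrable (fun x => ‖Gφ x‖ ^ 2) ν := hGφ.norm.integrable_sq
  have hχi : Integrable (fun x => χ (φ x) ^ 2 * ‖Gφ x‖ ^ 2) ν := by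
    refine hGφ2.bdd_mul (c := N ^ 2) ((hχ.pow 2).comp_aestronglyMeasurable hφ.1)
      (Eventually.of_forall fun x => ?_)
    rw [norm_pow, Real.norm_eq_abs]
    exact pow_le_pow_left₀ (abs_nonneg _) (hχM _) 2
  have hlhs : Integrable (fun x => inner ℝ (Gm x) (ρ (φ x) ^ 2 • Gφ x)) ν := by
    simp only [real_inner_smul_right]
    have hin : Integrable (fun x => inner ℝ (Gm x) (Gφ x)) ν := by
      refine (hGm.norm.integrable_mul hGφ.norm).mono' (hGm.1.inner hGφ.1)
        (Eventually.of_forall fun x => ?_)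
      exact norm_inner_le_norm _ _
    exact hin.bdd_mul hρφm hρφM
  have hee (r : ℝ) : ‖r‖ₑ ^ 2 = ENNReal.ofReal (r ^ 2) := by
    rw [Real.enorm_eq_ofReal_abs, ← ENNReal.ofReal_pow (abs_nonneg _), sq_abs]
  have hnl := lintegral_weight_mul_convVec_sq_le (Ω := Ω) hK hφ.1 hρ.measurable hmono
  have hκe (x : E d) : ‖ρ (φ x)‖ₑ ^ 2 * ‖κ x‖ₑ ^ 2 = ENNReal.ofReal (ρ (φ x) ^ 2 * ‖κ x‖ ^ 2) := by
    rw [hee, ENNReal.ofReal_mul (sq_nonneg _), ENNReal.ofReal_pow (norm_nonneg _), ofReal_norm]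
  have hQe (x : E d) : ‖ρ (φ x)‖ₑ ^ 2 * ‖φ x‖ₑ ^ 2 = ENNReal.ofReal (ρ (φ x) ^ 2 * φ x ^ 2) := by
    rw [hee, hee, ENNReal.ofReal_mul (sq_nonneg _)]
  rw [← hκ] at hnl
  simp only [hκe, hQe] at hnl
  rw [hLe, ← ofReal_integral_eq_lintegral_ofReal hQi
    (Eventually.of_forall fun x => mul_nonneg (sq_nonneg _) (sq_nonneg _))] at hnl
  set Q := ∫ x in Ω, ρ (φ x) ^ 2 * φ x ^ 2 with hQ
  have hQ0 : 0 ≤ Q := integral_nonneg fun x => mul_nonneg (sq_nonneg _) (sq_nonneg _)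
  have hrhs : 2 * ENNReal.ofReal L ^ 2 * ENNReal.ofReal Q = ENNReal.ofReal (2 * L ^ 2 * Q) := by
    rw [ENNReal.ofReal_mul (by positivity), ENNReal.ofReal_mul (by norm_num), ENNReal.ofReal_pow hL0,
      ENNReal.ofReal_ofNat]
  rw [hrhs] at hnl
  have hκi : Integrable (fun x => ρ (φ x) ^ 2 * ‖κ x‖ ^ 2) ν := by
    refine ⟨hρφm.mul (hκm.norm.pow 2), ?_⟩
    rw [HasFiniteIntegral]
    refine lt_of_le_of_lt (le_of_eq ?_) (hnl.trans_lt ENNReal.ofReal_lt_top)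
    refine lintegral_congr fun x => ?_
    rw [Real.enorm_of_nonneg (mul_nonneg (sq_nonneg _) (sq_nonneg _))]
  have hκQ : ∫ x in Ω, ρ (φ x) ^ 2 * ‖κ x‖ ^ 2 ≤ 2 * L ^ 2 * Q := by
    rw [← ofReal_integral_eq_lintegral_ofReal hκi
      (Eventually.of_forall fun x => mul_nonneg (sq_nonneg _) (sq_nonneg _))] at hnl
    exact (ENNReal.ofReal_le_ofReal_iff (by positivity)).1 hnl
  -- Each of the terms φ∇a and ∇J * φ is paid for with (c₀/4)|∇φ|², together the c₀/2 that `hχρ`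
  -- holds back. After integration they contribute one and two multiples of L²/c₀, whence the
  -- constant 3.
  have hpt : ∀ᵐ x ∂ν, χ (φ x) ^ 2 * ‖Gφ x‖ ^ 2 - (L ^ 2 / c₀ * (ρ (φ x) ^ 2 * φ x ^ 2)
      + c₀⁻¹ * (ρ (φ x) ^ 2 * ‖κ x‖ ^ 2)) ≤ inner ℝ (Gm x) (ρ (φ x) ^ 2 • Gφ x) := by
    filter_upwards [hgrad, ae_restrict_mem hΩ.measurableSet] with x hx hxΩ
    rw [hx, real_inner_smul_right, inner_sub_left, inner_add_left, real_inner_smul_left,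
      real_inner_smul_left, real_inner_self_eq_norm_sq]
    have ha := sInf_aCoef_le hJ hxΩ
    set A := convVec Ω K (fun _ => 1) x
    have hAL : ‖A‖ ≤ L := norm_convVec_one_le hK x
    have hi1 : |φ x * inner ℝ A (Gφ x)| ≤ |φ x| * L * ‖Gφ x‖ := by
      rw [abs_mul, mul_assoc]
      gcongr
      exact (abs_real_inner_le_norm _ _).trans (by gcongr)
    have hi2 : |inner ℝ (κ x) (Gφ x)| ≤ ‖κ x‖ * ‖Gφ x‖ := abs_real_inner_le_norm _ _
    set g := ‖Gφ x‖
    have hχx := hχρ (φ x)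
    set r := ρ (φ x) ^ 2 with hr
    have hr0 : 0 ≤ r := sq_nonneg _
    have hmain : -(L ^ 2 / c₀ * φ x ^ 2 + c₀⁻¹ * ‖κ x‖ ^ 2) - c₀ / 2 * g ^ 2
        ≤ φ x * inner ℝ A (Gφ x) - inner ℝ (κ x) (Gφ x) := by
      have h1 := neg_le_of_abs_le hi1
      have h2 := le_of_abs_le hi2
      have e1 : |φ x| * L * g ≤ L ^ 2 / c₀ * φ x ^ 2 + c₀ / 4 * g ^ 2 := by
        have := sq_nonneg (2 * (|φ x| * L) - c₀ * g)
        have h3 : 4 * c₀ * (|φ x| * L * g) ≤ 4 * (φ x ^ 2 * L ^ 2) + c₀ ^ 2 * g ^ 2 := by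
          rw [← sq_abs (φ x)]; nlinarith
        rw [← sub_nonneg] at h3 ⊢
        have : L ^ 2 / c₀ * φ x ^ 2 + c₀ / 4 * g ^ 2 - |φ x| * L * g
          = (4 * (φ x ^ 2 * L ^ 2) + c₀ ^ 2 * g ^ 2 - 4 * c₀ * (|φ x| * L * g)) / (4 * c₀) := by
          field_simp
        rw [this]
        positivity
      have e2 : ‖κ x‖ * g ≤ c₀⁻¹ * ‖κ x‖ ^ 2 + c₀ / 4 * g ^ 2 := by
        have := sq_nonneg (2 * ‖κ x‖ - c₀ * g)
        have h3 : 0 ≤ 4 * ‖κ x‖ ^ 2 + c₀ ^ 2 * g ^ 2 - 4 * c₀ * (‖κ x‖ * g) := by nlinarith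
        rw [← sub_nonneg]
        have : c₀⁻¹ * ‖κ x‖ ^ 2 + c₀ / 4 * g ^ 2 - ‖κ x‖ * g
          = (4 * ‖κ x‖ ^ 2 + c₀ ^ 2 * g ^ 2 - 4 * c₀ * (‖κ x‖ * g)) / (4 * c₀) := by
          field_simp
        rw [this]
        positivity
      linarith
    have h5 : χ (φ x) ^ 2 * g ^ 2 ≤ r * (aCoef Ω J x + deriv (deriv F) (φ x) - c₀ / 2) * g ^ 2 := by
      refine mul_le_mul_of_nonneg_right (hχx.trans (mul_le_mul_of_nonneg_left ?_ hr0)) (sq_nonneg _)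
      linarith
    have h6 := mul_le_mul_of_nonneg_left hmain hr0
    rw [show L ^ 2 / c₀ * (r * φ x ^ 2) + c₀⁻¹ * (r * ‖κ x‖ ^ 2)
      = r * (L ^ 2 / c₀ * φ x ^ 2 + c₀⁻¹ * ‖κ x‖ ^ 2) by ring]
    nlinarith
  have hint := integral_mono_ae (hχi.sub ((hQi.const_mul (L ^ 2 / c₀)).add (hκi.const_mul c₀⁻¹)))
    hlhs hpt
  rw [integral_sub' hχi ((hQi.const_mul (L ^ 2 / c₀)).add (hκi.const_mul c₀⁻¹)),
    integral_add' (hQi.const_mul (L ^ 2 / c₀)) (hκi.const_mul c₀⁻¹), integral_const_mul,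
    integral_const_mul] at hint
  have h7 : c₀⁻¹ * ∫ x in Ω, ρ (φ x) ^ 2 * ‖κ x‖ ^ 2 ≤ c₀⁻¹ * (2 * L ^ 2 * Q) := by gcongr
  have h8 : 3 * L ^ 2 / c₀ * Q = L ^ 2 / c₀ * Q + c₀⁻¹ * (2 * L ^ 2 * Q) := by
    field_simp; ring
  rw [h8]
  linarith

end

/-! ### Comparison and integration of increment inequalities in time. -/

section

/-- A smoothing estimate: comparison of a continuous function that satisfies an integrated
differential inequality on `(t₀, t₁]` with a multiple of a negative power of `t - t₀`. -/
theorem le_rpow_of_integral_inequality {y : ℝ → ℝ} {t₀ t₁ σ b : ℝ} (ht : t₀ < t₁) (hσ : 0 < σ)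
    (hb : 0 < b) (hy : ContinuousOn y (Icc t₀ t₁))
    (h : ∀ r s, t₀ < r → r ≤ s → s ≤ t₁ → y s - y r
      ≤ ∫ t in r..s, (b * (t - t₀) ^ (-σ - 1) - (σ + 1) / (t - t₀) * y t)) :
    y t₁ ≤ 2 * b * (t₁ - t₀) ^ (-σ) := by
  obtain ⟨M, hM⟩ := (isCompact_Icc.image_of_continuousOn hy).bddAbove
  have hMy (t) (ht : t ∈ Icc t₀ t₁) : y t ≤ M := hM ⟨t, ht, rfl⟩
  have hlim : Tendsto (fun a : ℝ => 2 * b * (a - t₀) ^ (-σ)) (𝓝[>] t₀) atTop := by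
    have h1 : Tendsto (fun a : ℝ => a - t₀) (𝓝[>] t₀) (𝓝[>] 0) := by
      refine tendsto_nhdsWithin_iff.2 ⟨?_, ?_⟩
      · have : Tendsto (fun a : ℝ => a - t₀) (𝓝 t₀) (𝓝 (t₀ - t₀)) :=
          (continuous_id.sub continuous_const).tendsto t₀
        rw [sub_self] at this
        exact this.mono_left nhdsWithin_le_nhds
      · filter_upwards [self_mem_nhdsWithin] with a ha
        exact sub_pos.2 (mem_Ioi.1 ha)
    exact ((tendsto_rpow_neg_nhdsGT_zero (neg_neg_of_pos hσ)).comp h1).const_mul_atTop (by positivity)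
  -- The barrier blows up at t₀, so the comparison can start at a time where it already exceeds the
  -- maximum of y. This is why y(t₀) does not enter the bound.
  obtain ⟨a, haM, ha0, ha1⟩ : ∃ a, M ≤ 2 * b * (a - t₀) ^ (-σ) ∧ t₀ < a ∧ a < t₁ := by
    have := (hlim.eventually (eventually_ge_atTop M)).and
      (show ∀ᶠ a in 𝓝[>] t₀, a ∈ Ioo t₀ t₁ from Ioo_mem_nhdsGT ht)
    obtain ⟨a, ha⟩ := this.exists
    exact ⟨a, ha.1, ha.2.1, ha.2.2⟩
  set g : ℝ → ℝ := fun t => b * (t - t₀) ^ (-σ - 1) - (σ + 1) / (t - t₀) * y t with hg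
  have hgc : ContinuousOn g (Icc a t₁) := by
    have hne : ∀ t ∈ Icc a t₁, t - t₀ ≠ 0 := fun t ht => (sub_pos.2 (ha0.trans_le ht.1)).ne'
    refine ContinuousOn.sub (continuousOn_const.mul ?_) (ContinuousOn.mul ?_ ?_)
    · exact (continuousOn_id.sub continuousOn_const).rpow_const fun t ht => Or.inl (hne t ht)
    · exact continuousOn_const.div (continuousOn_id.sub continuousOn_const) hne
    · exact hy.mono (Icc_subset_Icc_left ha0.le)
  have hmain := image_le_of_liminf_slope_right_lt_deriv_boundary' (f := y) (f' := g)
    (a := a) (b := t₁) (B := fun t => 2 * b * (t - t₀) ^ (-σ))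
    (B' := fun t => 2 * b * (-σ * (t - t₀) ^ (-σ - 1)))
    (hy.mono (Icc_subset_Icc_left ha0.le)) ?_ ?_ ?_ ?_ ?_
  · exact hmain (right_mem_Icc.2 ha1.le)
  · intro x hx r hr
    have hxt : x ∈ Icc a t₁ := Ico_subset_Icc_self hx
    have hev : ∀ᶠ t in 𝓝[Icc a t₁] x, g t < (g x + r) / 2 :=
      (hgc x hxt).eventually (gt_mem_nhds (by linarith))
    obtain ⟨ε, hε, hεs⟩ := Metric.mem_nhdsWithin_iff.1 hev
    apply Eventually.frequently
    filter_upwards [Ioo_mem_nhdsGT (show x < min t₁ (x + ε) from lt_min hx.2 (by linarith))]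
      with z hz
    have hzt : z < t₁ := hz.2.trans_le (min_le_left _ _)
    have hzε : z < x + ε := hz.2.trans_le (min_le_right _ _)
    have h1 := h x z (ha0.trans_le hx.1) hz.1.le hzt.le
    have h2 : ∫ t in x..z, g t ≤ ∫ t in x..z, (g x + r) / 2 := by
      refine intervalIntegral.integral_mono_on hz.1.le ?_ (by simp) fun t ht => ?_
      · refine ContinuousOn.intervalIntegrable_of_Icc hz.1.le (hgc.mono ?_)
        exact Icc_subset_Icc hx.1 hzt.le
      · refine le_of_lt (hεs ⟨?_, hx.1.trans ht.1, ht.2.trans hzt.le⟩)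
        rw [Metric.mem_ball, Real.dist_eq, abs_of_nonneg (by linarith [ht.1])]
        linarith [ht.2]
    rw [intervalIntegral.integral_const, smul_eq_mul] at h2
    rw [slope_def_field, div_lt_iff₀ (by linarith [hz.1])]
    have : 0 < z - x := by linarith [hz.1]
    nlinarith
  · exact (hMy a ⟨ha0.le, ha1.le⟩).trans haM
  · refine continuousOn_const.mul ((continuousOn_id.sub continuousOn_const).rpow_const
      fun t ht => Or.inl (sub_pos.2 (ha0.trans_le ht.1)).ne')
  · intro x hx
    have hx0 : x - t₀ ≠ 0 := (sub_pos.2 (ha0.trans_le hx.1)).ne'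
    have := ((((hasDerivAt_id x).sub_const t₀).rpow_const (p := -σ) (Or.inl hx0)).const_mul (2 * b))
    refine HasDerivAt.hasDerivWithinAt ?_
    convert! this using 1
    simp
  -- At a contact point y has slope at most -(2σ+1) b (x-t₀)^(-σ-1), strictly below the slope -2σ b
  -- (x-t₀)^(-σ-1) of the barrier.
  · intro x hx hxy
    have hx0 : 0 < x - t₀ := sub_pos.2 (ha0.trans_le hx.1)
    have e : (σ + 1) / (x - t₀) * (x - t₀) ^ (-σ) = (σ + 1) * (x - t₀) ^ (-σ - 1) := by
      rw [Real.rpow_sub_one hx0.ne']; ring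
    have hp : 0 < (x - t₀) ^ (-σ - 1) := Real.rpow_pos_of_pos hx0 _
    simp only [hg]
    rw [hxy]
    have : (σ + 1) / (x - t₀) * (2 * b * (x - t₀) ^ (-σ))
        = 2 * b * ((σ + 1) * (x - t₀) ^ (-σ - 1)) := by rw [← e]; ring
    rw [this]
    nlinarith [mul_pos hb hp]

/-- Continuity of translations in `L²`. -/
theorem tendsto_eLpNorm_translate_sub {X : Type*} [NormedAddCommGroup X] {g : ℝ → X}
    (hg : MemLp g 2) : Tendsto (fun s : ℝ => eLpNorm (fun t => g (t - s) - g t) 2 volume) (𝓝 0)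
      (𝓝 0) := by
  let c : C(ℝ, C(ℝ, ℝ)) := ContinuousMap.curry ⟨fun p : ℝ × ℝ => p.2 - p.1, by fun_prop⟩
  have hc (s) : MeasurePreserving (c s) volume volume := measurePreserving_sub_right volume s
  have hcont : Continuous fun s => Lp.compMeasurePreserving (c s) (hc s) (hg.toLp g) :=
    Continuous.compMeasurePreservingLp continuous_const c.continuous hc (by simp)
  have h0 := (hcont.tendsto 0).edist (tendsto_const_nhds (x := Lp.compMeasurePreserving (c 0) (hc 0)
    (hg.toLp g)))
  rw [edist_self] at h0
  refine h0.congr fun s => ?_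
  rw [Lp.edist_def]
  refine eLpNorm_congr_ae ?_
  have h1 (s) := Lp.coeFn_compMeasurePreserving (hg.toLp g) (hc s)
  have h2 (s) : (hg.toLp g : ℝ → X) ∘ c s =ᵐ[volume] g ∘ c s :=
    (hc s).quasiMeasurePreserving.ae_eq_comp hg.coeFn_toLp
  filter_upwards [h1 s, h2 s, h1 0, h2 0] with t a1 a2 a3 a4
  rw [Pi.sub_apply, a1, a2, a3, a4]
  simp [c]

/-- An increment inequality whose error is controlled by a translate of an `L²` function
integrates to an inequality without error. -/
theorem sub_le_integral_of_increment_le {X : Type*} [NormedAddCommGroup X] {g : ℝ → X}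
    (hg : MemLp g 2) {N : ℝ → ℝ} {y B : ℝ → ℝ} {a r s : ℝ} (har : a < r) (hrs : r ≤ s)
    (hN : MemLp N 2 (volume.restrict (Ioo r s))) (hy : ContinuousOn y (Icc a s))
    (hB : ContinuousOn B (Icc r s))
    (h : ∀ᵐ t ∂volume.restrict (Ioo r s), ∀ h ∈ Ioo 0 (r - a),
      ENNReal.ofReal (y t - y (t - h) - h * B t)
        ≤ ‖N t‖ₑ * ∫⁻ x in Ico 0 h, ‖g (t - x) - g t‖ₑ) :
    y s - y r ≤ ∫ t in r..s, B t := by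
  set ν := volume.restrict (Ioo r s) with hν
  set n := (eLpNorm N 2 ν).toReal with hn
  have hn0 : 0 ≤ n := ENNReal.toReal_nonneg
  have hne : eLpNorm N 2 ν = ENNReal.ofReal n := (ENNReal.ofReal_toReal hN.2.ne).symm
  have hBi : IntervalIntegrable B volume r s := hB.intervalIntegrable_of_Icc hrs
  -- Integrating the error in t and applying Cauchy–Schwarz for each shift x < h gives n times an L²
  -- distance between translates of g, hence at most h n ε altogether: o(h), as needed before
  -- dividing by h.
  have key (ε : ℝ) (hε : 0 < ε) : ∀ᶠ h in 𝓝[>] (0 : ℝ),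
      (∫ t in r..s, (y t - y (t - h))) ≤ h * ((∫ t in r..s, B t) + n * ε) := by
    have hev := (tendsto_eLpNorm_translate_sub hg).eventually
      (gt_mem_nhds (ENNReal.ofReal_pos.2 hε))
    obtain ⟨δ, hδ, hδs⟩ := Metric.eventually_nhds_iff.1 hev
    filter_upwards [Ioo_mem_nhdsGT (show (0 : ℝ) < min δ (r - a) from lt_min hδ (by linarith))]
      with h hh
    have hh0 : 0 < h := hh.1
    have hhδ : h < δ := hh.2.trans_le (min_le_left _ _)
    have hha : h < r - a := hh.2.trans_le (min_le_right _ _)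
    have hyi : IntervalIntegrable (fun t => y t - y (t - h)) volume r s := by
      refine ContinuousOn.intervalIntegrable_of_Icc hrs (ContinuousOn.sub ?_ ?_)
      · exact hy.mono (Icc_subset_Icc_left har.le)
      · refine hy.comp (by fun_prop) fun t ht => ⟨by linarith [ht.1], by linarith [ht.2]⟩
    have hfi : IntervalIntegrable (fun t => y t - y (t - h) - h * B t) volume r s :=
      hyi.sub (hBi.const_mul h)
    have hmeas : AEMeasurable (fun p : ℝ × ℝ => ‖N p.1‖ₑ * ‖g (p.1 - p.2) - g p.1‖ₑ)
        (ν.prod (volume.restrict (Ico 0 h))) := by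
      refine hN.1.comp_fst.enorm.mul ?_
      have : AEMeasurable (fun p : ℝ × ℝ => ‖g (p.1 - p.2) - g p.1‖ₑ) (volume.prod volume) :=
        ((hg.1.comp_quasiMeasurePreserving
          (quasiMeasurePreserving_sub_of_right_invariant volume volume)).sub hg.1.comp_fst).enorm
      exact this.mono_ac (Measure.AbsolutelyContinuous.prod
        Measure.restrict_le_self.absolutelyContinuous Measure.restrict_le_self.absolutelyContinuous)
    have hlin : ∫⁻ t, ENNReal.ofReal (y t - y (t - h) - h * B t) ∂ν
        ≤ ENNReal.ofReal (h * (n * ε)) := by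
      calc ∫⁻ t, ENNReal.ofReal (y t - y (t - h) - h * B t) ∂ν
          ≤ ∫⁻ t, ‖N t‖ₑ * (∫⁻ x in Ico 0 h, ‖g (t - x) - g t‖ₑ) ∂ν :=
            lintegral_mono_ae (by filter_upwards [‹∀ᵐ t ∂ν, _›] with t ht using ht h ⟨hh0, hha⟩)
        _ ≤ ∫⁻ t, ∫⁻ x in Ico 0 h, ‖N t‖ₑ * ‖g (t - x) - g t‖ₑ ∂volume ∂ν :=
            lintegral_mono fun t => lintegral_const_mul_le _ _
        _ = ∫⁻ x in Ico 0 h, ∫⁻ t, ‖N t‖ₑ * ‖g (t - x) - g t‖ₑ ∂ν := lintegral_lintegral_swap hmeas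
        _ ≤ ∫⁻ x in Ico 0 h, ENNReal.ofReal (n * ε) := by
            refine setLIntegral_mono' measurableSet_Ico fun x hx => ?_
            have hm2 : AEStronglyMeasurable (fun t => g (t - x) - g t) volume :=
              (hg.1.comp_quasiMeasurePreserving
                (measurePreserving_sub_right volume x).quasiMeasurePreserving).sub hg.1
            have h1 := ENNReal.lintegral_mul_le_Lp_mul_Lq ν Real.HolderConjugate.two_two
              hN.1.enorm hm2.restrict.enorm
            have e1 : (∫⁻ t, ‖N t‖ₑ ^ (2 : ℝ) ∂ν) ^ (1 / (2 : ℝ)) = eLpNorm N 2 ν := by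
              rw [eLpNorm_eq_lintegral_rpow_enorm_toReal (by simp) (by simp)]; simp
            have e2 : (∫⁻ t, ‖g (t - x) - g t‖ₑ ^ (2 : ℝ) ∂ν) ^ (1 / (2 : ℝ))
                = eLpNorm (fun t => g (t - x) - g t) 2 ν := by
              rw [eLpNorm_eq_lintegral_rpow_enorm_toReal (by simp) (by simp)]; simp
            rw [e1, e2, hne] at h1
            refine h1.trans ?_
            rw [ENNReal.ofReal_mul hn0]
            gcongr
            refine (eLpNorm_mono_measure _ Measure.restrict_le_self).trans (hδs ?_).le
            rw [dist_zero_right, Real.norm_of_nonneg hx.1]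
            exact hx.2.trans hhδ
        _ = _ := by
            rw [setLIntegral_const, Real.volume_Ico, sub_zero, mul_comm,
              ← ENNReal.ofReal_mul hh0.le]
    have hint : ∫ t in r..s, (y t - y (t - h) - h * B t) ≤ h * (n * ε) := by
      rw [intervalIntegral.integral_of_le hrs, integral_Ioc_eq_integral_Ioo]
      have hfi' : Integrable (fun t => y t - y (t - h) - h * B t) ν :=
        ((intervalIntegrable_iff_integrableOn_Ioo_of_le hrs).1 hfi)
      rw [integral_eq_lintegral_pos_part_sub_lintegral_neg_part hfi']
      have := ENNReal.toReal_mono ENNReal.ofReal_ne_top hlin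
      rw [ENNReal.toReal_ofReal (by positivity)] at this
      exact (sub_le_self _ ENNReal.toReal_nonneg).trans this
    rw [intervalIntegral.integral_sub hyi (hBi.const_mul h), intervalIntegral.integral_const_mul]
      at hint
    linarith
  have hIy {c e : ℝ} (hac : a ≤ c) (hce : c ≤ e) (hes : e ≤ s) : IntervalIntegrable y volume c e :=
    (hy.mono (Icc_subset_Icc hac hes)).intervalIntegrable_of_Icc hce
  -- The integral of the increments telescopes to means of y over intervals of length h ending at s
  -- and at r. Divided by h, they tend to y s and y r by continuity.
  have hshift : ∀ᶠ h in 𝓝[>] (0 : ℝ), (∫ t in r..s, (y t - y (t - h)))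
      = (∫ t in (s - h)..s, y t) - ∫ t in (r - h)..r, y t := by
    filter_upwards [Ioo_mem_nhdsGT (show (0 : ℝ) < r - a by linarith)] with h hh
    have h1 : IntervalIntegrable (fun t => y (t - h)) volume r s := by
      refine ContinuousOn.intervalIntegrable_of_Icc hrs ?_
      exact hy.comp (by fun_prop) fun t ht => ⟨by linarith [ht.1, hh.2], by linarith [ht.2, hh.1]⟩
    rw [intervalIntegral.integral_sub (hIy har.le hrs le_rfl) h1,
      intervalIntegral.integral_comp_sub_right]
    have i1 : IntervalIntegrable y volume (r - h) r :=
      hIy (by linarith [hh.2]) (by linarith [hh.1]) hrs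
    have i2 : IntervalIntegrable y volume r s := hIy har.le hrs le_rfl
    have i3 : IntervalIntegrable y volume (s - h) s :=
      hIy (by linarith [hh.2]) (by linarith [hh.1]) le_rfl
    have i4 : IntervalIntegrable y volume (r - h) (s - h) :=
      hIy (by linarith [hh.2]) (by linarith) (by linarith [hh.1])
    have e1 := intervalIntegral.integral_add_adjacent_intervals i1 i2
    have e2 := intervalIntegral.integral_add_adjacent_intervals i4 i3
    linarith
  have hlim (c : ℝ) (hac : a < c) (hcs : c ≤ s) :
      Tendsto (fun h => h⁻¹ * ∫ t in (c - h)..c, y t) (𝓝[>] 0) (𝓝 (y c)) := by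
    refine Metric.tendsto_nhds.2 fun ε hε => ?_
    have hcc : ContinuousWithinAt y (Icc a s) c := hy c ⟨hac.le, hcs⟩
    obtain ⟨δ, hδ, hδs⟩ := Metric.continuousWithinAt_iff.1 hcc (ε / 2) (by positivity)
    filter_upwards [Ioo_mem_nhdsGT (show (0 : ℝ) < min δ (c - a) from lt_min hδ (by linarith))]
      with h hh
    have hhδ : h < δ := hh.2.trans_le (min_le_left _ _)
    have hha : h < c - a := hh.2.trans_le (min_le_right _ _)
    have hh0 : 0 < h := hh.1
    have hi : IntervalIntegrable y volume (c - h) c := hIy (by linarith) (by linarith) hcs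
    have hb : ‖∫ t in (c - h)..c, (y t - y c)‖ ≤ ε / 2 * |c - (c - h)| := by
      refine intervalIntegral.norm_integral_le_of_norm_le_const fun t ht => ?_
      rw [uIoc_of_le (by linarith)] at ht
      refine (hδs ⟨by linarith [ht.1], ht.2.trans hcs⟩ ?_).le
      rw [Real.dist_eq, abs_sub_comm, abs_of_nonneg (by linarith [ht.2])]
      linarith [ht.1]
    rw [intervalIntegral.integral_sub hi (by simp), intervalIntegral.integral_const, sub_sub_cancel,
      smul_eq_mul, Real.norm_eq_abs, abs_of_pos hh0] at hb
    rw [Real.dist_eq]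
    have : h⁻¹ * (∫ t in (c - h)..c, y t) - y c = h⁻¹ * ((∫ t in (c - h)..c, y t) - h * y c) := by
      field_simp
    rw [this, abs_mul, abs_of_pos (inv_pos.2 hh0)]
    calc h⁻¹ * |(∫ t in (c - h)..c, y t) - h * y c| ≤ h⁻¹ * (ε / 2 * h) := by gcongr
      _ = ε / 2 := by field_simp
      _ < ε := by linarith
  have hfin (ε : ℝ) (hε : 0 < ε) : y s - y r ≤ (∫ t in r..s, B t) + n * ε := by
    refine le_of_tendsto ((hlim s (har.trans_le hrs) le_rfl).sub (hlim r har hrs)) ?_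
    filter_upwards [key ε hε, hshift, self_mem_nhdsWithin] with h h1 h2 h3
    have hh0 : (0 : ℝ) < h := h3
    rw [h2] at h1
    rw [← mul_sub, inv_mul_le_iff₀ hh0]
    exact h1
  refine le_of_forall_pos_le_add fun ε hε => ?_
  refine (hfin (ε / (n + 1)) (by positivity)).trans ?_
  gcongr
  rw [mul_div_assoc', div_le_iff₀ (by positivity)]
  nlinarith

end

/-! ### Weak derivatives in time and elements of V. -/

section

/-- A continuous function on `(0, T)` whose weak derivative is `-k` is a primitive of `-k`. -/
theorem sub_eq_neg_integral_of_weakDeriv {T : ℝ} {f k : ℝ → ℝ} (hf : ContinuousOn f (Ioo 0 T))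
    (hk : IntegrableOn k (Ioo 0 T))
    (h : ∀ θ : ℝ → ℝ, IsTestFunction (Ioo 0 T) θ →
      ∫ t in Ioo 0 T, deriv θ t * f t = ∫ t in Ioo 0 T, θ t * k t)
    {s t : ℝ} (hs : 0 < s) (hst : s ≤ t) (ht : t < T) :
    f t - f s = -∫ r in s..t, k r := by
  let c : ℕ → ContDiffBump (0 : ℝ) := fun n =>
    ⟨1 / (2 * (n + 1)), 1 / (n + 1), by positivity, by
      apply one_div_lt_one_div_of_lt <;> [positivity; linarith [(Nat.cast_nonneg n : (0 : ℝ) ≤ n)]]⟩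
  have hcout : Tendsto (fun n => (c n).rOut) atTop (𝓝 0) := tendsto_one_div_add_atTop_nhds_zero_nat
  set ρ : ℕ → ℝ → ℝ := fun n => (c n).normed volume with hρ
  have hρs (n) : ContDiff ℝ ∞ (ρ n) := (c n).contDiff_normed
  have hρi (n) : Integrable (ρ n) := (c n).integrable_normed
  have hρ0 (n x) : 0 ≤ ρ n x := (c n).nonneg_normed x
  have hρ1 (n) : ∫ x, ρ n x = 1 := (c n).integral_normed
  have hρz (n) (x) (hx : (c n).rOut ≤ |x|) : ρ n x = 0 := by
    by_contra hne
    have : x ∈ Function.support (ρ n) := hne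
    rw [hρ, ContDiffBump.support_normed_eq, mem_ball_zero_iff, Real.norm_eq_abs] at this
    linarith
  -- D is the derivative of a smooth approximation θ of the indicator of (s, t]. It has mean zero,
  -- so θ vanishes again beyond t and is a test function; ∫ Dₙ f tends to f s - f t because f is
  -- continuous.
  set D : ℕ → ℝ → ℝ := fun n x => ρ n (x - s) - ρ n (x - t) with hD
  have hDs (n) : ContDiff ℝ ∞ (D n) :=
    ((hρs n).comp (contDiff_id.sub contDiff_const)).sub ((hρs n).comp (contDiff_id.sub contDiff_const))
  have hDi (n) : Integrable (D n) := ((hρi n).comp_sub_right s).sub ((hρi n).comp_sub_right t)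
  have hD0 (n) : ∫ x, D n x = 0 := by
    rw [integral_sub ((hρi n).comp_sub_right s) ((hρi n).comp_sub_right t),
      integral_sub_right_eq_self (ρ n), integral_sub_right_eq_self (ρ n), sub_self]
  set θ : ℕ → ℝ → ℝ := fun n x => ∫ u in (0 : ℝ)..x, D n u with hθ
  have hθd (n x) : HasDerivAt (θ n) (D n x) x :=
    intervalIntegral.integral_hasDerivAt_right ((hDs n).continuous.intervalIntegrable _ _)
      ((hDs n).continuous.stronglyMeasurableAtFilter _ _) (hDs n).continuous.continuousAt
  have hθderiv (n) : deriv (θ n) = D n := funext fun x => (hθd n x).deriv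
  have hθs (n) : ContDiff ℝ ∞ (θ n) := by
    rw [contDiff_infty_iff_deriv, hθderiv]
    exact ⟨fun x => (hθd n x).differentiableAt, hDs n⟩
  -- the support of the test function
  have hsmall : ∀ᶠ n in atTop, (c n).rOut < min (s / 2) ((T - t) / 2) :=
    hcout.eventually (gt_mem_nhds (lt_min (by linarith) (by linarith)))
  have hDz (n) (x) (hx : x ≤ s - (c n).rOut ∨ t + (c n).rOut ≤ x) : D n x = 0 := by
    simp only [hD]
    rcases hx with hx | hx
    · rw [hρz n _ (by rw [abs_sub_comm, le_abs]; left; linarith),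
        hρz n _ (by rw [abs_sub_comm, le_abs]; left; linarith), sub_zero]
    · rw [hρz n _ (by rw [le_abs]; left; linarith),
        hρz n _ (by rw [le_abs]; left; linarith), sub_zero]
  have hθz1 (n) (hn : (c n).rOut < s / 2) (x) (hx : x ≤ s - (c n).rOut) : θ n x = 0 := by
    simp only [hθ]
    rw [intervalIntegral.integral_congr (g := fun _ => 0), intervalIntegral.integral_zero]
    intro u hu
    refine hDz n u (Or.inl ?_)
    rcases le_total 0 x with h0 | h0
    · rw [uIcc_of_le h0] at hu; linarith [hu.2]
    · rw [uIcc_of_ge h0] at hu; linarith [hu.2]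
  have hθz2 (n) (hn : (c n).rOut < s / 2) (x) (hx : t + (c n).rOut ≤ x) : θ n x = 0 := by
    simp only [hθ]
    rw [intervalIntegral.integral_eq_integral_of_support_subset, hD0]
    intro u hu
    by_contra hne
    apply hu
    refine hDz n u ?_
    rw [mem_Ioc, not_and_or, not_lt, not_le] at hne
    rcases hne with h0 | h0
    · left; linarith
    · right; linarith
  have htest : ∀ᶠ n in atTop, IsTestFunction (Ioo 0 T) (θ n) := by
    filter_upwards [hsmall] with n hn
    have hn1 : (c n).rOut < s / 2 := hn.trans_le (min_le_left _ _)
    have hn2 : (c n).rOut < (T - t) / 2 := hn.trans_le (min_le_right _ _)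
    have hsup : Function.support (θ n) ⊆ Icc (s / 2) (t + (T - t) / 2) := by
      intro x hx
      by_contra hne
      apply hx
      rw [mem_Icc, not_and_or, not_le, not_le] at hne
      rcases hne with h0 | h0
      · exact hθz1 n hn1 x (by linarith)
      · exact hθz2 n hn1 x (by linarith)
    have hts : tsupport (θ n) ⊆ Icc (s / 2) (t + (T - t) / 2) :=
      closure_minimal hsup isClosed_Icc
    exact ⟨hθs n, HasCompactSupport.of_support_subset_isCompact isCompact_Icc hsup,
      hts.trans fun x hx => ⟨by linarith [hx.1], by linarith [hx.2]⟩⟩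
  have hθb (n x) : |θ n x| ≤ 2 := by
    simp only [hθ]
    calc |∫ u in (0 : ℝ)..x, D n u| ≤ ∫ u in uIoc 0 x, |D n u| := by
          simpa only [Real.norm_eq_abs] using
            intervalIntegral.norm_integral_le_integral_norm_uIoc (f := D n) (a := 0) (b := x)
              (μ := volume)
      _ ≤ ∫ u, |D n u| := setIntegral_le_integral (hDi n).abs (Eventually.of_forall fun _ => abs_nonneg _)
      _ ≤ ∫ u, (ρ n (u - s) + ρ n (u - t)) := by
          refine integral_mono (hDi n).abs (((hρi n).comp_sub_right s).add
            ((hρi n).comp_sub_right t)) fun u => ?_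
          simp only [hD]
          refine (abs_sub _ _).trans ?_
          rw [abs_of_nonneg (hρ0 _ _), abs_of_nonneg (hρ0 _ _)]
      _ = 2 := by
          rw [integral_add ((hρi n).comp_sub_right s) ((hρi n).comp_sub_right t),
            integral_sub_right_eq_self (ρ n), integral_sub_right_eq_self (ρ n), hρ1]
          norm_num
  have hθlim (x) (hxs : x ≠ s) (hxt : x ≠ t) :
      Tendsto (fun n => θ n x) atTop (𝓝 ((Ioc s t).indicator (fun _ => 1) x)) := by
    refine tendsto_const_nhds.congr' ?_
    have hd1 : 0 < |x - s| := abs_pos.2 (sub_ne_zero.2 hxs)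
    have hd2 : 0 < |x - t| := abs_pos.2 (sub_ne_zero.2 hxt)
    filter_upwards [hsmall, hcout.eventually (gt_mem_nhds hd1), hcout.eventually (gt_mem_nhds hd2)]
      with n hn h1 h2
    have hn1 : (c n).rOut < s / 2 := hn.trans_le (min_le_left _ _)
    by_cases hx : x ∈ Ioc s t
    · rw [indicator_of_mem hx]
      have hxt' : x < t := lt_of_le_of_ne hx.2 hxt
      rw [abs_of_pos (by linarith [hx.1])] at h1
      rw [abs_of_neg (by linarith)] at h2
      have e1 : θ n x = ∫ u in (0 : ℝ)..x, ρ n (u - s) := by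
        refine intervalIntegral.integral_congr fun u hu => ?_
        rw [uIcc_of_le (by linarith [hx.1])] at hu
        simp only [hD]
        rw [hρz n (u - t) (by rw [abs_sub_comm, le_abs]; left; linarith [hu.2]), sub_zero]
      rw [e1, intervalIntegral.integral_eq_integral_of_support_subset,
        integral_sub_right_eq_self (ρ n), hρ1]
      intro u hu
      by_contra hne
      apply hu
      dsimp only
      rw [mem_Ioc, not_and_or, not_lt, not_le] at hne
      rcases hne with h0 | h0
      · exact hρz n _ (by rw [abs_sub_comm, le_abs]; left; linarith)
      · exact hρz n _ (by rw [le_abs]; left; linarith)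
    · rw [indicator_of_notMem hx]
      rw [mem_Ioc, not_and_or, not_lt, not_le] at hx
      rcases hx with h0 | h0
      · rw [abs_of_nonpos (by linarith)] at h1
        exact (hθz1 n hn1 x (by linarith)).symm
      · rw [abs_of_pos (by linarith)] at h2
        exact (hθz2 n hn1 x (by linarith)).symm
  have hR : Tendsto (fun n => ∫ x in Ioo 0 T, θ n x * k x) atTop (𝓝 (∫ r in s..t, k r)) := by
    have e : ∫ r in s..t, k r = ∫ x in Ioo 0 T, (Ioc s t).indicator (fun _ => 1) x * k x := by
      have : (fun x => (Ioc s t).indicator (fun _ => (1 : ℝ)) x * k x) = (Ioc s t).indicator k := by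
        ext x; by_cases hx : x ∈ Ioc s t <;> simp [hx]
      rw [this, setIntegral_indicator measurableSet_Ioc, intervalIntegral.integral_of_le hst,
        inter_eq_right.2 (show Ioc s t ⊆ Ioo 0 T from
          fun x hx => ⟨hs.trans hx.1, hx.2.trans_lt ht⟩)]
    rw [e]
    refine tendsto_integral_of_dominated_convergence (fun x => 2 * |k x|) (fun n => ?_)
      (hk.abs.const_mul 2) (fun n => ?_) ?_
    · exact (hθs n).continuous.aestronglyMeasurable.mul hk.1
    · refine Eventually.of_forall fun x => ?_
      rw [norm_mul, Real.norm_eq_abs, Real.norm_eq_abs]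
      gcongr
      exact hθb n x
    · have hne : ∀ᵐ x : ℝ, x ≠ s ∧ x ≠ t := by
        filter_upwards [Measure.ae_ne volume s, Measure.ae_ne volume t] with x h1 h2
        exact ⟨h1, h2⟩
      filter_upwards [ae_restrict_of_ae hne] with x hx
      exact (hθlim x hx.1 hx.2).mul_const _
  set F := (Ioo 0 T).indicator f with hF
  have hFm : AEStronglyMeasurable F volume :=
    (aestronglyMeasurable_indicator_iff measurableSet_Ioo).2
      (hf.aestronglyMeasurable measurableSet_Ioo)
  have hFlim (x) (hx : x ∈ Ioo 0 T) : Tendsto (fun n => ∫ u, ρ n (u - x) * F u) atTop (𝓝 (f x)) := by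
    have hc : ContinuousAt F x := by
      have h1 : ContinuousAt f x := hf.continuousAt (isOpen_Ioo.mem_nhds hx)
      refine h1.congr ?_
      filter_upwards [isOpen_Ioo.mem_nhds hx] with u hu
      rw [hF, indicator_of_mem hu]
    have := ContDiffBump.convolution_tendsto_right (μ := volume) (φ := c) (g := fun _ => F)
      (k := fun _ => x) (x₀ := x) (z₀ := F x) hcout (Eventually.of_forall fun _ => hFm)
      (hc.tendsto.comp tendsto_snd) tendsto_const_nhds
    rw [hF, indicator_of_mem hx, ← hF] at this
    refine this.congr fun n => ?_
    rw [convolution_eq_swap]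
    refine integral_congr_ae (Eventually.of_forall fun u => ?_)
    simp only [ContinuousLinearMap.lsmul_apply, smul_eq_mul, hρ]
    rw [← (c n).normed_neg (u - x), neg_sub]
  have hL : Tendsto (fun n => ∫ x in Ioo 0 T, deriv (θ n) x * f x) atTop (𝓝 (f s - f t)) := by
    have hsT : s ∈ Ioo 0 T := ⟨hs, hst.trans_lt ht⟩
    have htT : t ∈ Ioo 0 T := ⟨hs.trans_le hst, ht⟩
    refine ((hFlim s hsT).sub (hFlim t htT)).congr' ?_
    filter_upwards [hsmall] with n hn
    have hn1 : (c n).rOut < s / 2 := hn.trans_le (min_le_left _ _)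
    have hn2 : (c n).rOut < (T - t) / 2 := hn.trans_le (min_le_right _ _)
    have hint (x) (h1 : s ≤ x) (h2 : x ≤ t) : Integrable (fun u => ρ n (u - x) * F u) := by
      have hsub : Function.support (fun u => ρ n (u - x) * F u)
          ⊆ Icc (s / 2) (t + (T - t) / 2) := by
        intro u hu
        by_contra hne
        apply hu
        have : ρ n (u - x) = 0 := by
          apply hρz
          rw [mem_Icc, not_and_or, not_le, not_le] at hne
          rcases hne with h0 | h0
          · rw [abs_sub_comm, le_abs]; left; linarith
          · rw [le_abs]; left; linarith
        simp [this]
      rw [← integrableOn_iff_integrable_of_support_subset hsub]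
      refine ContinuousOn.integrableOn_compact isCompact_Icc (ContinuousOn.mul ?_ ?_)
      · exact ((hρs n).continuous.comp (continuous_id.sub continuous_const)).continuousOn
      · refine (hf.mono (t := Icc (s / 2) (t + (T - t) / 2)) fun u hu =>
          ⟨by linarith [hu.1], by linarith [hu.2]⟩).congr fun u hu => ?_
        rw [hF, indicator_of_mem (show u ∈ Ioo 0 T from ⟨by linarith [hu.1], by linarith [hu.2]⟩)]
    rw [← integral_sub (hint s le_rfl hst) (hint t hst le_rfl), hθderiv,
      ← integral_indicator measurableSet_Ioo]
    refine integral_congr_ae (Eventually.of_forall fun u => ?_)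
    by_cases hu : u ∈ Ioo 0 T
    · simp only [hF, hD, indicator_of_mem hu]; ring
    · simp only [hF, indicator_of_notMem hu]; ring
  have hLR := hL.congr' (htest.mono fun n hn => h (θ n) hn)
  have := tendsto_nhds_unique hLR hR
  linarith

/-! ### Elements of `V` -/

variable {d : ℕ} {Ω : Set (E d)}

theorem V.hasWeakGradient (w : V Ω) : HasWeakGradient Ω (toL2 w) (weakGrad w) := w.2

/-- The weak gradient as a continuous linear map. -/
noncomputable def weakGradL (Ω : Set (E d)) : V Ω →L[ℝ] Hvec Ω :=
  (WithLp.sndL 2 ℝ (H Ω) (Hvec Ω)).comp (sobolev Ω).subtypeL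

theorem norm_weakGrad_le (w : V Ω) : ‖weakGrad w‖ ≤ ‖w‖ := by
  have h : ‖(w.1 : WithLp 2 (H Ω × Hvec Ω))‖ ^ 2 = ‖toL2 w‖ ^ 2 + ‖weakGrad w‖ ^ 2 :=
    WithLp.prod_norm_sq_eq_of_L2 _
  have h' : ‖w‖ = ‖(w.1 : WithLp 2 (H Ω × Hvec Ω))‖ := rfl
  rw [← h'] at h
  exact (sq_le_sq₀ (norm_nonneg _) (norm_nonneg _)).1 (by nlinarith [sq_nonneg ‖toL2 w‖])

theorem exists_V_of_hasWeakGradient {u : E d → ℝ} {G : E d → E d}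
    (hu : MemLp u 2 (volume.restrict Ω)) (hG : MemLp G 2 (volume.restrict Ω))
    (h : HasWeakGradient Ω u G) : ∃ ξ : V Ω, toL2 ξ = hu.toLp u ∧ weakGrad ξ = hG.toLp G :=
  ⟨⟨WithLp.toLp 2 (hu.toLp u, hG.toLp G),
    h.congr_ae hu.coeFn_toLp.symm hG.coeFn_toLp.symm⟩, rfl, rfl⟩

end

/-! ### Convex functionals along weak solutions. -/

section

/-- The primitive of `g` that vanishes at `0`. -/
noncomputable def primitive (g : ℝ → ℝ) (s : ℝ) : ℝ := ∫ u in (0 : ℝ)..s, g u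

theorem primitive_zero (g : ℝ → ℝ) : primitive g 0 = 0 := by simp [primitive]

theorem hasDerivAt_primitive {g : ℝ → ℝ} (hg : Continuous g) (s : ℝ) :
    HasDerivAt (primitive g) (g s) s :=
  intervalIntegral.integral_hasDerivAt_right (hg.intervalIntegrable _ _)
    (hg.stronglyMeasurableAtFilter _ _) hg.continuousAt

theorem continuous_primitive {g : ℝ → ℝ} (hg : Continuous g) : Continuous (primitive g) :=
  continuous_iff_continuousAt.2 fun s => (hasDerivAt_primitive hg s).continuousAt

theorem primitive_sub {g : ℝ → ℝ} (hg : Continuous g) (a b : ℝ) :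
    primitive g a - primitive g b = ∫ u in b..a, g u :=
  intervalIntegral.integral_interval_sub_left (hg.intervalIntegrable _ _)
    (hg.intervalIntegrable _ _)

theorem monotone_primitive {g : ℝ → ℝ} (hg : Continuous g) (h0 : ∀ s, 0 ≤ g s) :
    Monotone (primitive g) := by
  intro b a hab
  rw [← sub_nonneg, primitive_sub hg]
  exact intervalIntegral.integral_nonneg hab fun u _ => h0 u

theorem abs_primitive_sub_le {g : ℝ → ℝ} (hg : Continuous g) {M a b : ℝ}
    (hM : ∀ u ∈ uIcc b a, |g u| ≤ M) : |primitive g a - primitive g b| ≤ M * |a - b| := by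
  rw [primitive_sub hg, ← Real.norm_eq_abs]
  refine intervalIntegral.norm_integral_le_of_norm_le_const fun u hu => ?_
  exact hM u (uIoc_subset_uIcc hu)

theorem abs_primitive_le {g : ℝ → ℝ} (hg : Continuous g) {M : ℝ} (hM : ∀ u, |g u| ≤ M) (a : ℝ) :
    |primitive g a| ≤ M * |a| := by
  have := abs_primitive_sub_le hg (a := a) (b := 0) fun u _ => hM u
  rwa [primitive_zero, sub_zero, sub_zero] at this

/-- The primitive is convex and lies above its tangent at a. In the energy estimate this one-sided
inequality takes the place of a chain rule in time. -/
theorem primitive_sub_le_of_monotone {g : ℝ → ℝ} (hg : Continuous g) (hm : Monotone g) (a b : ℝ) :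
    primitive g a - primitive g b ≤ g a * (a - b) := by
  rw [primitive_sub hg]
  rcases le_total b a with h | h
  · have := intervalIntegral.integral_mono_on h (hg.intervalIntegrable b a)
      (intervalIntegrable_const (μ := volume) (c := g a)) fun u hu => hm hu.2
    rw [intervalIntegral.integral_const, smul_eq_mul] at this
    linarith
  · rw [intervalIntegral.integral_symm]
    have := intervalIntegral.integral_mono_on h
      (intervalIntegrable_const (μ := volume) (c := g a))
      (hg.intervalIntegrable a b) fun u hu => hm hu.1
    rw [intervalIntegral.integral_const, smul_eq_mul] at this
    linarith

variable {d : ℕ} {Ω : Set (E d)}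

theorem integral_abs_mul_abs_le (u v : H Ω) : ∫ x in Ω, |u x| * |v x| ≤ ‖u‖ * ‖v‖ := by
  have h := real_inner_le_norm |u| |v|
  rw [L2.inner_def, norm_abs_eq_norm, norm_abs_eq_norm] at h
  refine le_trans (le_of_eq (integral_congr_ae ?_)) h
  filter_upwards [Lp.coeFn_abs u, Lp.coeFn_abs v] with x h1 h2
  rw [h1, h2]
  simp [mul_comm]

section

variable {ρ : ℝ → ℝ} {M : ℝ}

/-- The first primitive grows at most linearly. The resulting local Lipschitz bound makes the
functional ∫ Ψ(φ) continuous on L², which is the reason for using bounded weights. -/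
theorem abs_primitive_primitive_sub_le (hρ : Continuous ρ) (hM : ∀ s, |ρ s| ≤ M) (a b : ℝ) :
    |primitive (primitive ρ) a - primitive (primitive ρ) b| ≤ M * ((|a| + |b|) * |a - b|) := by
  have hM0 : 0 ≤ M := (abs_nonneg _).trans (hM 0)
  rw [← mul_assoc]
  refine abs_primitive_sub_le (continuous_primitive hρ) fun u hu => ?_
  refine (abs_primitive_le hρ hM u).trans ?_
  gcongr
  have h := (abs_le_max_abs_abs hu.1 hu.2).trans
    (max_le_add_of_nonneg (abs_nonneg _) (abs_nonneg _))
  rcases le_total a b with hab | hab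
  · rw [inf_eq_right.2 hab, sup_eq_left.2 hab] at h; linarith
  · rw [inf_eq_left.2 hab, sup_eq_right.2 hab] at h; linarith

theorem integrable_primitive_primitive (hρ : Continuous ρ) (hM : ∀ s, |ρ s| ≤ M) (u : H Ω) :
    Integrable (fun x => primitive (primitive ρ) (u x)) (volume.restrict Ω) := by
  refine ((Lp.memLp u).integrable_sq.const_mul M).mono'
    ((continuous_primitive (continuous_primitive hρ)).comp_aestronglyMeasurable (Lp.memLp u).1)
    (Eventually.of_forall fun x => ?_)
  have := abs_primitive_primitive_sub_le hρ hM (u x) 0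
  rw [primitive_zero] at this
  simpa [sq, abs_mul_abs_self] using this

theorem continuous_integral_primitive_primitive (hρ : Continuous ρ) (hM : ∀ s, |ρ s| ≤ M) :
    Continuous fun u : H Ω => ∫ x in Ω, primitive (primitive ρ) (u x) := by
  have key (u v : H Ω) : ‖(∫ x in Ω, primitive (primitive ρ) (u x))
      - ∫ x in Ω, primitive (primitive ρ) (v x)‖ ≤ M * ((‖u‖ + ‖v‖) * ‖u - v‖) := by
    have i1 : Integrable (fun x => |u x| * |(u - v : H Ω) x|) (volume.restrict Ω) :=
      (Lp.memLp u).abs.integrable_mul (Lp.memLp (u - v)).abs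
    have i2 : Integrable (fun x => |v x| * |(u - v : H Ω) x|) (volume.restrict Ω) :=
      (Lp.memLp v).abs.integrable_mul (Lp.memLp (u - v)).abs
    have hM0 : 0 ≤ M := (abs_nonneg _).trans (hM 0)
    rw [← integral_sub (integrable_primitive_primitive hρ hM u)
      (integrable_primitive_primitive hρ hM v)]
    calc _ ≤ ∫ x in Ω, M * (|u x| * |(u - v : H Ω) x| + |v x| * |(u - v : H Ω) x|) := by
          refine norm_integral_le_of_norm_le ((i1.add i2).const_mul M) ?_
          filter_upwards [Lp.coeFn_sub u v] with x hx
          rw [hx, Pi.sub_apply, ← add_mul]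
          exact abs_primitive_primitive_sub_le hρ hM _ _
      _ = M * ((∫ x in Ω, |u x| * |(u - v : H Ω) x|) + ∫ x in Ω, |v x| * |(u - v : H Ω) x|) := by
          rw [integral_const_mul, integral_add i1 i2]
      _ ≤ _ := by
          rw [add_mul]
          gcongr <;> exact integral_abs_mul_abs_le _ _
  rw [continuous_iff_continuousAt]
  intro v
  rw [ContinuousAt, tendsto_iff_norm_sub_tendsto_zero]
  refine squeeze_zero (fun _ => norm_nonneg _) (fun u => key u v) ?_
  have : Continuous fun u : H Ω => M * ((‖u‖ + ‖v‖) * ‖u - v‖) := by fun_prop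
  simpa using this.tendsto v

end

/-- Chain rule in `V`. -/
theorem exists_V_comp (hΩ : IsOpen Ω) (hvol : volume Ω ≠ ⊤) (w : V Ω) {g : ℝ → ℝ} {M : ℝ}
    (hg : Continuous g) (hM : ∀ s, |g s| ≤ M) :
    ∃ ξ : V Ω, toL2 ξ =ᵐ[volume.restrict Ω] (fun x => primitive g (toL2 w x)) ∧
      weakGrad ξ =ᵐ[volume.restrict Ω] fun x => g (toL2 w x) • weakGrad w x := by
  have : IsFiniteMeasure (volume.restrict Ω) := ⟨by simpa using hvol.lt_top⟩
  have hu := Lp.memLp (toL2 w)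
  have hG := Lp.memLp (weakGrad w)
  have h1 : MemLp (fun x => primitive g (toL2 w x)) 2 (volume.restrict Ω) :=
    hu.of_le_mul ((continuous_primitive hg).comp_aestronglyMeasurable hu.1)
      (Eventually.of_forall fun x => abs_primitive_le hg hM _)
  have h2 : MemLp (fun x => g (toL2 w x) • weakGrad w x) 2 (volume.restrict Ω) := by
    refine hG.of_le_mul (c := M) ((hg.comp_aestronglyMeasurable hu.1).smul hG.1)
      (Eventually.of_forall fun x => ?_)
    rw [norm_smul]
    gcongr
    exact hM _
  obtain ⟨ξ, hξ1, hξ2⟩ := exists_V_of_hasWeakGradient h1 h2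
    (HasWeakGradient.comp hΩ (hu.integrable one_le_two) (hG.integrable one_le_two)
      w.hasWeakGradient (hasDerivAt_primitive hg) hg hM)
  exact ⟨ξ, hξ1 ▸ h1.coeFn_toLp, hξ2 ▸ h2.coeFn_toLp⟩

/-- For a fixed ξ the exceptional null set of times in the equation is harmless, and (φ(t), ξ) is a
continuous scalar function with an integrable weak derivative. -/
theorem inner_sub_eq_neg_integral {T : ℝ} {φ : ℝ → H Ω} {φ' : ℝ → V' Ω} {μ : ℝ → V Ω}
    (hφ : ContinuousOn φ (Icc 0 T)) (hμ : MemLp μ 2 (volume.restrict (Ioo 0 T)))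
    (hd : HasWeakTimeDeriv T φ φ')
    (he : ∀ ψ : V Ω, ∀ᵐ t ∂volume.restrict (Ioo 0 T),
      duality (φ' t) ψ + inner ℝ (weakGrad (μ t)) (weakGrad ψ) = 0)
    (ξ : V Ω) {s t : ℝ} (hs : 0 < s) (hst : s ≤ t) (ht : t < T) :
    inner ℝ (φ t) (toL2 ξ) - inner ℝ (φ s) (toL2 ξ)
      = -∫ r in s..t, inner ℝ (weakGrad (μ r)) (weakGrad ξ) := by
  have hi : IntegrableOn (fun r => inner ℝ (weakGrad (μ r)) (weakGrad ξ)) (Ioo 0 T) := by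
    have : MemLp (fun r => weakGradL Ω (μ r)) 2 (volume.restrict (Ioo 0 T)) :=
      (weakGradL Ω).comp_memLp' hμ
    exact (this.integrable one_le_two).inner_const _
  refine sub_eq_neg_integral_of_weakDeriv
    (f := fun r => inner ℝ (φ r) (toL2 ξ)) ?_ hi (fun θ hθ => ?_) hs hst ht
  · exact (hφ.mono Ioo_subset_Icc_self).inner continuousOn_const
  · rw [hd θ hθ ξ, ← integral_neg]
    refine integral_congr_ae ?_
    filter_upwards [he ξ] with r hr
    rw [eq_neg_of_add_eq_zero_left hr]
    ring

/-- Integrated energy inequality for the functional `∫ Ψ(φ)`, where `Ψ'' = ρ²`. -/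
theorem integral_primitive_sub_le (hΩ : IsOpen Ω) (hvol : volume Ω ≠ ⊤) {T : ℝ} {φ : ℝ → H Ω}
    {φ' : ℝ → V' Ω} {μ w : ℝ → V Ω} (hφ : ContinuousOn φ (Icc 0 T))
    (hw : MemLp w 2 (volume.restrict (Ioo 0 T)))
    (hwφ : ∀ᵐ t ∂volume.restrict (Ioo 0 T), toL2 (w t) = φ t)
    (hμ : MemLp μ 2 (volume.restrict (Ioo 0 T))) (hd : HasWeakTimeDeriv T φ φ')
    (he : ∀ ψ : V Ω, ∀ᵐ t ∂volume.restrict (Ioo 0 T),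
      duality (φ' t) ψ + inner ℝ (weakGrad (μ t)) (weakGrad ψ) = 0)
    {g : ℝ → ℝ} {M : ℝ} (hg : Continuous g) (hg0 : ∀ s, 0 ≤ g s) (hM : ∀ s, |g s| ≤ M)
    {B : ℝ → ℝ} {r s : ℝ} (hr : 0 < r) (hrs : r ≤ s) (hs : s < T) (hB : ContinuousOn B (Icc r s))
    (h : ∀ᵐ t ∂volume.restrict (Ioo r s),
      -∫ x in Ω, inner ℝ (weakGrad (μ t) x) (g (φ t x) • weakGrad (w t) x) ≤ B t) :
    (∫ x in Ω, primitive (primitive g) (φ s x)) - ∫ x in Ω, primitive (primitive g) (φ r x)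
      ≤ ∫ t in r..s, B t := by
  have hsub : Ioo r s ⊆ Ioo 0 T := Ioo_subset_Ioo hr.le hs.le
  set G := (Ioo 0 T).indicator fun t => weakGrad (μ t) with hGdef
  have hGm : MemLp G 2 := by
    rw [hGdef, memLp_indicator_iff_restrict measurableSet_Ioo]
    exact (weakGradL Ω).comp_memLp' hμ
  have hM0 : 0 ≤ M := (abs_nonneg _).trans (hM 0)
  have hNm : MemLp (fun t => M * ‖w t‖) 2 (volume.restrict (Ioo r s)) :=
    ((hw.mono_measure (Measure.restrict_mono hsub le_rfl)).norm).const_mul M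
  refine sub_le_integral_of_increment_le (a := r / 2) hGm (by linarith) hrs hNm
    (y := fun t => ∫ x in Ω, primitive (primitive g) (φ t x)) ?_ hB ?_
  · exact (continuous_integral_primitive_primitive hg hM).comp_continuousOn
      (hφ.mono (Icc_subset_Icc (by linarith) hs.le))
  filter_upwards [h, ae_restrict_of_ae_restrict_of_subset hsub hwφ,
    ae_restrict_mem measurableSet_Ioo] with t hBt hwt ht k hk
  -- The test function is Ψ'(φ(t)), frozen at the right end t of the increment: a fixed element of
  -- V, with the sign that convexity needs.
  obtain ⟨ξ, hξ1, hξ2⟩ := exists_V_comp hΩ hvol (w t) hg hM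
  rw [hwt] at hξ1 hξ2
  have htT : t ∈ Ioo 0 T := hsub ht
  have hk0 : 0 < k := hk.1
  have hkt : 0 < t - k := by linarith [hk.2, ht.1]
  have hNξ : ‖weakGrad ξ‖ ≤ M * ‖w t‖ := by
    refine le_trans ?_ (mul_le_mul_of_nonneg_left (norm_weakGrad_le (w t)) hM0)
    refine Lp.norm_le_mul_norm_of_ae_le_mul ?_
    filter_upwards [hξ2] with x hx
    rw [hx, norm_smul]
    gcongr
    exact hM _
  have hinner : inner ℝ (weakGrad (μ t)) (weakGrad ξ)
      = ∫ x in Ω, inner ℝ (weakGrad (μ t) x) (g (φ t x) • weakGrad (w t) x) := by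
    rw [L2.inner_def]
    refine integral_congr_ae ?_
    filter_upwards [hξ2] with x hx
    rw [hx]
  rw [← hinner] at hBt
  have hconv : (∫ x in Ω, primitive (primitive g) (φ t x))
      - ∫ x in Ω, primitive (primitive g) (φ (t - k) x)
      ≤ inner ℝ (φ t) (toL2 ξ) - inner ℝ (φ (t - k)) (toL2 ξ) := by
    rw [← inner_sub_left, L2.inner_def, ← integral_sub (integrable_primitive_primitive hg hM _)
      (integrable_primitive_primitive hg hM _)]
    refine integral_mono_ae ((integrable_primitive_primitive hg hM _).sub
      (integrable_primitive_primitive hg hM _)) (L2.integrable_inner _ _) ?_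
    filter_upwards [hξ1, Lp.coeFn_sub (φ t) (φ (t - k))] with x h1 h2
    rw [h1, h2, Pi.sub_apply]
    refine (primitive_sub_le_of_monotone (continuous_primitive hg) (monotone_primitive hg hg0)
      (φ t x) (φ (t - k) x)).trans (le_of_eq ?_)
    simp
  rw [inner_sub_eq_neg_integral hφ hμ hd he ξ hkt (by linarith) htT.2] at hconv
  have hGi : IntervalIntegrable (fun u => inner ℝ (weakGrad (μ u)) (weakGrad ξ)) volume (t - k) t := by
    rw [intervalIntegrable_iff_integrableOn_Ioc_of_le (by linarith)]
    have h1 : MemLp (fun r => weakGradL Ω (μ r)) 2 (volume.restrict (Ioo 0 T)) :=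
      (weakGradL Ω).comp_memLp' hμ
    have h2 : IntegrableOn (fun r => inner ℝ (weakGrad (μ r)) (weakGrad ξ)) (Ioo 0 T) :=
      (h1.integrable one_le_two).inner_const _
    exact h2.mono_set fun u hu => ⟨hkt.trans hu.1, hu.2.trans_lt htT.2⟩
  -- ∇μ is frozen at time t as well, where `hBt` bounds the dissipation. The error ∇μ(u) - ∇μ(t) is
  -- the translate difference of an L² function that `sub_le_integral_of_increment_le` removes.
  have e1 : ∫ u in (t - k)..t, inner ℝ (weakGrad (μ u)) (weakGrad ξ)
      = (∫ u in (t - k)..t, inner ℝ (G u - G t) (weakGrad ξ))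
        + k * inner ℝ (weakGrad (μ t)) (weakGrad ξ) := by
    have e2 : ∫ u in (t - k)..t, inner ℝ (G u - G t) (weakGrad ξ)
        = ∫ u in (t - k)..t, (inner ℝ (weakGrad (μ u)) (weakGrad ξ)
          - inner ℝ (weakGrad (μ t)) (weakGrad ξ)) := by
      refine intervalIntegral.integral_congr fun u hu => ?_
      rw [uIcc_of_le (by linarith)] at hu
      simp only [hGdef]
      rw [indicator_of_mem htT, indicator_of_mem
        (show u ∈ Ioo 0 T from ⟨hkt.trans_le hu.1, hu.2.trans_lt htT.2⟩), inner_sub_left]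
    rw [e2, intervalIntegral.integral_sub hGi (by simp), intervalIntegral.integral_const]
    simp
  rw [e1] at hconv
  have h3 : (∫ x in Ω, primitive (primitive g) (φ t x))
      - (∫ x in Ω, primitive (primitive g) (φ (t - k) x)) - k * B t
      ≤ ‖∫ u in (t - k)..t, inner ℝ (G u - G t) (weakGrad ξ)‖ := by
    have := neg_le_abs (∫ u in (t - k)..t, inner ℝ (G u - G t) (weakGrad ξ))
    rw [Real.norm_eq_abs]
    nlinarith
  calc _ ≤ ENNReal.ofReal ‖∫ u in (t - k)..t, inner ℝ (G u - G t) (weakGrad ξ)‖ :=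
        ENNReal.ofReal_le_ofReal h3
    _ ≤ ∫⁻ u in Ioc (t - k) t, ‖inner ℝ (G u - G t) (weakGrad ξ)‖ₑ := by
        rw [ofReal_norm, intervalIntegral.integral_of_le (by linarith)]
        exact enorm_integral_le_lintegral_enorm _
    _ ≤ ∫⁻ u in Ioc (t - k) t, ‖M * ‖w t‖‖ₑ * ‖G u - G t‖ₑ := by
        refine lintegral_mono fun u => ?_
        rw [← enorm_norm (G u - G t), ← enorm_mul]
        refine enorm_le_iff_norm_le.2 ?_
        rw [norm_mul, norm_norm, Real.norm_of_nonneg (mul_nonneg hM0 (norm_nonneg _))]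
        refine (norm_inner_le_norm (𝕜 := ℝ) _ _).trans ?_
        rw [mul_comm]
        gcongr
    _ = ‖M * ‖w t‖‖ₑ * ∫⁻ u in Ioc (t - k) t, ‖G u - G t‖ₑ :=
        lintegral_const_mul' _ _ enorm_ne_top
    _ = _ := by
        congr 1
        rw [← lintegral_indicator measurableSet_Ioc, ← lintegral_indicator measurableSet_Ico,
          ← lintegral_sub_left_eq_self _ t]
        refine lintegral_congr fun x => ?_
        by_cases hx : x ∈ Ico 0 k
        · rw [indicator_of_mem hx, indicator_of_mem
            (show t - x ∈ Ioc (t - k) t from ⟨by linarith [hx.2], by linarith [hx.1]⟩)]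
        · rw [indicator_of_notMem hx, indicator_of_notMem]
          exact fun h' => hx ⟨by linarith [h'.2], by linarith [h'.1]⟩

/-- The differential inequality for `∫ Ψ(φ)`, `Ψ'' = ρ²`, along a weak solution. The function `χ`
measures the dissipation and may depend on time. -/
theorem IsWeakSolutionOn.integral_primitive_sub_le (hΩ : IsOpen Ω) (hvol : volume Ω ≠ ⊤)
    {J : E d → ℝ} {F : ℝ → ℝ} {q T c₀ : ℝ} {K : E d → E d} (hJ : Integrable J) (hK : Integrable K)
    (hJK : HasWeakGradient univ J K) (hF : ConvexityAssumption Ω J F) (hc₀ : 0 < c₀) {φ : ℝ → H Ω}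
    (hφ : IsWeakSolutionOn Ω J F q T φ) {ρ : ℝ → ℝ} {M : ℝ} (hρ : Continuous ρ)
    (hM : ∀ s, |ρ s| ≤ M)
    (hmono : ∀ a b, ρ a ^ 2 * b ^ 2 ≤ ρ a ^ 2 * a ^ 2 + ρ b ^ 2 * b ^ 2)
    {B : ℝ → ℝ} {r s : ℝ} (hr : 0 < r) (hrs : r ≤ s) (hs : s < T) (hB : ContinuousOn B (Icc r s))
    (h : ∀ t ∈ Ioo r s, ∃ (χ : ℝ → ℝ) (N : ℝ), Continuous χ ∧ (∀ s, |χ s| ≤ N) ∧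
      (∀ s, χ s ^ 2 ≤ ρ s ^ 2 * (deriv (deriv F) s + sInf (aCoef Ω J '' Ω) - c₀ / 2)) ∧
      ∀ G : E d → E d, MemLp G 2 (volume.restrict Ω) → HasWeakGradient Ω (φ t) G →
        -(∫ x in Ω, χ (φ t x) ^ 2 * ‖G x‖ ^ 2)
          + (3 * (∫ y, ‖K y‖) ^ 2 / c₀) * ∫ x in Ω, ρ (φ t x) ^ 2 * φ t x ^ 2 ≤ B t) :
    (∫ x in Ω, primitive (primitive fun s => ρ s ^ 2) (φ s x))
      - ∫ x in Ω, primitive (primitive fun s => ρ s ^ 2) (φ r x) ≤ ∫ t in r..s, B t := by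
  obtain ⟨w, hw, hwφ⟩ := hφ.memL2V
  obtain ⟨φ', μ, -, hμ, hd, hμφ, he⟩ := hφ.equation
  have hsub : Ioo r s ⊆ Ioo 0 T := Ioo_subset_Ioo hr.le hs.le
  refine NonlocalCH.integral_primitive_sub_le hΩ hvol hφ.continuousOn hw hwφ hμ hd he (hρ.pow 2)
    (fun s => sq_nonneg _) (M := M ^ 2) (fun s => ?_) hr hrs hs hB ?_
  · rw [Pi.pow_apply, abs_pow]
    exact pow_le_pow_left₀ (abs_nonneg _) (hM s) 2
  filter_upwards [ae_restrict_of_ae_restrict_of_subset hsub hwφ,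
    ae_restrict_of_ae_restrict_of_subset hsub hμφ, ae_restrict_mem measurableSet_Ioo]
    with t hwt hμt ht
  obtain ⟨χ, N, hχ, hN, hχρ, hbound⟩ := h t ht
  have hwg : HasWeakGradient Ω (φ t) (weakGrad (w t)) := hwt ▸ (w t).hasWeakGradient
  exact (dissipation_le hΩ hvol hJ hK hJK hF hc₀ (Lp.memLp (φ t)) (Lp.memLp (toL2 (μ t)))
    (Lp.memLp (weakGrad (w t))) (Lp.memLp (weakGrad (μ t))) hwg (μ t).hasWeakGradient hμt hρ hχ hM hN
    hmono hχρ).trans (hbound _ (Lp.memLp _) hwg)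

/-- Conservation of mass. -/
theorem IsWeakSolutionOn.integral_eq (hvol : volume Ω ≠ ⊤) {J : E d → ℝ} {F : ℝ → ℝ} {q T : ℝ}
    {φ : ℝ → H Ω} (hφ : IsWeakSolutionOn Ω J F q T φ) {t : ℝ} (ht0 : 0 ≤ t) (ht : t < T) :
    ∫ x in Ω, φ t x = ∫ x in Ω, φ 0 x := by
  have : IsFiniteMeasure (volume.restrict Ω) := ⟨by simpa using hvol.lt_top⟩
  obtain ⟨φ', μ, -, hμ, hd, -, he⟩ := hφ.equation
  have h1 : MemLp (fun _ : E d => (1 : ℝ)) 2 (volume.restrict Ω) := memLp_const 1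
  have h0 : MemLp (fun _ : E d => (0 : E d)) 2 (volume.restrict Ω) := MemLp.zero
  obtain ⟨ξ, hξ1, hξ2⟩ := exists_V_of_hasWeakGradient h1 h0 (by
    intro η hη v
    have := setIntegral_mul_fderiv_testFunction hη (f := fun _ => (1 : ℝ)) contDiff_const v
    simpa using this)
  have hg0 : weakGrad ξ = 0 := by rw [hξ2]; exact MemLp.toLp_zero h0
  have hin (u : H Ω) : inner ℝ u (toL2 ξ) = ∫ x in Ω, u x := by
    rw [L2.inner_def]
    refine integral_congr_ae ?_
    have : toL2 ξ =ᵐ[volume.restrict Ω] fun _ => 1 := hξ1 ▸ h1.coeFn_toLp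
    filter_upwards [this] with x hx
    rw [hx]; simp
  rcases ht0.eq_or_lt with rfl | ht0
  · rfl
  have hc : ContinuousOn (fun s => inner ℝ (φ s) (toL2 ξ)) (Icc 0 T) :=
    hφ.continuousOn.inner continuousOn_const
  -- The integrated equation is available for positive times only; time 0 is reached by continuity
  -- in L².
  have hlim : Tendsto (fun s => inner ℝ (φ s) (toL2 ξ)) (𝓝[>] 0) (𝓝 (inner ℝ (φ 0) (toL2 ξ))) :=
    (hc 0 ⟨le_rfl, (ht0.trans ht).le⟩).mono_left
      (nhdsWithin_le_iff.2 (Icc_mem_nhdsGT (ht0.trans ht)))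
  rw [← hin, ← hin]
  refine tendsto_nhds_unique_of_eventuallyEq tendsto_const_nhds hlim ?_
  filter_upwards [Ioo_mem_nhdsGT ht0] with s hs
  have := inner_sub_eq_neg_integral hφ.continuousOn hμ hd he ξ hs.1 hs.2.le ht
  rw [hg0] at this
  simp only [inner_zero_right, intervalIntegral.integral_zero, neg_zero] at this
  linarith

end

/-! ### Truncated powers and their primitives. -/

section

theorem primitive_neg_of_even {g : ℝ → ℝ} (h : ∀ s, g (-s) = g s) (s : ℝ) :
    primitive g (-s) = -primitive g s := by
  have := intervalIntegral.integral_comp_neg (f := g) (a := 0) (b := s)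
  simp only [h, neg_zero] at this
  rw [primitive, primitive, this, intervalIntegral.integral_symm]

theorem primitive_neg_of_odd {g : ℝ → ℝ} (h : ∀ s, g (-s) = -g s) (s : ℝ) :
    primitive g (-s) = primitive g s := by
  have := intervalIntegral.integral_comp_neg (f := g) (a := 0) (b := s)
  simp only [h, neg_zero, intervalIntegral.integral_neg] at this
  rw [primitive, primitive, intervalIntegral.integral_symm, ← this, neg_neg]

theorem primitive_mono {f g : ℝ → ℝ} (hf : Continuous f) (hg : Continuous g) {s : ℝ} (hs : 0 ≤ s)
    (h : ∀ u, 0 ≤ u → u ≤ s → f u ≤ g u) : primitive f s ≤ primitive g s :=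
  intervalIntegral.integral_mono_on hs (hf.intervalIntegrable _ _) (hg.intervalIntegrable _ _)
    fun u hu => h u hu.1 hu.2

theorem primitive_const_mul (c : ℝ) (g : ℝ → ℝ) (s : ℝ) :
    primitive (fun u => c * g u) s = c * primitive g s :=
  intervalIntegral.integral_const_mul _ _

theorem primitive_nonneg {g : ℝ → ℝ} (h : ∀ u, 0 ≤ g u) {s : ℝ} (hs : 0 ≤ s) :
    0 ≤ primitive g s :=
  intervalIntegral.integral_nonneg hs fun u _ => h u

/-- The truncated power `min(|s|, k) ^ j`. -/
noncomputable def truncPow (k : ℝ) (j : ℕ) (s : ℝ) : ℝ := min |s| k ^ j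

section

variable {k : ℝ} (j : ℕ)

theorem continuous_truncPow : Continuous (truncPow k j) :=
  (continuous_abs.min continuous_const).pow j

theorem truncPow_neg (s : ℝ) : truncPow k j (-s) = truncPow k j s := by simp [truncPow]

theorem truncPow_nonneg (hk : 0 ≤ k) (s : ℝ) : 0 ≤ truncPow k j s :=
  pow_nonneg (le_min (abs_nonneg _) hk) _

theorem truncPow_le_pow (hk : 0 ≤ k) (s : ℝ) : truncPow k j s ≤ k ^ j :=
  pow_le_pow_left₀ (le_min (abs_nonneg _) hk) (min_le_right _ _) _

theorem abs_truncPow_le (hk : 0 ≤ k) (s : ℝ) : |truncPow k j s| ≤ k ^ j := by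
  rw [abs_of_nonneg (truncPow_nonneg j hk s)]
  exact truncPow_le_pow j hk s

theorem truncPow_sq (s : ℝ) : truncPow k j s ^ 2 = truncPow k (2 * j) s := by
  rw [truncPow, truncPow, ← pow_mul, mul_comm]

theorem truncPow_mono (hk : 0 ≤ k) {a b : ℝ} (h : |a| ≤ |b|) : truncPow k j a ≤ truncPow k j b :=
  pow_le_pow_left₀ (le_min (abs_nonneg _) hk) (min_le_min_right _ h) _

/-- The monotonicity condition on weights required by the nonlocal term: the weight is nondecreasing
in |s|, so the larger of |a| and |b| can take both factors. -/
theorem truncPow_sq_mul_sq_le (hk : 0 ≤ k) (a b : ℝ) :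
    truncPow k j a ^ 2 * b ^ 2
      ≤ truncPow k j a ^ 2 * a ^ 2 + truncPow k j b ^ 2 * b ^ 2 := by
  rcases le_total |a| |b| with h | h
  · have h1 := pow_le_pow_left₀ (truncPow_nonneg j hk a) (truncPow_mono j hk h) 2
    nlinarith [mul_nonneg (sq_nonneg (truncPow k j a)) (sq_nonneg a),
      mul_le_mul_of_nonneg_right h1 (sq_nonneg b)]
  · have h1 : b ^ 2 ≤ a ^ 2 := sq_le_sq.2 h
    nlinarith [mul_nonneg (sq_nonneg (truncPow k j b)) (sq_nonneg b),
      mul_le_mul_of_nonneg_left h1 (sq_nonneg (truncPow k j a))]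

/-- By concavity min(u, k) ≥ (u/s) min(s, k) on [0, s], so the truncated power lies above a pure
power with the same value at s, whose integral is explicit. -/
theorem truncPow_mul_le (hk : 0 ≤ k) {s : ℝ} (hs : 0 ≤ s) :
    truncPow k j s * s ≤ (j + 1) * primitive (truncPow k j) s := by
  rcases hs.eq_or_lt with rfl | hs
  · simp [primitive_zero]
  have h : primitive (fun u => truncPow k j s / s ^ j * u ^ j) s ≤ primitive (truncPow k j) s := by
    refine primitive_mono (by fun_prop) (continuous_truncPow j) hs.le fun u hu hus => ?_
    rw [truncPow, truncPow, abs_of_nonneg hu, abs_of_pos hs, ← div_pow, ← mul_pow]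
    refine pow_le_pow_left₀ (by positivity) (le_min ?_ ?_) _
    · rw [div_mul_eq_mul_div, div_le_iff₀ hs, mul_comm]
      exact mul_le_mul_of_nonneg_left (min_le_left _ _) hu
    · rw [div_mul_eq_mul_div, div_le_iff₀ hs]
      exact mul_le_mul (min_le_right _ _) hus hu hk
  rw [primitive_const_mul, primitive, integral_pow] at h
  have e : truncPow k j s / s ^ j * ((s ^ (j + 1) - 0 ^ (j + 1)) / (j + 1))
      = truncPow k j s * s / (j + 1) := by
    rw [zero_pow (by omega), pow_succ]
    field_simp
    ring
  rw [e, div_le_iff₀ (by positivity)] at h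
  linarith

theorem truncPow_succ_le (hk : 0 ≤ k) {s : ℝ} (hs : 0 ≤ s) :
    truncPow k (j + 1) s ≤ (j + 1) * primitive (truncPow k j) s := by
  refine le_trans ?_ (truncPow_mul_le j hk hs)
  rw [truncPow, truncPow, pow_succ, abs_of_nonneg hs]
  exact mul_le_mul_of_nonneg_left (min_le_left _ _) (pow_nonneg (le_min hs hk) _)

theorem abs_primitive_truncPow (hk : 0 ≤ k) (s : ℝ) :
    |primitive (truncPow k j) s| = primitive (truncPow k j) |s| := by
  rcases le_total 0 s with h | h
  · rw [abs_of_nonneg h, abs_of_nonneg (primitive_nonneg (truncPow_nonneg j hk) h)]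
  · rw [abs_of_nonpos h, primitive_neg_of_even (truncPow_neg j)]
    refine abs_of_nonpos ?_
    rw [← neg_nonneg, ← primitive_neg_of_even (truncPow_neg j)]
    exact primitive_nonneg (truncPow_nonneg j hk) (neg_nonneg.2 h)

theorem primitive_primitive_truncPow_abs (s : ℝ) :
    primitive (primitive (truncPow k j)) |s| = primitive (primitive (truncPow k j)) s := by
  rcases abs_choice s with h | h <;> rw [h]
  exact primitive_neg_of_odd (primitive_neg_of_even (truncPow_neg j)) s

theorem primitive_primitive_truncPow_nonneg (hk : 0 ≤ k) (s : ℝ) :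
    0 ≤ primitive (primitive (truncPow k j)) s := by
  rw [← primitive_primitive_truncPow_abs]
  have := primitive_mono continuous_const (continuous_primitive (continuous_truncPow (k := k) j))
    (abs_nonneg s) (f := fun _ => 0) fun u hu _ => primitive_nonneg (truncPow_nonneg j hk) hu
  simpa [primitive] using this

theorem truncPow_sq_mul_sq_le_primitive (hk : 0 ≤ k) (s : ℝ) :
    truncPow k j s ^ 2 * s ^ 2 ≤ (j + 1) ^ 2 * primitive (truncPow k j) s ^ 2 := by
  have h := truncPow_mul_le j hk (abs_nonneg s)
  rw [← abs_primitive_truncPow j hk] at h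
  have e : truncPow k j |s| = truncPow k j s := by simp [truncPow]
  rw [e] at h
  have := pow_le_pow_left₀ (mul_nonneg (truncPow_nonneg j hk s) (abs_nonneg s)) h 2
  rwa [mul_pow, mul_pow, sq_abs, sq_abs] at this

/-- For s ≥ 0 monotonicity of ρ gives ∫₀ᵘ ρ² ≤ ρ(u) ∫₀ᵘ ρ, and the right side is the derivative of
half the square of the primitive; evenness covers s < 0. The functional of the Moser step is thereby
controlled by the L² norm to which the Nash inequality applies. -/
theorem two_mul_primitive_primitive_le (hk : 0 ≤ k) (s : ℝ) :
    2 * primitive (primitive (truncPow k (2 * j))) s ≤ primitive (truncPow k j) s ^ 2 := by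
  have hc := continuous_truncPow (k := k) j
  have hd (u : ℝ) : HasDerivAt (fun u => primitive (truncPow k j) u ^ 2 / 2)
      (primitive (truncPow k j) u * truncPow k j u) u := by
    refine (((hasDerivAt_primitive hc u).pow 2).div_const 2).congr_deriv ?_
    simp
    ring
  have key (s : ℝ) (hs : 0 ≤ s) :
      2 * primitive (primitive (truncPow k (2 * j))) s ≤ primitive (truncPow k j) s ^ 2 := by
    have e : primitive (fun u => primitive (truncPow k j) u * truncPow k j u) s
        = primitive (truncPow k j) s ^ 2 / 2 := by
      rw [primitive, intervalIntegral.integral_eq_sub_of_hasDerivAt (fun u _ => hd u)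
        (((continuous_primitive hc).mul hc).intervalIntegrable _ _)]
      simp [primitive_zero]
    have h := primitive_mono (continuous_primitive (continuous_truncPow (2 * j)))
      (g := fun u => primitive (truncPow k j) u * truncPow k j u)
      ((continuous_primitive hc).mul hc) hs (f := primitive (truncPow k (2 * j)))
      fun u hu _ => by
        rw [mul_comm (primitive _ _), ← primitive_const_mul]
        refine primitive_mono (continuous_truncPow _) (continuous_const.mul hc) hu fun v hv hvu => ?_
        rw [← truncPow_sq, sq]
        refine mul_le_mul_of_nonneg_right (truncPow_mono j hk ?_) (truncPow_nonneg j hk v)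
        rwa [abs_of_nonneg hv, abs_of_nonneg hu]
    rw [e] at h
    linarith
  rw [← primitive_primitive_truncPow_abs, ← sq_abs (primitive (truncPow k j) s),
    abs_primitive_truncPow j hk]
  exact key _ (abs_nonneg s)

/-- The link between consecutive Moser steps: the L¹ norm in the Nash inequality is bounded by the
functional of the previous step. -/
theorem abs_primitive_truncPow_succ_le (hk : 0 ≤ k) (s : ℝ) :
    |primitive (truncPow k (j + 1)) s| ≤ (j + 1) * primitive (primitive (truncPow k j)) s := by
  rw [abs_primitive_truncPow _ hk, ← primitive_primitive_truncPow_abs, ← primitive_const_mul]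
  exact primitive_mono (continuous_truncPow _)
    (continuous_const.mul (continuous_primitive (continuous_truncPow j))) (abs_nonneg s)
    fun u hu _ => truncPow_succ_le j hk hu

/-- Where |s| ≥ k the truncation is saturated. This is the lower bound for Chebyshev's inequality at
the end of the iteration. -/
theorem pow_le_primitive_primitive_truncPow (hk : 0 ≤ k) {s : ℝ} (hs : k ≤ |s|) :
    k ^ (j + 2) ≤ (j + 2) ^ 2 * primitive (primitive (truncPow k j)) s := by
  have h1 := abs_primitive_truncPow_succ_le j hk s
  have h2 := truncPow_succ_le (j + 1) hk (abs_nonneg s)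
  rw [← abs_primitive_truncPow _ hk] at h2
  have h3 : truncPow k (j + 1 + 1) |s| = k ^ (j + 2) := by
    rw [truncPow, abs_abs, min_eq_right hs]
  rw [h3] at h2
  push_cast at h2
  have h0 := primitive_primitive_truncPow_nonneg j hk s
  have hj : (0 : ℝ) ≤ j := j.cast_nonneg
  calc k ^ (j + 2) ≤ (j + 1 + 1) * |primitive (truncPow k (j + 1)) s| := h2
    _ ≤ (j + 1 + 1) * ((j + 1) * primitive (primitive (truncPow k j)) s) := by gcongr
    _ ≤ _ := by nlinarith [mul_nonneg hj h0]

end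

end

/-! ### Nash and Poincaré inequalities in the form used for solutions. -/

section

theorem lintegral_enorm_sq_eq {α X : Type*} [MeasurableSpace α] {ν : Measure α}
    [NormedAddCommGroup X] {u : α → X} (hu : MemLp u 2 ν) :
    ∫⁻ x, ‖u x‖ₑ ^ 2 ∂ν = ENNReal.ofReal (∫ x, ‖u x‖ ^ 2 ∂ν) := by
  rw [ofReal_integral_eq_lintegral_ofReal hu.norm.integrable_sq
    (Eventually.of_forall fun x => sq_nonneg _)]
  refine lintegral_congr fun x => ?_
  rw [ENNReal.ofReal_pow (norm_nonneg _), ofReal_norm]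

variable {d : ℕ} {Ω : Set (E d)}

/-- A Nash type inequality on a bounded Lipschitz domain. -/
theorem IsBoundedLipschitzDomain.exists_integral_sq_le (hd : 0 < d)
    (hΩ : IsBoundedLipschitzDomain Ω) :
    ∃ C > 0, ∀ s : ℝ, 0 < s → s ≤ 1 → ∀ (u : E d → ℝ) (G : E d → E d),
      MemLp u 2 (volume.restrict Ω) → MemLp G 2 (volume.restrict Ω) → HasWeakGradient Ω u G →
      ∫ x in Ω, u x ^ 2 ≤ C * s ^ 2 * (∫ x in Ω, ‖G x‖ ^ 2)
        + C * (s ^ d)⁻¹ ^ 2 * (∫ x in Ω, |u x|) ^ 2 := by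
  have : IsFiniteMeasure (volume.restrict Ω) := ⟨by simpa using hΩ.isBounded.measure_lt_top⟩
  obtain ⟨C, hC, h⟩ := hΩ.exists_lintegral_sq_le hd
  refine ⟨C, hC, fun s hs hs1 u G hu hG hw => ?_⟩
  have hui := hu.integrable one_le_two
  have key := h s hs hs1 u G hui (hG.integrable one_le_two) hw
  rw [lintegral_enorm_sq_eq hu, lintegral_enorm_sq_eq hG,
    ← ofReal_integral_norm_eq_lintegral_enorm hui,
    ← ENNReal.ofReal_pow (integral_nonneg fun _ => norm_nonneg _),
    ← ENNReal.ofReal_mul (by positivity), ← ENNReal.ofReal_mul (by positivity),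
    ← ENNReal.ofReal_add
      (mul_nonneg (by positivity) (integral_nonneg fun _ => sq_nonneg _)) (by positivity),
    ENNReal.ofReal_le_ofReal_iff (add_nonneg
      (mul_nonneg (by positivity) (integral_nonneg fun _ => sq_nonneg _)) (by positivity))] at key
  simpa only [Real.norm_eq_abs, sq_abs] using key

/-- The derivative of `s ↦ s - k arctan (s / k)`. -/
noncomputable def coreWeight (k s : ℝ) : ℝ := 1 - 1 / (1 + (s / k) ^ 2)

theorem continuous_coreWeight (k : ℝ) : Continuous (coreWeight k) := by
  refine continuous_const.sub (continuous_const.div (by fun_prop) fun s => ?_)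
  positivity

theorem coreWeight_nonneg (k s : ℝ) : 0 ≤ coreWeight k s := by
  rw [coreWeight, sub_nonneg, div_le_one (by positivity)]
  linarith [sq_nonneg (s / k)]

theorem coreWeight_le_one (k s : ℝ) : coreWeight k s ≤ 1 := by
  rw [coreWeight, sub_le_self_iff]
  positivity

theorem abs_coreWeight_le (k s : ℝ) : |coreWeight k s| ≤ 1 := by
  rw [abs_of_nonneg (coreWeight_nonneg k s)]
  exact coreWeight_le_one k s

theorem hasDerivAt_sub_arctan {k : ℝ} (hk : 0 < k) (s : ℝ) :
    HasDerivAt (fun s => s - k * Real.arctan (s / k)) (coreWeight k s) s := by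
  refine ((hasDerivAt_id s).sub (((hasDerivAt_id s).div_const k).arctan.const_mul k)).congr_deriv ?_
  rw [coreWeight]
  simp only [id]
  field_simp

/-- The weight is at most 1 and at most (s/k)², so for q ≤ 1 its square lies below (|s|/k)^(2q) both
inside and outside the core. The degenerate dissipation |s|^(2q) thus controls k^(2q) times the
squared weight. -/
theorem coreWeight_sq_mul_rpow_le {k q : ℝ} (hk : 0 < k) (hq : 0 < q) (hq1 : q ≤ 1) (s : ℝ) :
    coreWeight k s ^ 2 * k ^ (2 * q) ≤ |s| ^ (2 * q) := by
  have hx : 0 ≤ |s| / k := by positivity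
  have e : |s| ^ (2 * q) = (|s| / k) ^ (2 * q) * k ^ (2 * q) := by
    rw [← Real.mul_rpow hx hk.le, div_mul_cancel₀ _ hk.ne']
  rw [e]
  gcongr
  have h0 := coreWeight_nonneg k s
  have h1 := coreWeight_le_one k s
  rcases le_total 1 (|s| / k) with h | h
  · exact (pow_le_one₀ h0 h1).trans (Real.one_le_rpow h (by positivity))
  · have h2 : coreWeight k s ≤ (|s| / k) ^ 2 := by
      have e2 : (s / k) ^ 2 = (|s| / k) ^ 2 := by rw [div_pow, div_pow, sq_abs]
      rw [coreWeight, e2, sub_le_iff_le_add, ← sub_le_iff_le_add', le_div_iff₀ (by positivity)]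
      nlinarith [sq_nonneg ((|s| / k) ^ 2)]
    have h3 : (|s| / k) ^ 2 ≤ (|s| / k) ^ (2 * q) := by
      rw [← Real.rpow_natCast]
      refine Real.rpow_le_rpow_of_exponent_ge_of_imp hx h ?_ ?_
      · push_cast; linarith
      · intro _ h'; norm_num at h'
    calc coreWeight k s ^ 2 ≤ coreWeight k s := by nlinarith
      _ ≤ _ := h2.trans h3

/-- Poincaré's inequality for a function that is controlled only where it is large. -/
theorem IsBoundedLipschitzDomain.exists_variance_le (hd : 0 < d)
    (hΩ : IsBoundedLipschitzDomain Ω) :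
    ∃ C > 0, ∀ k : ℝ, 0 < k → ∀ (u : E d → ℝ) (G : E d → E d),
      MemLp u 2 (volume.restrict Ω) → MemLp G 2 (volume.restrict Ω) → HasWeakGradient Ω u G →
      volume.real Ω * (∫ x in Ω, u x ^ 2) - (∫ x in Ω, u x) ^ 2
        ≤ C * (∫ x in Ω, coreWeight k (u x) ^ 2 * ‖G x‖ ^ 2) + 16 * k ^ 2 * volume.real Ω ^ 2 := by
  have : IsFiniteMeasure (volume.restrict Ω) := ⟨by simpa using hΩ.isBounded.measure_lt_top⟩
  have hvol : volume Ω ≠ ⊤ := hΩ.isBounded.measure_lt_top.ne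
  obtain ⟨C, hC, h⟩ := hΩ.linked_self hd
  refine ⟨C.toReal + 1, by positivity, fun k hk u G hu hG hw => ?_⟩
  set ν := volume.restrict Ω with hν
  set V₀ := volume.real Ω with hV₀
  have hV : ν univ = ENNReal.ofReal V₀ := by
    rw [hν, Measure.restrict_apply_univ, hV₀, measureReal_def, ENNReal.ofReal_toReal hvol]
  have hVr : ν.real univ = V₀ := by rw [measureReal_def, hV, ENNReal.toReal_ofReal measureReal_nonneg]
  have hui := hu.integrable one_le_two
  have hu2 := hu.integrable_sq
  -- θ differs from the identity by at most 2k, and its derivative is the weight. The Poincaré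
  -- inequality is applied to θ(u); going back to u costs 2(4k)² = 32k² per pair of points, halved
  -- at the end because the double integral is twice the variance expression.
  set θ : ℝ → ℝ := fun s => s - k * Real.arctan (s / k) with hθ
  have hθd := hasDerivAt_sub_arctan hk
  have hθc : Continuous θ := continuous_iff_continuousAt.2 fun s => (hθd s).continuousAt
  have hθs (s : ℝ) : |s - θ s| ≤ 2 * k := by
    have h1 : |Real.arctan (s / k)| < Real.pi / 2 :=
      abs_lt.2 ⟨Real.neg_pi_div_two_lt_arctan _, Real.arctan_lt_pi_div_two _⟩
    have e : s - θ s = k * Real.arctan (s / k) := by simp [hθ]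
    rw [e, abs_mul, abs_of_pos hk]
    nlinarith [Real.pi_lt_four]
  have hθi : Integrable (fun x => θ (u x)) ν := by
    refine (hui.abs.add (integrable_const (2 * k))).mono' (hθc.comp_aestronglyMeasurable hu.1)
      (Eventually.of_forall fun x => ?_)
    have := abs_sub_abs_le_abs_sub (θ (u x)) (u x)
    rw [abs_sub_comm (θ (u x))] at this
    simp only [Pi.add_apply, Real.norm_eq_abs]
    linarith [hθs (u x)]
  have hχG : MemLp (fun x => coreWeight k (u x) • G x) 2 ν := by
    refine hG.of_le ((continuous_coreWeight k).comp_aestronglyMeasurable hu.1 |>.smul hG.1)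
      (Eventually.of_forall fun x => ?_)
    rw [norm_smul]
    exact mul_le_of_le_one_left (norm_nonneg _) (abs_coreWeight_le _ _)
  have key := h _ _ hθi (hχG.integrable one_le_two) (HasWeakGradient.comp hΩ.isOpen hui
    (hG.integrable one_le_two) hw hθd (continuous_coreWeight k) (abs_coreWeight_le k))
  rw [lintegral_enorm_sq_eq hχG] at key
  simp only [norm_smul, mul_pow, Real.norm_eq_abs, sq_abs] at key
  set I := ∫ x in Ω, coreWeight k (u x) ^ 2 * ‖G x‖ ^ 2 with hI
  have hI0 : 0 ≤ I := integral_nonneg fun x => by positivity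
  have hqi (a b c : ℝ) : Integrable (fun y => a * u y ^ 2 + b * u y + c) ν :=
    ((hu2.const_mul a).add (hui.const_mul b)).add (integrable_const c)
  have hq (a b c : ℝ) : ∫ y, (a * u y ^ 2 + b * u y + c) ∂ν
      = a * (∫ y, u y ^ 2 ∂ν) + b * (∫ y, u y ∂ν) + c * V₀ := by
    rw [integral_add (f := fun y => a * u y ^ 2 + b * u y)
      ((hu2.const_mul a).add (hui.const_mul b)) (integrable_const c),
      integral_add (hu2.const_mul a) (hui.const_mul b), integral_const_mul, integral_const_mul,
      integral_const, hVr, smul_eq_mul, mul_comm V₀]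
  have hsq (x : E d) : (fun y => (u x - u y) ^ 2)
      = fun y => 1 * u y ^ 2 + (-2 * u x) * u y + u x ^ 2 := by
    ext y; ring
  have hini (x : E d) : Integrable (fun y => (u x - u y) ^ 2) ν := hsq x ▸ hqi _ _ _
  have hin : (fun x => ∫ y, (u x - u y) ^ 2 ∂ν)
      = fun x => V₀ * u x ^ 2 + (-2 * ∫ y, u y ∂ν) * u x + ∫ y, u y ^ 2 ∂ν := by
    ext x
    rw [hsq, hq]
    ring
  have houti : Integrable (fun x => ∫ y, (u x - u y) ^ 2 ∂ν) ν := hin ▸ hqi _ _ _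
  have hout : ∫ x, ∫ y, (u x - u y) ^ 2 ∂ν ∂ν
      = 2 * (V₀ * (∫ x, u x ^ 2 ∂ν) - (∫ x, u x ∂ν) ^ 2) := by
    rw [hin, hq]
    ring
  have hpt (x y : E d) : ENNReal.ofReal ((u x - u y) ^ 2)
      ≤ 2 * ‖θ (u x) - θ (u y)‖ₑ ^ 2 + ENNReal.ofReal (32 * k ^ 2) := by
    rw [← ofReal_norm, ← ENNReal.ofReal_pow (norm_nonneg _), Real.norm_eq_abs, sq_abs,
      show (2 : ℝ≥0∞) = ENNReal.ofReal 2 by simp, ← ENNReal.ofReal_mul (by norm_num),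
      ← ENNReal.ofReal_add (by positivity) (by positivity)]
    refine ENNReal.ofReal_le_ofReal ?_
    have h1 := abs_le.1 (hθs (u x))
    have h2 := abs_le.1 (hθs (u y))
    have h3 : ((u x - θ (u x)) - (u y - θ (u y))) ^ 2 ≤ (4 * k) ^ 2 :=
      sq_le_sq.2 (by rw [abs_of_pos (show (0 : ℝ) < 4 * k by positivity)]
                     exact abs_le.2 ⟨by linarith, by linarith⟩)
    nlinarith [sq_nonneg ((θ (u x) - θ (u y)) - ((u x - θ (u x)) - (u y - θ (u y))))]
  have hfin : ENNReal.ofReal (2 * (V₀ * (∫ x, u x ^ 2 ∂ν) - (∫ x, u x ∂ν) ^ 2))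
      ≤ ENNReal.ofReal (2 * (C.toReal * I) + 32 * k ^ 2 * V₀ ^ 2) := by
    rw [← hout, ofReal_integral_eq_lintegral_ofReal houti
      (Eventually.of_forall fun x => integral_nonneg fun y => sq_nonneg _)]
    calc ∫⁻ x, ENNReal.ofReal (∫ y, (u x - u y) ^ 2 ∂ν) ∂ν
        ≤ ∫⁻ x, (2 * (∫⁻ y, ‖θ (u x) - θ (u y)‖ₑ ^ 2 ∂ν) + ENNReal.ofReal (32 * k ^ 2) * ν univ) ∂ν := by
          refine lintegral_mono fun x => ?_
          rw [ofReal_integral_eq_lintegral_ofReal (hini x)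
            (Eventually.of_forall fun y => sq_nonneg _)]
          refine (lintegral_mono fun y => hpt x y).trans_eq ?_
          rw [lintegral_add_right _ measurable_const, lintegral_const_mul' _ _ (by simp),
            lintegral_const]
      _ = 2 * (∫⁻ x, ∫⁻ y, ‖θ (u x) - θ (u y)‖ₑ ^ 2 ∂ν ∂ν)
          + ENNReal.ofReal (32 * k ^ 2) * ν univ * ν univ := by
          rw [lintegral_add_right _ measurable_const, lintegral_const_mul' _ _ (by simp),
            lintegral_const]
      _ ≤ 2 * (C * ENNReal.ofReal I) + ENNReal.ofReal (32 * k ^ 2) * ν univ * ν univ := by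
          gcongr
      _ = _ := by
          rw [hV, ENNReal.ofReal_add (by positivity) (by positivity), ENNReal.ofReal_mul zero_le_two,
            ENNReal.ofReal_mul ENNReal.toReal_nonneg, ENNReal.ofReal_toReal hC,
            ENNReal.ofReal_ofNat, mul_assoc (ENNReal.ofReal (32 * k ^ 2)), ← sq,
            ← ENNReal.ofReal_pow measureReal_nonneg,
            ← ENNReal.ofReal_mul (p := 32 * k ^ 2) (by positivity)]
  rw [ENNReal.ofReal_le_ofReal_iff (by positivity)] at hfin
  nlinarith

end

/-! ### The L² bound, independent of the initial datum. -/

section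

variable {d : ℕ} {Ω : Set (E d)} {J : E d → ℝ} {F : ℝ → ℝ} {q : ℝ}

/-- The superlinear growth survives when half of the convexity constant is subtracted, possibly
with a smaller exponent. -/
theorem exists_rpow_le_of_superlinear (hF : SuperlinearAssumption Ω J F q) {c₀ : ℝ} (hc₀ : 0 < c₀)
    (h : ∀ s : ℝ, c₀ ≤ deriv (deriv F) s + sInf (aCoef Ω J '' Ω)) :
    ∃ c > 0, ∃ q' : ℝ, 0 < q' ∧ q' ≤ 1 ∧ ∀ s : ℝ,
      c * |s| ^ (2 * q') ≤ deriv (deriv F) s + sInf (aCoef Ω J '' Ω) - c₀ / 2 := by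
  obtain ⟨hq, c₅, c₆, hc₅, hc₆, hs⟩ := hF
  -- The conclusion is the convex combination, with weight l, of the superlinear bound and the bound
  -- by c₀; l is such that the constants lost amount to exactly c₀/2.
  set l := c₀ / (2 * (c₀ + c₅ + c₆)) with hl
  have hl0 : 0 < l := by positivity
  have hl' : l * (c₀ + c₅ + c₆) = c₀ / 2 := by rw [hl]; field_simp
  have hl1 : l ≤ 1 := by
    rw [hl, div_le_one (by positivity)]; linarith
  refine ⟨l * c₅, by positivity, min q 1, lt_min hq one_pos, min_le_right _ _, fun s => ?_⟩
  have h1 : |s| ^ (2 * min q 1) - 1 ≤ |s| ^ (2 * q) := by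
    have hp : 0 < 2 * min q 1 := by have := lt_min hq one_pos; linarith
    rcases le_total 1 |s| with hs1 | hs1
    · have := Real.rpow_le_rpow_of_exponent_le hs1
        (show 2 * min q 1 ≤ 2 * q by linarith [min_le_left q 1])
      linarith
    · have h2 := Real.rpow_le_one (abs_nonneg s) hs1 hp.le
      have h3 := Real.rpow_nonneg (abs_nonneg s) (2 * q)
      linarith
  have h2 : c₅ * (|s| ^ (2 * min q 1) - 1) ≤ c₅ * |s| ^ (2 * q) :=
    mul_le_mul_of_nonneg_left h1 hc₅.le
  have h3 := mul_le_mul_of_nonneg_left ((sub_le_sub_right h2 c₆).trans (hs s)) hl0.le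
  have h4 := mul_le_mul_of_nonneg_left (h s) (sub_nonneg.2 hl1)
  nlinarith

theorem primitive_primitive_one (s : ℝ) : primitive (primitive fun _ => 1) s = s ^ 2 / 2 := by
  have : (primitive fun _ => (1 : ℝ)) = fun u => u := by ext u; simp [primitive]
  rw [this]
  simp [primitive]

theorem sq_integral_le_of_mem_Y {m : ℝ} (hV : 0 < volume.real Ω) {ψ : H Ω}
    (hψ : ψ ∈ Y Ω F m) : (∫ x in Ω, ψ x) ^ 2 ≤ (m * volume.real Ω) ^ 2 := by
  have h := hψ.2
  rw [average_eq, measureReal_restrict_apply_univ, smul_eq_mul, abs_mul, abs_inv, abs_of_pos hV,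
    inv_mul_le_iff₀ hV] at h
  have h0 : 0 ≤ m * volume.real Ω := (abs_nonneg _).trans (h.trans_eq (mul_comm _ _))
  refine sq_le_sq.2 ?_
  rw [abs_of_nonneg h0, mul_comm]
  exact h

/-- The `L²` norm of a solution is bounded after a short time, uniformly in the initial datum. -/
theorem exists_integral_sq_le_of_global (hd : 0 < d) (hΩ : IsBoundedLipschitzDomain Ω)
    (hJ : KernelAssumption Ω J) (hF : ConvexityAssumption Ω J F)
    (hF' : SuperlinearAssumption Ω J F q) (m : ℝ) {τ : ℝ} (hτ : 0 < τ) (hτ1 : τ ≤ 1) :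
    ∃ C > 0, ∀ φ₀ ∈ Y Ω F m, ∀ φ : ℝ → H Ω, IsGlobalWeakSolution Ω J F q φ₀ φ → ∀ t, τ ≤ t →
      ∫ x in Ω, φ t x ^ 2 ≤ C := by
  have hvol : volume Ω ≠ ⊤ := hΩ.isBounded.measure_lt_top.ne
  have : IsFiniteMeasure (volume.restrict Ω) := ⟨by simpa using hvol.lt_top⟩
  obtain ⟨hJ1, K, hK, hJK⟩ := hJ.memW11
  rw [memLp_one_iff_integrable] at hJ1 hK
  obtain ⟨c₀, hc₀, hlow⟩ := hF.lower
  obtain ⟨c, hc, q', hq', hq'1, hgrow⟩ := exists_rpow_le_of_superlinear hF' hc₀ hlow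
  obtain ⟨C, hC, hP⟩ := hΩ.exists_variance_le hd
  set V₀ := volume.real Ω with hV₀
  have hV : 0 < V₀ := ENNReal.toReal_pos
    (hΩ.isOpen.measure_pos volume hΩ.isConnected.nonempty).ne' hvol
  set D := 3 * (∫ y, ‖K y‖) ^ 2 / c₀ with hD
  have hD0 : 0 ≤ D := by positivity
  set σ := 1 / q' with hσ
  have hσ0 : 0 < σ := by positivity
  -- The dissipation will carry the coefficient P/δ. By Poincaré, P V₀/C of it must cover the source
  -- D and supply the damping (σ+1)y/δ, where y is half the squared L² norm.
  set P := C * ((σ + 1) / 2 + D) / V₀ with hPdef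
  have hP0 : 0 < P := by positivity
  have hPV : P * V₀ = C * ((σ + 1) / 2 + D) := by rw [hPdef]; field_simp
  set Q := (P / c) ^ σ with hQ
  have hQ0 : 0 < Q := by positivity
  set b := P * ((m * V₀) ^ 2 + 16 * Q * V₀ ^ 2) / C with hb
  have hb0 : 0 < b := by positivity
  refine ⟨4 * b * τ ^ (-σ), by positivity, fun φ₀ hφ₀ φ hφ t₁ ht₁ => ?_⟩
  -- The clock is restarted a time τ before t₁, which makes the bound uniform in t₁.
  set t₀ := t₁ - τ with ht₀
  have ht₀0 : 0 ≤ t₀ := by linarith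
  have hT : 0 < t₁ + 1 := by linarith
  have hsol := hφ.2 (t₁ + 1) hT
  have hmass (t) (h0 : 0 ≤ t) (h1 : t ≤ t₁) : (∫ x in Ω, φ t x) ^ 2 ≤ (m * V₀) ^ 2 := by
    rw [hsol.integral_eq hvol h0 (by linarith), hφ.1]
    exact sq_integral_le_of_mem_Y hV hφ₀
  have hone : ∀ s : ℝ, |(fun _ : ℝ => (1 : ℝ)) s| ≤ 1 := by simp
  set y : ℝ → ℝ := fun t => ∫ x in Ω, primitive (primitive fun _ => 1) (φ t x) with hy
  have hyeq (t) : y t = (∫ x in Ω, φ t x ^ 2) / 2 := by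
    simp only [hy, primitive_primitive_one, integral_div]
  have hyc : ContinuousOn y (Icc t₀ t₁) :=
    (continuous_integral_primitive_primitive continuous_const hone).comp_continuousOn
      (hsol.continuousOn.mono (Icc_subset_Icc ht₀0 (by linarith)))
  have hmain := le_rpow_of_integral_inequality (y := y) (σ := σ) (b := b)
    (show t₀ < t₁ by linarith) hσ0 hb0 hyc ?_
  · rw [hyeq, ht₀, sub_sub_cancel] at hmain
    linarith
  intro r s hr hrs hs
  have hBc : ContinuousOn (fun t => b * (t - t₀) ^ (-σ - 1) - (σ + 1) / (t - t₀) * y t)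
      (Icc r s) := by
    have hne : ∀ t ∈ Icc r s, t - t₀ ≠ 0 := fun t ht => by linarith [ht.1]
    refine ContinuousOn.sub (continuousOn_const.mul ?_) (ContinuousOn.mul ?_ ?_)
    · exact ContinuousOn.rpow_const (by fun_prop) fun t ht => Or.inl (hne t ht)
    · exact continuousOn_const.div (by fun_prop) hne
    · exact hyc.mono (Icc_subset_Icc hr.le hs)
  have hin := hsol.integral_primitive_sub_le hΩ.isOpen hvol hJ1 hK hJK hF hc₀
    (ρ := fun _ => 1) continuous_const hone (fun a b => by nlinarith [sq_nonneg a])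
    (ht₀0.trans_lt hr) hrs (by linarith) hBc ?_
  · simpa only [one_pow, hy] using hin
  intro t ht
  have hδ0 : 0 < t - t₀ := by linarith [ht.1]
  have hδ1 : t - t₀ ≤ 1 := by linarith [ht.2]
  set δ := t - t₀ with hδ
  -- The level is tied to the elapsed time by c k^(2q') = P/δ. The Poincaré error k² is then Q
  -- δ^(-σ) with σ = 1/q', exactly of the order allowed by the comparison lemma.
  set k := (P / (c * δ)) ^ (1 / (2 * q')) with hk
  have hk0 : 0 < k := by positivity
  have hkq : k ^ (2 * q') = P / (c * δ) := by
    rw [hk, ← Real.rpow_mul (by positivity), one_div_mul_cancel (by positivity), Real.rpow_one]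
  have hk2 : k ^ 2 = Q * δ ^ (-σ) := by
    rw [hk, ← Real.rpow_natCast, ← Real.rpow_mul (by positivity), hQ, Real.rpow_neg hδ0.le,
      ← Real.inv_rpow hδ0.le, ← Real.mul_rpow (by positivity) (by positivity)]
    congr 1
    · field_simp
    · rw [hσ]; push_cast; field_simp
  have hχ2 (s : ℝ) : (√(P / δ) * coreWeight k s) ^ 2 = P / δ * coreWeight k s ^ 2 := by
    rw [mul_pow, Real.sq_sqrt (by positivity)]
  refine ⟨fun s => √(P / δ) * coreWeight k s, √(P / δ),
    continuous_const.mul (continuous_coreWeight k), fun s => ?_, fun s => ?_, fun G hG hw => ?_⟩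
  · rw [abs_mul, abs_of_nonneg (Real.sqrt_nonneg _)]
    exact mul_le_of_le_one_right (Real.sqrt_nonneg _) (abs_coreWeight_le k s)
  · rw [hχ2, one_pow, one_mul]
    refine le_trans ?_ (hgrow s)
    have e : P / δ * coreWeight k s ^ 2 = c * (coreWeight k s ^ 2 * k ^ (2 * q')) := by
      rw [hkq]; field_simp
    rw [e]
    exact mul_le_mul_of_nonneg_left (coreWeight_sq_mul_rpow_le hk0 hq' hq'1 s) hc.le
  · have hv := hP k hk0 (φ t) G (Lp.memLp _) hG hw
    have hm' := hmass t (by linarith [ht.1]) (by linarith [ht.2])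
    simp only [hχ2, mul_assoc (P / δ), integral_const_mul, one_pow, one_mul]
    rw [hyeq, hk2] at *
    set I := ∫ x in Ω, coreWeight k (φ t x) ^ 2 * ‖G x‖ ^ 2 with hI
    set S := ∫ x in Ω, φ t x ^ 2 with hS
    have hS0 : 0 ≤ S := integral_nonneg fun x => sq_nonneg _
    have hz : 1 ≤ δ ^ (-σ) := Real.one_le_rpow_of_pos_of_le_one_of_nonpos hδ0 hδ1 (by linarith)
    have hz' : δ ^ (-σ - 1) = δ ^ (-σ) / δ := by rw [Real.rpow_sub hδ0, Real.rpow_one]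
    rw [hz']
    set z := δ ^ (-σ) with hzd
    have h1 : V₀ * S - z * ((m * V₀) ^ 2 + 16 * Q * V₀ ^ 2) ≤ C * I := by
      linarith [mul_le_mul_of_nonneg_right hz (sq_nonneg (m * V₀))]
    have h2 : P * (V₀ * S - z * ((m * V₀) ^ 2 + 16 * Q * V₀ ^ 2)) ≤ P * (C * I) :=
      mul_le_mul_of_nonneg_left h1 hP0.le
    have hbC : b * C = P * ((m * V₀) ^ 2 + 16 * Q * V₀ ^ 2) := by rw [hb]; field_simp
    have h3 : C * (((σ + 1) / 2 + D) * S - z * b) ≤ C * (P * I) := by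
      have : C * (((σ + 1) / 2 + D) * S - z * b) = (P * V₀) * S - z * (b * C) := by
        rw [hPV]; ring
      rw [this, hbC]
      linarith
    have h4 := le_of_mul_le_mul_left h3 hC
    have h5 : D * S * δ ≤ D * S := mul_le_of_le_one_right (by positivity) hδ1
    have h6 : -(P * I) + D * S * δ ≤ b * z - (σ + 1) * (S / 2) := by linarith
    have h7 := div_le_div_of_nonneg_right h6 hδ0.le
    have e1 : (-(P * I) + D * S * δ) / δ = -(P / δ * I) + D * S := by field_simp
    have e2 : (b * z - (σ + 1) * (S / 2)) / δ = b * (z / δ) - (σ + 1) / δ * (S / 2) := by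
      field_simp
    rwa [e1, e2] at h7

end

/-! ### Moser iteration. -/

section

variable {d : ℕ} {Ω : Set (E d)} {J : E d → ℝ} {F : ℝ → ℝ} {q : ℝ}

/-- One step of the Moser iteration: a bound for a truncated power of order `j + 2` on a time
interval gives a bound for the truncated power of twice that order at the end of the interval. -/
theorem exists_integral_truncPow_le (hd : 0 < d) (hΩ : IsBoundedLipschitzDomain Ω)
    (hJ : KernelAssumption Ω J) (hF : ConvexityAssumption Ω J F) :
    ∃ A > 0, ∀ (φ₀ : H Ω) (φ : ℝ → H Ω), IsGlobalWeakSolution Ω J F q φ₀ φ →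
      ∀ (j : ℕ) (k M t₀ t₁ : ℝ), 0 < k → 0 < M → 0 ≤ t₀ → t₀ < t₁ → t₁ ≤ t₀ + 1 →
      (∀ t ∈ Icc t₀ t₁, ∫ x in Ω, primitive (primitive (truncPow k j)) (φ t x) ≤ M) →
      ∫ x in Ω, primitive (primitive (truncPow k (2 * (j + 1)))) (φ t₁ x)
        ≤ A * ((j : ℝ) + 2) ^ (2 * d + 4) * ((t₁ - t₀) ^ d)⁻¹ * M ^ 2 := by
  have hvol : volume Ω ≠ ⊤ := hΩ.isBounded.measure_lt_top.ne
  have : IsFiniteMeasure (volume.restrict Ω) := ⟨by simpa using hvol.lt_top⟩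
  obtain ⟨hJ1, K, hK, hJK⟩ := hJ.memW11
  rw [memLp_one_iff_integrable] at hJ1 hK
  obtain ⟨c₀, hc₀, hlow⟩ := hF.lower
  obtain ⟨C, hC, hN⟩ := hΩ.exists_integral_sq_le hd
  set D := 3 * (∫ y, ‖K y‖) ^ 2 / c₀ with hD
  have hD0 : 0 ≤ D := by positivity
  -- The Nash scale z = ε√δ/R is so small that (c₀/2) z⁻² dominates C times the source D R² plus the
  -- damping (d+1)/δ.
  set ε := min 1 √(c₀ / (2 * C * (D + d + 1))) with hε
  have hε0 : 0 < ε := lt_min one_pos (Real.sqrt_pos.2 (by positivity))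
  have hε1 : ε ≤ 1 := min_le_left _ _
  have hε2 : ε ^ 2 * (2 * C * (D + d + 1)) ≤ c₀ := by
    have h1 := pow_le_pow_left₀ hε0.le (min_le_right 1 √(c₀ / (2 * C * (D + d + 1)))) 2
    rw [Real.sq_sqrt (by positivity)] at h1
    rwa [← le_div_iff₀ (by positivity)]
  refine ⟨c₀ * ((ε ^ 2)⁻¹) ^ (d + 1), by positivity, ?_⟩
  intro φ₀ φ hφ j k M t₀ t₁ hk hM ht₀0 ht₀₁ ht₁ hbound
  set R : ℝ := (j : ℝ) + 2 with hR
  have hR1 : 1 ≤ R := by rw [hR]; linarith [(Nat.cast_nonneg j : (0 : ℝ) ≤ j)]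
  have hR0 : 0 < R := by linarith
  set b := c₀ / 2 * (R ^ 2 / ε ^ 2) ^ (d + 1) * ((j + 1) * M) ^ 2 with hb
  have hb0 : 0 < b := by positivity
  have hsol := hφ.2 (t₁ + 1) (by linarith)
  set ρ := truncPow k (j + 1) with hρ
  have hρc : Continuous ρ := continuous_truncPow _
  have hρM : ∀ s, |ρ s| ≤ k ^ (j + 1) := abs_truncPow_le _ hk.le
  have hρ2 : (fun s => ρ s ^ 2) = truncPow k (2 * (j + 1)) := funext fun s => truncPow_sq _ s
  set g := truncPow k (2 * (j + 1)) with hg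
  have hgc : Continuous g := continuous_truncPow _
  have hgM : ∀ s, |g s| ≤ k ^ (2 * (j + 1)) := abs_truncPow_le _ hk.le
  set y : ℝ → ℝ := fun t => ∫ x in Ω, primitive (primitive g) (φ t x) with hy
  have hyc : ContinuousOn y (Icc t₀ t₁) :=
    (continuous_integral_primitive_primitive hgc hgM).comp_continuousOn
      (hsol.continuousOn.mono (Icc_subset_Icc ht₀0 (by linarith)))
  -- The L¹ term of the Nash inequality, multiplied by z⁻², carries z^(-2(d+1)) ~ δ^(-d-1). This
  -- dictates σ = d.
  have hmain := le_rpow_of_integral_inequality (y := y) (σ := d) (b := b) ht₀₁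
    (by exact_mod_cast hd) hb0 hyc ?_
  · refine hmain.trans ?_
    have h0 : 0 < t₁ - t₀ := by linarith
    rw [Real.rpow_neg h0.le, Real.rpow_natCast]
    have e : c₀ * (ε ^ 2)⁻¹ ^ (d + 1) * R ^ (2 * d + 4) * ((t₁ - t₀) ^ d)⁻¹ * M ^ 2
        = c₀ * (R ^ 2 / ε ^ 2) ^ (d + 1) * (R * M) ^ 2 * ((t₁ - t₀) ^ d)⁻¹ := by
      have e' : R ^ (2 * d + 4) = (R ^ 2) ^ (d + 1) * R ^ 2 := by
        rw [← pow_mul, ← pow_add]; congr 1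
      rw [div_eq_mul_inv, mul_pow (R ^ 2), e']
      ring
    rw [e, hb]
    have h1 : ((j + 1) * M) ^ 2 ≤ (R * M) ^ 2 := by gcongr; linarith
    have h2 : 0 ≤ c₀ * (R ^ 2 / ε ^ 2) ^ (d + 1) * ((t₁ - t₀) ^ d)⁻¹ := by positivity
    linarith [mul_le_mul_of_nonneg_left h1 h2]
  intro r s hr hrs hs
  have hBc : ContinuousOn (fun t => b * (t - t₀) ^ (-(d : ℝ) - 1) - (d + 1) / (t - t₀) * y t)
      (Icc r s) := by
    have hne : ∀ t ∈ Icc r s, t - t₀ ≠ 0 := fun t ht => by linarith [ht.1]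
    refine ContinuousOn.sub (continuousOn_const.mul ?_) (ContinuousOn.mul ?_ ?_)
    · exact ContinuousOn.rpow_const (by fun_prop) fun t ht => Or.inl (hne t ht)
    · exact continuousOn_const.div (by fun_prop) hne
    · exact hyc.mono (Icc_subset_Icc hr.le hs)
  have hin := hsol.integral_primitive_sub_le hΩ.isOpen hvol hJ1 hK hJK hF hc₀ hρc hρM
    (truncPow_sq_mul_sq_le _ hk.le) (ht₀0.trans_lt hr) hrs (by linarith) hBc ?_
  · simpa only [hρ2, hy] using hin
  intro t ht
  have hχ2 (s : ℝ) : (√(c₀ / 2) * ρ s) ^ 2 = c₀ / 2 * ρ s ^ 2 := by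
    rw [mul_pow, Real.sq_sqrt (by positivity)]
  refine ⟨fun s => √(c₀ / 2) * ρ s, √(c₀ / 2) * k ^ (j + 1), continuous_const.mul hρc,
    fun s => ?_, fun s => ?_, fun G hG hw => ?_⟩
  · rw [abs_mul, abs_of_nonneg (Real.sqrt_nonneg _)]
    exact mul_le_mul_of_nonneg_left (hρM s) (Real.sqrt_nonneg _)
  · rw [hχ2, mul_comm]
    exact mul_le_mul_of_nonneg_left (by linarith [hlow s]) (sq_nonneg _)
  have hδ0 : 0 < t - t₀ := by linarith [ht.1]
  have hδ1 : t - t₀ ≤ 1 := by linarith [ht.2]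
  set u : E d → ℝ := ⇑(φ t) with hu_def
  have hu : MemLp u 2 (volume.restrict Ω) := Lp.memLp (φ t)
  have hω : MemLp (fun x => primitive ρ (u x)) 2 (volume.restrict Ω) :=
    hu.of_le_mul ((continuous_primitive hρc).comp_aestronglyMeasurable hu.1)
      (Eventually.of_forall fun x => abs_primitive_le hρc hρM _)
  have hρG : MemLp (fun x => ρ (u x) • G x) 2 (volume.restrict Ω) := by
    refine hG.of_le_mul (c := k ^ (j + 1)) ((hρc.comp_aestronglyMeasurable hu.1).smul hG.1)
      (Eventually.of_forall fun x => ?_)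
    rw [norm_smul]
    exact mul_le_mul_of_nonneg_right (hρM _) (norm_nonneg _)
  set δ := t - t₀ with hδ
  set z := ε * √δ / R with hz
  have hz0 : 0 < z := by have := Real.sqrt_pos.2 hδ0; positivity
  have hz1 : z ≤ 1 := by
    rw [hz, div_le_one hR0]
    have := Real.sqrt_le_one.2 hδ1
    exact (mul_le_one₀ hε1 (Real.sqrt_nonneg _) this).trans hR1
  have hnash := hN z hz0 hz1 _ _ hω hρG (HasWeakGradient.comp hΩ.isOpen
    (hu.integrable one_le_two) (hG.integrable one_le_two) hw (hasDerivAt_primitive hρc) hρc hρM)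
  simp only [norm_smul, mul_pow, Real.norm_eq_abs, sq_abs] at hnash
  have hppi := integrable_primitive_primitive (continuous_truncPow (k := k) j)
    (abs_truncPow_le j hk.le) (φ t)
  have hNM : ∫ x in Ω, |primitive ρ (u x)| ≤ (j + 1) * M := by
    calc ∫ x in Ω, |primitive ρ (u x)|
        ≤ ∫ x in Ω, (j + 1) * primitive (primitive (truncPow k j)) (u x) :=
          integral_mono (hω.integrable one_le_two).abs (hppi.const_mul _)
            fun x => abs_primitive_truncPow_succ_le j hk.le _
      _ ≤ _ := by
          rw [integral_const_mul]
          exact mul_le_mul_of_nonneg_left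
            (hbound t ⟨by linarith [ht.1], by linarith [ht.2]⟩) (by positivity)
  have hWT : ∫ x in Ω, ρ (u x) ^ 2 * u x ^ 2 ≤ R ^ 2 * ∫ x in Ω, primitive ρ (u x) ^ 2 := by
    rw [← integral_const_mul]
    refine integral_mono ?_ (hω.integrable_sq.const_mul _) fun x => ?_
    · refine hu.integrable_sq.bdd_mul (c := (k ^ (j + 1)) ^ 2)
        ((hρc.pow 2).comp_aestronglyMeasurable hu.1) (Eventually.of_forall fun x => ?_)
      rw [norm_pow]
      exact pow_le_pow_left₀ (norm_nonneg _) (hρM _) 2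
    · refine (truncPow_sq_mul_sq_le_primitive (j + 1) hk.le (u x)).trans (le_of_eq ?_)
      rw [hR, hρ]
      push_cast
      ring
  have hWy : 2 * y t ≤ ∫ x in Ω, primitive ρ (u x) ^ 2 := by
    rw [hy, ← integral_const_mul]
    exact integral_mono ((integrable_primitive_primitive hgc hgM (φ t)).const_mul 2)
      hω.integrable_sq fun x => two_mul_primitive_primitive_le (j + 1) hk.le _
  have hy0 : 0 ≤ y t :=
    integral_nonneg fun x => primitive_primitive_truncPow_nonneg _ hk.le _
  have hN0 : 0 ≤ ∫ x in Ω, |primitive ρ (u x)| := integral_nonneg fun x => abs_nonneg _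
  simp only [hχ2, mul_assoc (c₀ / 2), integral_const_mul]
  set N := ∫ x in Ω, |primitive ρ (u x)| with hNdef
  set W := ∫ x in Ω, primitive ρ (u x) ^ 2 with hW
  set I := ∫ x in Ω, ρ (u x) ^ 2 * ‖G x‖ ^ 2 with hI
  set S := ∫ x in Ω, ρ (u x) ^ 2 * u x ^ 2 with hS
  have hW0 : 0 ≤ W := by linarith
  set X := R ^ 2 / ε ^ 2 / δ with hX
  have hX0 : 0 < X := by positivity
  have hzX : z ^ 2 = X⁻¹ := by
    rw [hz, hX, div_pow, mul_pow, Real.sq_sqrt hδ0.le]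
    field_simp
  have hzd : (z ^ d)⁻¹ ^ 2 = X ^ d := by
    rw [inv_pow, ← pow_mul, mul_comm d, pow_mul, hzX, inv_pow, inv_inv]
  rw [hzX, hzd] at hnash
  have hXd : X ^ (d + 1) = (R ^ 2 / ε ^ 2) ^ (d + 1) * (δ ^ (d + 1))⁻¹ := by
    rw [hX, div_pow, div_eq_mul_inv]
  have hpow : δ ^ (-(d : ℝ) - 1) = (δ ^ (d + 1))⁻¹ := by
    rw [show -(d : ℝ) - 1 = -((d + 1 : ℕ) : ℝ) by push_cast; ring, Real.rpow_neg hδ0.le,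
      Real.rpow_natCast]
  rw [hpow]
  have h1 : X * W ≤ C * I + C * X ^ (d + 1) * N ^ 2 := by
    calc X * W ≤ X * (C * X⁻¹ * I + C * X ^ d * N ^ 2) := mul_le_mul_of_nonneg_left hnash hX0.le
      _ = C * I + C * X ^ (d + 1) * N ^ 2 := by rw [pow_succ X d]; field_simp
  have h2 : c₀ / 2 * X ^ (d + 1) * N ^ 2 ≤ b * (δ ^ (d + 1))⁻¹ := by
    have : N ^ 2 ≤ ((j + 1) * M) ^ 2 := pow_le_pow_left₀ hN0 hNM 2
    calc c₀ / 2 * X ^ (d + 1) * N ^ 2 ≤ c₀ / 2 * X ^ (d + 1) * ((j + 1) * M) ^ 2 := by gcongr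
      _ = _ := by rw [hXd, hb]; ring
  have h3 : (D * R ^ 2 + (d + 1) / δ) * C ≤ c₀ / 2 * X := by
    have e : c₀ / 2 * X = c₀ / ε ^ 2 / 2 * R ^ 2 / δ := by rw [hX]; field_simp
    have h4 : C * (D + d + 1) ≤ c₀ / ε ^ 2 / 2 := by
      rw [le_div_iff₀ two_pos, le_div_iff₀ (by positivity)]
      linarith
    rw [e, le_div_iff₀ hδ0]
    have e2 : (D * R ^ 2 + (d + 1) / δ) * C * δ = C * (D * R ^ 2) * δ + C * (d + 1) := by
      field_simp
    rw [e2]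
    have h5 : C * (D * R ^ 2) * δ ≤ C * (D * R ^ 2) := mul_le_of_le_one_right (by positivity) hδ1
    have h6 : C * (d + 1) ≤ C * (d + 1) * R ^ 2 :=
      le_mul_of_one_le_right (by positivity) (one_le_pow₀ hR1)
    linarith [mul_le_mul_of_nonneg_right h4 (sq_nonneg R)]
  have h7 : (D * R ^ 2 + (d + 1) / δ) * W ≤ c₀ / 2 * I + c₀ / 2 * X ^ (d + 1) * N ^ 2 := by
    refine le_of_mul_le_mul_left ?_ hC
    calc C * ((D * R ^ 2 + (d + 1) / δ) * W) = ((D * R ^ 2 + (d + 1) / δ) * C) * W := by ring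
      _ ≤ c₀ / 2 * X * W := mul_le_mul_of_nonneg_right h3 hW0
      _ = c₀ / 2 * (X * W) := by ring
      _ ≤ c₀ / 2 * (C * I + C * X ^ (d + 1) * N ^ 2) :=
          mul_le_mul_of_nonneg_left h1 (by positivity)
      _ = _ := by ring
  have h8 : (d + 1) / δ * y t ≤ (d + 1) / δ * W :=
    mul_le_mul_of_nonneg_left (by linarith) (by positivity)
  have h9 : D * S ≤ D * (R ^ 2 * W) := mul_le_mul_of_nonneg_left hWT hD0
  linarith

/-- A solution is bounded after a short time, uniformly in the initial datum. -/
theorem exists_ae_abs_le_of_global (hd : 0 < d) (hΩ : IsBoundedLipschitzDomain Ω)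
    (hJ : KernelAssumption Ω J) (hF : ConvexityAssumption Ω J F)
    (hF' : SuperlinearAssumption Ω J F q) (m : ℝ) {τ : ℝ} (hτ : 0 < τ) (hτ1 : τ ≤ 1) :
    ∃ C > 0, ∀ φ₀ ∈ Y Ω F m, ∀ φ : ℝ → H Ω, IsGlobalWeakSolution Ω J F q φ₀ φ → ∀ t, 2 * τ ≤ t →
      ∀ᵐ x ∂volume.restrict Ω, |φ t x| ≤ C := by
  have hvol : volume Ω ≠ ⊤ := hΩ.isBounded.measure_lt_top.ne
  have : IsFiniteMeasure (volume.restrict Ω) := ⟨by simpa using hvol.lt_top⟩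
  obtain ⟨C, hC, hL2⟩ := exists_integral_sq_le_of_global hd hΩ hJ hF hF' m hτ hτ1
  obtain ⟨A, hA, hstep⟩ := exists_integral_truncPow_le (q := q) hd hΩ hJ hF
  set B := A * (τ ^ d)⁻¹ with hB
  have hB0 : 0 < B := by positivity
  -- At step n one has j + 2 = 2^(n+1) and an interval of length τ/2^(n+1). The factors (j+2)^(2d+4)
  -- and the inverse d-th power of the length combine to L^(n+1).
  set L : ℝ := 2 ^ (3 * d + 4) with hL
  have hL1 : 1 ≤ L := one_le_pow₀ one_le_two
  have hL0 : 0 < L := by linarith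
  set N := B * L ^ 2 * C with hN
  have hN0 : 0 < N := by positivity
  set k := √(8 * N) with hk
  have hk0 : 0 < k := Real.sqrt_pos.2 (by positivity)
  refine ⟨k, hk0, fun φ₀ hφ₀ φ hφ t ht => ?_⟩
  -- The right side solves the recursion Mₙ₊₁ = B L^(n+1) Mₙ² exactly, and N is chosen so that M₀ =
  -- C. The starting times increase from τ, where the L² bound begins, and stay below 2τ.
  have hiter : ∀ n i : ℕ, i + 2 = 2 ^ (n + 1) → ∀ t, 2 * τ - τ / 2 ^ n ≤ t →
      ∫ x in Ω, primitive (primitive (truncPow k i)) (φ t x) ≤ N ^ 2 ^ n / (B * L ^ (n + 2)) := by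
    intro n
    induction n with
    | zero =>
      intro i hi t ht
      obtain rfl : i = 0 := by simpa using hi
      have h1 : truncPow k 0 = fun _ => 1 := by ext s; simp [truncPow]
      have h2 := hL2 φ₀ hφ₀ φ hφ t (by simp at ht; linarith)
      simp only [h1, primitive_primitive_one, integral_div]
      have h3 : N ^ 2 ^ 0 / (B * L ^ (0 + 2)) = C := by
        rw [hN]; simp; field_simp
      rw [h3]
      linarith [show 0 ≤ ∫ x in Ω, φ t x ^ 2 from integral_nonneg fun x => sq_nonneg _]
    | succ n ih =>
      intro i hi t ht
      have hp : 2 ^ (n + 1 + 1) = 2 * 2 ^ (n + 1) := pow_succ' 2 (n + 1)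
      have hp2 : 2 ≤ 2 ^ (n + 1) := by
        rw [pow_succ']; exact le_mul_of_one_le_right (by norm_num) Nat.one_le_two_pow
      obtain ⟨j, rfl, hj⟩ : ∃ j, i = 2 * (j + 1) ∧ j + 2 = 2 ^ (n + 1) :=
        ⟨i / 2 - 1, by omega, by omega⟩
      have hjR : (j : ℝ) + 2 = 2 ^ (n + 1) := by exact_mod_cast hj
      have hgap : 2 * τ - τ / 2 ^ n + τ / 2 ^ (n + 1) = 2 * τ - τ / 2 ^ (n + 1) := by
        rw [pow_succ]; field_simp; ring
      have hpos : 0 < τ / 2 ^ (n + 1) := by positivity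
      have hle : τ / 2 ^ (n + 1) ≤ 1 :=
        (div_le_self hτ.le (one_le_pow₀ one_le_two)).trans hτ1
      have hle2 : τ / 2 ^ n ≤ τ := div_le_self hτ.le (one_le_pow₀ one_le_two)
      have h := hstep φ₀ φ hφ j k (N ^ 2 ^ n / (B * L ^ (n + 2))) (t - τ / 2 ^ (n + 1)) t hk0
        (by positivity) (by linarith) (by linarith) (by linarith)
        fun s hs => ih j hj s (by linarith [hs.1])
      refine h.trans (le_of_eq ?_)
      rw [hjR, sub_sub_cancel]
      have e1 : A * (2 ^ (n + 1)) ^ (2 * d + 4) * ((τ / 2 ^ (n + 1)) ^ d)⁻¹ = B * L ^ (n + 1) := by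
        have e2 : L ^ (n + 1) = (2 ^ (n + 1)) ^ (2 * d + 4) * ((2 : ℝ) ^ (n + 1)) ^ d := by
          rw [hL, ← pow_mul, ← pow_mul, ← pow_mul, ← pow_add]
          congr 1
          ring
        rw [e2, hB, div_pow]
        field_simp
      have e3 : N ^ 2 ^ (n + 1) = (N ^ 2 ^ n) ^ 2 := by rw [← pow_mul, ← pow_succ]
      have e4 : L ^ (n + 2) = L ^ (n + 1) * L := pow_succ _ _
      have e5 : L ^ (n + 1 + 2) = L ^ (n + 1) * L * L := by rw [← pow_succ, ← pow_succ]
      have hLn : L ^ (n + 1) ≠ 0 := by positivity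
      rw [e1, e3, e4, e5]
      generalize L ^ (n + 1) = l at hLn ⊢
      field_simp
  set ν := volume.restrict Ω with hν
  -- With k² = 8N the powers of N cancel in Chebyshev's inequality, and 8^(2^n) ≥ 8^n beats the loss
  -- (i+2)² = 4·4^n.
  have hmeas (n : ℕ) : ν.real {x | k ≤ |φ t x|} ≤ 4 / B * (1 / 2) ^ n := by
    obtain ⟨i, hi⟩ : ∃ i, i + 2 = 2 ^ (n + 1) := by
      refine ⟨2 ^ (n + 1) - 2, Nat.sub_add_cancel ?_⟩
      rw [pow_succ']; exact le_mul_of_one_le_right (by norm_num) Nat.one_le_two_pow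
    have hiR : (i : ℝ) + 2 = 2 ^ (n + 1) := by exact_mod_cast hi
    have h1 := hiter n i hi t (by have : 0 < τ / 2 ^ n := by positivity
                                  linarith)
    have h2 := mul_meas_ge_le_integral_of_nonneg (μ := ν)
      (Eventually.of_forall fun x => primitive_primitive_truncPow_nonneg i hk0.le (φ t x))
      (integrable_primitive_primitive (continuous_truncPow i) (abs_truncPow_le i hk0.le) (φ t))
      (k ^ (i + 2) / ((i : ℝ) + 2) ^ 2)
    have h3 : ν.real {x | k ≤ |φ t x|} ≤ ν.real {x | k ^ (i + 2) / ((i : ℝ) + 2) ^ 2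
        ≤ primitive (primitive (truncPow k i)) (φ t x)} := by
      refine measureReal_mono fun x hx => ?_
      rw [mem_ofPred_eq, div_le_iff₀ (by positivity), mul_comm]
      exact pow_le_primitive_primitive_truncPow i hk0.le hx
    set a := ν.real {x | k ≤ |φ t x|} with ha
    have ha0 : 0 ≤ a := measureReal_nonneg
    have h4 : k ^ (i + 2) / ((i : ℝ) + 2) ^ 2 * a ≤ N ^ 2 ^ n / (B * L ^ (n + 2)) :=
      (mul_le_mul_of_nonneg_left h3 (by positivity)).trans (h2.trans h1)
    have hkp : k ^ (i + 2) = 8 ^ 2 ^ n * N ^ 2 ^ n := by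
      rw [hi, pow_succ', pow_mul, hk, Real.sq_sqrt (by positivity), mul_pow]
    have h5 : N ^ 2 ^ n / (B * L ^ (n + 2)) ≤ N ^ 2 ^ n / B :=
      div_le_div_of_nonneg_left (by positivity) hB0
        (le_mul_of_one_le_right hB0.le (one_le_pow₀ hL1))
    have h6 : (8 : ℝ) ^ n ≤ 8 ^ 2 ^ n :=
      pow_le_pow_right₀ (by norm_num) Nat.lt_two_pow_self.le
    have h7 := h4.trans h5
    rw [hkp, hiR, div_mul_eq_mul_div, div_le_div_iff₀ (by positivity) hB0] at h7
    have h8 : 8 ^ n * a * B ≤ (2 ^ (n + 1)) ^ 2 := by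
      have h9 : N ^ 2 ^ n * (8 ^ 2 ^ n * a * B) ≤ N ^ 2 ^ n * (2 ^ (n + 1)) ^ 2 := by linarith
      refine le_trans ?_ (le_of_mul_le_mul_left h9 (by positivity))
      gcongr
    have e : (8 : ℝ) ^ n = 4 ^ n * 2 ^ n := by rw [← mul_pow]; norm_num
    have e' : ((2 : ℝ) ^ (n + 1)) ^ 2 = 4 ^ n * 4 := by
      rw [← pow_mul, mul_comm, pow_mul, pow_succ]; norm_num
    rw [e, e'] at h8
    have h10 : 2 ^ n * a * B ≤ 4 := by
      refine le_of_mul_le_mul_left (a := (4 : ℝ) ^ n) ?_ (by positivity)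
      linarith
    rw [one_div, inv_pow, ← div_eq_mul_inv, div_div, le_div_iff₀ (by positivity)]
    linarith
  have hzero : ν.real {x | k ≤ |φ t x|} = 0 := by
    refine le_antisymm (ge_of_tendsto' (x := atTop) ?_ hmeas) measureReal_nonneg
    simpa using (tendsto_pow_atTop_nhds_zero_of_lt_one (by norm_num : (0 : ℝ) ≤ 1 / 2)
      (by norm_num)).const_mul (4 / B)
  have hnull : ν {x | k ≤ |φ t x|} = 0 := (measureReal_eq_zero_iff).1 hzero
  have : ∀ᵐ x ∂ν, ¬ k ≤ |φ t x| := measure_eq_zero_iff_ae_notMem.1 hnull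
  filter_upwards [this] with x hx
  exact (not_le.1 hx).le

end

end NonlocalCH

/-! ### Conclusion. -/

open NonlocalCH

theorem lemma2p7 {d : ℕ} (hd : d = 2 ∨ d = 3) (Ω : Set (E d))
    (hΩ : IsBoundedLipschitzDomain Ω) (J : E d → ℝ) (F : ℝ → ℝ) (p q : ℝ)
    (hJ : KernelAssumption Ω J) (hF2 : ConvexityAssumption Ω J F)
    (hF3 : CoercivityAssumption J F) (hF4 : GrowthAssumption F p)
    (hF5 : SuperlinearAssumption Ω J F q) (hq : d = 3 → 1 / 2 ≤ q) (hp : d = 3 → 6 / 5 < p)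
    (m : ℝ) (hm : 0 ≤ m) :
    (∀ τ > 0, ∃ C > 0, ∀ φ₀ ∈ Y Ω F m, ∀ φ : ℝ → H Ω, IsGlobalWeakSolution Ω J F q φ₀ φ →
      (⨆ t ∈ Set.Ici (2 * τ), eLpNorm (φ t) ∞ (volume.restrict Ω)) ≤ ENNReal.ofReal C) ∧
    ∃ R₀ > 0, IsAbsorbing Ω J F q m (ballLinfty Ω F m R₀) := by
  have hd0 : 0 < d := by omega
  have hvol : volume Ω ≠ ⊤ := hΩ.isBounded.measure_lt_top.ne
  have : IsFiniteMeasure (volume.restrict Ω) := ⟨by simpa using hvol.lt_top⟩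
  have hnorm {u : H Ω} {C : ℝ} (h : ∀ᵐ x ∂volume.restrict Ω, |u x| ≤ C) :
      eLpNorm u ⊤ (volume.restrict Ω) ≤ ENNReal.ofReal C := by
    rw [eLpNorm_exponent_top]
    exact eLpNormEssSup_le_of_ae_bound h
  refine ⟨fun τ hτ => ?_, ?_⟩
  -- The smoothing lemmas are stated for τ ≤ 1; a larger τ only shortens the range of times.
  · obtain ⟨C, hC, h⟩ := exists_ae_abs_le_of_global hd0 hΩ hJ hF2 hF5 m
      (lt_min hτ one_pos) (min_le_right τ 1)
    refine ⟨C, hC, fun φ₀ hφ₀ φ hφ => iSup₂_le fun t ht => hnorm (h φ₀ hφ₀ φ hφ t ?_)⟩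
    have ht' : 2 * τ ≤ t := ht
    linarith [min_le_left τ 1]
  · obtain ⟨C, hC, h⟩ := exists_ae_abs_le_of_global hd0 hΩ hJ hF2 hF5 m one_pos le_rfl
    -- With τ = 1 the entrance time is 2 for every B.
    refine ⟨C, hC, fun B hB _ => ⟨2, zero_le_two, ?_⟩⟩
    rintro t ht _ ⟨φ₀, hφ₀, φ, hφ, rfl⟩
    have hb := h φ₀ (hB hφ₀) φ hφ t (by linarith)
    -- Membership in Y_m: F is bounded on [-C, C], so F(φ) is integrable, and the mean value is
    -- conserved.
    refine ⟨⟨?_, ?_⟩, hnorm hb⟩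
    · have hFc : Continuous F := hF2.contDiff.continuous
      obtain ⟨M, hM⟩ := (isCompact_Icc (a := -C) (b := C)).exists_bound_of_continuousOn
        hFc.continuousOn
      refine (integrable_const M).mono' (hFc.comp_aestronglyMeasurable (Lp.memLp (φ t)).1) ?_
      filter_upwards [hb] with x hx
      exact hM _ (abs_le.1 hx)
    · have hmean := (hB hφ₀).2
      rw [average_eq] at hmean ⊢
      rwa [(hφ.2 (t + 1) (by linarith)).integral_eq hvol (by linarith) (by linarith), hφ.1]
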